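/- **Setting.** For a subset $S$ of a Banach space, $[S]$ denotes its closed linear span; $\mathcal B$, $\mathcal K$, $\mathcal B(\cdot)_*$ denote bounded operators, compact operators and normal functionals. Let $\mathcal C$ be a concrete monoidal $W^*$-category, i.e. a monoidal $W^*$-category (with normal bilinear $*$-preserving tensor bifunctor and unitary coherence isomorphisms) together with a normal strong monoidal $*$-functor, with unitary structure maps, to Hilbert spaces with the completed tensor product. Write $\mathcal H,\mathcal K,\mathcal L$ for the Hilbert spaces underlying the objects $H,K,L$, and suppress coherence isomorphisms and the functor. Let $c$ be a *regular* braiding on $\mathcal C$: all $c_{H,K}:H\otimes K\to K\otimes H$ are unitary, and $[(\mathrm{id}\otimes\omega)(c_{H,K})\mid \omega\in\mathcal B(\mathcal K,\mathcal H)_*]=\mathcal K(\mathcal H,\mathcal K)$ for all $H,K\in\mathcal C$. For $X\in\mathrm{End}_{\mathcal C}(H\otimes K)$ put $\hat A(X)=[(\mathrm{id}\otimes\omega)(X)\mid\omega\in\mathcal B(\mathcal K)_*]\subseteq\mathcal B(\mathcal H)$. The category $\hat A(\mathcal C)$ has as objects the pairs $(H,A)$ with $H\in\mathcal C$ and $A\subseteq\mathcal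 B(\mathcal H)$ a nondegenerate $C^*$-subalgebra of the form $A=\hat A(X)$; its morphisms $(H_1,A_1)\to(H_2,A_2)$ are the nondegenerate $*$-homomorphisms $A_1\to M(A_2)\subseteq\mathcal B(\mathcal H_2)$ of the form $a\mapsto V(\mathrm{id}_K\otimes a)V^*$ with an isometry $V\in\mathrm{Hom}_{\mathcal C}(K\otimes H_1,H_2)$, composed by means of the unique extension to multiplier algebras. It carries the tensor product $\boxtimes_c$ with $(H_1,A_1)\boxtimes_c(H_2,A_2)=(H_1\otimes H_2,[\alpha(A_1)\beta(A_2)])$, where $$\alpha(a_1)=a_1\boxtimes 1=c_{H_2,H_1}(\mathrm{id}\otimes a_1)c_{H_2,H_1}^{-1},\qquad \beta(a_2)=1\boxtimes a_2=\mathrm{id}\otimes a_2 ,$$ $\alpha$ and $\beta$ are morphisms of $\hat A(\mathcal C)$ into $A_1\boxtimes_c A_2$, and $(f\boxtimes_c g)(\alpha(a_1)\beta(a_2))=\alpha(f(a_1))\beta(g(a_2))$ for morphisms $f,g$; the associator is conjugation with that of $\mathcal C$. The tensor product $\boxtimes_{c^{-1}}$ is defined in the same way with the inverse braiding, so that then $a_1\boxtimes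 1=c_{H_1,H_2}^{-1}(\mathrm{id}\otimes a_1)c_{H_1,H_2}$. A *bi-simplifiable braided $C^*$-bialgebra* in $(\hat A(\mathcal C),\boxtimes)$ is an object $A$ with a morphism $\Delta:A\to A\boxtimes A$ of $\hat A(\mathcal C)$ that is coassociative, $(\Delta\boxtimes\mathrm{id})\Delta=(\mathrm{id}\boxtimes\Delta)\Delta$, and satisfies both Podleś conditions $A\boxtimes A=[\Delta(A)(A\boxtimes 1)]$ and $A\boxtimes A=[\Delta(A)(1\boxtimes A)]$. **Proposition.** Let $L\in\mathcal C$ and let $F\in\mathrm{End}_{\mathcal C}(L\otimes L)$ be a regular multiplicative unitary, that is, $F$ is unitary, $$F_{23}F_{12}=F_{12}\,(c_{L,L}^{-1})_{12}\,F_{23}\,(c_{L,L})_{12}\,F_{23},$$ and $[(\mathrm{id}\otimes\omega)(c_{L,L}^{-1}F)\mid\omega\in\mathcal B(\mathcal L)_*]=\mathcal K(\mathcal L)$. For $a\in\hat A(F)$ put $\hat\Delta^{\mathrm{op}}(a)=F^*(\mathrm{id}_L\otimes a)F$ and $\hat\Delta(a)=c_{L,L}\hat\Delta^{\mathrm{op}}(a)c_{L,L}^{-1}$.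 Then $(L,\hat A(F))$ is an object of $\hat A(\mathcal C)$, $(\hat A(F),\hat\Delta^{\mathrm{op}})$ is a bi-simplifiable braided $C^*$-bialgebra in $(\hat A(\mathcal C),\boxtimes_{c^{-1}})$, and $(\hat A(F),\hat\Delta)$ is a bi-simplifiable braided $C^*$-bialgebra in $(\hat A(\mathcal C),\boxtimes_c)$. In particular, the tensor products and the tensor product morphisms occurring here are well defined. -/

import Mathlib

open CategoryTheory MonoidalCategory
open scoped TensorProduct Topology

universe w v u

/-! ### `C⋆`-categories and `W⋆`-categories -/

/-- A `C⋆`-category: the morphism spaces are complex Banach spaces, composition is bilinear and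
submultiplicative, and there are isometric conjugate-linear involutions `adj` from `X ⟶ Y` to
`Y ⟶ X` that reverse composition and satisfy the `C⋆`-identity. -/
class CStarCategory (C : Type u) [Category.{v} C] where
  [homGroup : ∀ X Y : C, NormedAddCommGroup (X ⟶ Y)]
  [homSpace : ∀ X Y : C, NormedSpace ℂ (X ⟶ Y)]
  [homComplete : ∀ X Y : C, CompleteSpace (X ⟶ Y)]
  add_comp : ∀ {X Y Z : C} (f f' : X ⟶ Y) (g : Y ⟶ Z), (f + f') ≫ g = f ≫ g + f' ≫ g
  comp_add : ∀ {X Y Z : C} (f : X ⟶ Y) (g g' : Y ⟶ Z), f ≫ (g + g') = f ≫ g + f ≫ g'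
  smul_comp : ∀ {X Y Z : C} (r : ℂ) (f : X ⟶ Y) (g : Y ⟶ Z), (r • f) ≫ g = r • (f ≫ g)
  comp_smul : ∀ {X Y Z : C} (r : ℂ) (f : X ⟶ Y) (g : Y ⟶ Z), f ≫ (r • g) = r • (f ≫ g)
  norm_comp_le : ∀ {X Y Z : C} (f : X ⟶ Y) (g : Y ⟶ Z), ‖f ≫ g‖ ≤ ‖g‖ * ‖f‖
  adj : ∀ {X Y : C}, (X ⟶ Y) → (Y ⟶ X)
  adj_adj : ∀ {X Y : C} (f : X ⟶ Y), adj (adj f) = f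
  adj_add : ∀ {X Y : C} (f g : X ⟶ Y), adj (f + g) = adj f + adj g
  adj_smul : ∀ {X Y : C} (r : ℂ) (f : X ⟶ Y), adj (r • f) = (starRingEnd ℂ) r • adj f
  adj_comp : ∀ {X Y Z : C} (f : X ⟶ Y) (g : Y ⟶ Z), adj (f ≫ g) = adj g ≫ adj f
  norm_adj : ∀ {X Y : C} (f : X ⟶ Y), ‖adj f‖ = ‖f‖
  norm_comp_adj : ∀ {X Y : C} (f : X ⟶ Y), ‖f ≫ adj f‖ = ‖f‖ ^ 2

attribute [reducible] CStarCategory.homGroup CStarCategory.homSpace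

attribute [instance] CStarCategory.homGroup CStarCategory.homSpace CStarCategory.homComplete

open CStarCategory (adj)

/-- A morphism `f` is isometric if `f⋆ f = id`. -/
def IsIsometric {C : Type u} [Category.{v} C] [CStarCategory C] {X Y : C} (f : X ⟶ Y) : Prop :=
  f ≫ adj f = 𝟙 X

/-- A morphism `f` is unitary if `f⋆ f = id` and `f f⋆ = id`. -/
def IsUnitaryHom {C : Type u} [Category.{v} C] [CStarCategory C] {X Y : C} (f : X ⟶ Y) : Prop :=
  f ≫ adj f = 𝟙 X ∧ adj f ≫ f = 𝟙 Y

/-- A `W⋆`-category: a `C⋆`-category all of whose morphism spaces are dual Banach spaces. -/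
class WStarCategory (C : Type u) [Category.{v} C] extends CStarCategory C where
  predual : C → C → Type v
  [predualGroup : ∀ X Y : C, NormedAddCommGroup (predual X Y)]
  [predualSpace : ∀ X Y : C, NormedSpace ℂ (predual X Y)]
  [predualComplete : ∀ X Y : C, CompleteSpace (predual X Y)]
  toDual : ∀ X Y : C, (X ⟶ Y) ≃ₗᵢ[ℂ] StrongDual ℂ (predual X Y)

attribute [reducible] WStarCategory.predualGroup WStarCategory.predualSpace

attribute [instance] WStarCategory.predualGroup WStarCategory.predualSpace
  WStarCategory.predualComplete

/-- The ultraweak topology on a morphism space of a `W⋆`-category. -/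
@[reducible] noncomputable def ultraweakHom {C : Type u} [Category.{v} C] [WStarCategory C] (X Y : C) :
    TopologicalSpace (X ⟶ Y) :=
  TopologicalSpace.induced
    (fun (f : X ⟶ Y) (p : WStarCategory.predual X Y) => WStarCategory.toDual X Y f p) inferInstance

/-- A monoidal `W⋆`-category: the tensor product is a bilinear, `⋆`-preserving and (in each
variable) normal bifunctor, and the coherence isomorphisms are unitary. -/
class MonoidalWStarCategory (C : Type u) [Category.{v} C] [MonoidalCategory C] extends
    WStarCategory C where
  tensor_add : ∀ {X X' Y Y' : C} (f : X ⟶ X') (g g' : Y ⟶ Y'),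
    f ⊗ₘ (g + g') = (f ⊗ₘ g) + (f ⊗ₘ g')
  add_tensor : ∀ {X X' Y Y' : C} (f f' : X ⟶ X') (g : Y ⟶ Y'),
    (f + f') ⊗ₘ g = (f ⊗ₘ g) + (f' ⊗ₘ g)
  tensor_smul : ∀ {X X' Y Y' : C} (r : ℂ) (f : X ⟶ X') (g : Y ⟶ Y'),
    f ⊗ₘ (r • g) = r • (f ⊗ₘ g)
  smul_tensor : ∀ {X X' Y Y' : C} (r : ℂ) (f : X ⟶ X') (g : Y ⟶ Y'),
    (r • f) ⊗ₘ g = r • (f ⊗ₘ g)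
  adj_tensor : ∀ {X X' Y Y' : C} (f : X ⟶ X') (g : Y ⟶ Y'),
    CStarCategory.adj (f ⊗ₘ g) = CStarCategory.adj f ⊗ₘ CStarCategory.adj g
  normal_left : ∀ {X X' Y Y' : C} (g : Y ⟶ Y'),
    Continuous[ultraweakHom X X', ultraweakHom (X ⊗ Y) (X' ⊗ Y')] (fun f : X ⟶ X' => f ⊗ₘ g)
  normal_right : ∀ {X X' Y Y' : C} (f : X ⟶ X'),
    Continuous[ultraweakHom Y Y', ultraweakHom (X ⊗ Y) (X' ⊗ Y')] (fun g : Y ⟶ Y' => f ⊗ₘ g)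
  unitary_associator : ∀ X Y Z : C, IsUnitaryHom (α_ X Y Z).hom
  unitary_leftUnitor : ∀ X : C, IsUnitaryHom (λ_ X).hom
  unitary_rightUnitor : ∀ X : C, IsUnitaryHom (ρ_ X).hom

/-! ### Normal functionals on spaces of bounded operators -/

/-- Square-summable sequences of vectors. -/
def SqSummable {E : Type w} [NormedAddCommGroup E] (ξ : ℕ → E) : Prop :=
  Summable fun n => ‖ξ n‖ ^ 2

/-- `ω` is a normal linear functional on `B(E, G)`, i.e. an element of the predual `B(E, G)_*`:
it is of the form `T ↦ ∑ₙ ⟨ηₙ, T ξₙ⟩` with square-summable sequences `ξ` in `E`, `η` in `G`. -/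
def IsNormalFunctional {E G : Type w} [NormedAddCommGroup E] [InnerProductSpace ℂ E]
    [NormedAddCommGroup G] [InnerProductSpace ℂ G] (ω : (E →L[ℂ] G) → ℂ) : Prop :=
  ∃ (ξ : ℕ → E) (η : ℕ → G), SqSummable ξ ∧ SqSummable η ∧
    ∀ T : E →L[ℂ] G, ω T = ∑' n, inner ℂ (η n) (T (ξ n))

/-- The ultraweak topology on `B(E, G)`: the initial topology for the normal functionals. -/
@[reducible] noncomputable def ultraweakOp (E G : Type w) [NormedAddCommGroup E] [InnerProductSpace ℂ E]
    [NormedAddCommGroup G] [InnerProductSpace ℂ G] : TopologicalSpace (E →L[ℂ] G) :=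
  TopologicalSpace.induced
    (fun (T : E →L[ℂ] G) (ω : {ω : (E →L[ℂ] G) → ℂ // IsNormalFunctional ω}) => ω.1 T)
    inferInstance

/-- The closed linear span `[S]`. -/
def closedSpan {E : Type w} [NormedAddCommGroup E] [NormedSpace ℂ E] (S : Set E) :
    Submodule ℂ E :=
  (Submodule.span ℂ S).topologicalClosure

/-! ### Concrete monoidal `W⋆`-categories -/

/-- A normal linear `⋆`-functor from a `W⋆`-category to Hilbert spaces. -/
structure HilbFunctor (C : Type u) [Category.{v} C] [WStarCategory C] where
  obj : C → Type w
  [objGroup : ∀ X : C, NormedAddCommGroup (obj X)]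
  [objInner : ∀ X : C, InnerProductSpace ℂ (obj X)]
  [objComplete : ∀ X : C, CompleteSpace (obj X)]
  map : ∀ {X Y : C}, (X ⟶ Y) → (obj X →L[ℂ] obj Y)
  map_id : ∀ X : C, map (𝟙 X) = ContinuousLinearMap.id ℂ (obj X)
  map_comp : ∀ {X Y Z : C} (f : X ⟶ Y) (g : Y ⟶ Z), map (f ≫ g) = map g ∘L map f
  map_add : ∀ {X Y : C} (f g : X ⟶ Y), map (f + g) = map f + map g
  map_smul : ∀ {X Y : C} (r : ℂ) (f : X ⟶ Y), map (r • f) = r • map f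
  map_adj : ∀ {X Y : C} (f : X ⟶ Y), map (adj f) = ContinuousLinearMap.adjoint (map f)
  normal : ∀ X Y : C, Continuous[ultraweakHom X Y, ultraweakOp (obj X) (obj Y)]
    (fun f : X ⟶ Y => map f)

attribute [instance] HilbFunctor.objGroup HilbFunctor.objInner HilbFunctor.objComplete

/-- The structure that makes a monoidal `W⋆`-category concrete: a normal `⋆`-functor to Hilbert
spaces that is strong monoidal for the completed tensor product of Hilbert spaces, with unitary
structure maps. Equations between bounded operators on a completed tensor product are stated on
elementary tensors. -/
structure FibreFunctor (C : Type u) [Category.{v} C] [MonoidalCategory C]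
    [MonoidalWStarCategory C] extends HilbFunctor.{w} C where
  tensorIso : ∀ X Y : C,
    UniformSpace.Completion (obj X ⊗[ℂ] obj Y) ≃ₗᵢ[ℂ] obj (X ⊗ Y)
  unitIso : ℂ ≃ₗᵢ[ℂ] obj (𝟙_ C)
  tensorIso_natural : ∀ {X X' Y Y' : C} (f : X ⟶ X') (g : Y ⟶ Y') (ξ : obj X) (η : obj Y),
    map (f ⊗ₘ g) (tensorIso X Y ((ξ ⊗ₜ[ℂ] η : obj X ⊗[ℂ] obj Y))) =
      tensorIso X' Y' ((map f ξ ⊗ₜ[ℂ] map g η : obj X' ⊗[ℂ] obj Y'))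
  tensorIso_assoc : ∀ (X Y Z : C) (ξ : obj X) (η : obj Y) (ζ : obj Z),
    map (α_ X Y Z).hom (tensorIso (X ⊗ Y) Z
        ((tensorIso X Y ((ξ ⊗ₜ[ℂ] η : obj X ⊗[ℂ] obj Y)) ⊗ₜ[ℂ] ζ :
          obj (X ⊗ Y) ⊗[ℂ] obj Z))) =
      tensorIso X (Y ⊗ Z)
        ((ξ ⊗ₜ[ℂ] tensorIso Y Z ((η ⊗ₜ[ℂ] ζ : obj Y ⊗[ℂ] obj Z)) :
          obj X ⊗[ℂ] obj (Y ⊗ Z)))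
  tensorIso_leftUnitor : ∀ (X : C) (ξ : obj X),
    map (λ_ X).hom (tensorIso (𝟙_ C) X ((unitIso 1 ⊗ₜ[ℂ] ξ : obj (𝟙_ C) ⊗[ℂ] obj X))) = ξ
  tensorIso_rightUnitor : ∀ (X : C) (ξ : obj X),
    map (ρ_ X).hom (tensorIso X (𝟙_ C) ((ξ ⊗ₜ[ℂ] unitIso 1 : obj X ⊗[ℂ] obj (𝟙_ C)))) = ξ

section Concrete

variable {C : Type u} [Category.{v} C] [MonoidalCategory C] [MonoidalWStarCategory C]

namespace FibreFunctor

variable (Φ : FibreFunctor.{w} C)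

/-- The algebra `B(ℋ)` of bounded operators on the Hilbert space underlying `H`. -/
abbrev Op (H : C) : Type w := Φ.obj H →L[ℂ] Φ.obj H

/-- For a vector `x` in the Hilbert space of `H`, the operator `η ↦ x ⊗ η`. -/
noncomputable def ket {H : C} (K : C) (x : Φ.obj H) : Φ.obj K →L[ℂ] Φ.obj (H ⊗ K) :=
  (Φ.tensorIso H K).toContinuousLinearEquiv.toContinuousLinearMap ∘L
    UniformSpace.Completion.toComplL ∘L TensorProduct.mkL ℂ (Φ.obj H) (Φ.obj K) x

/-- The operator `id ⊗ a` on the Hilbert space of `K ⊗ H`, for an arbitrary bounded operator `a`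
on the Hilbert space of `H`. -/
noncomputable def idTensor (K : C) {H : C} (a : Φ.Op H) : Φ.Op (K ⊗ H) :=
  (Φ.tensorIso K H).toContinuousLinearEquiv.toContinuousLinearMap ∘L
    (TensorProduct.mapL (ContinuousLinearMap.id ℂ (Φ.obj K)) a).completion ∘L
      (Φ.tensorIso K H).symm.toContinuousLinearEquiv.toContinuousLinearMap

/-- `S = (id ⊗ ω)(T)`: for all `x, y` one has `⟨x, S y⟩ = ω (T_{x,y})`, where
`T_{x,y} = (⟨x| ⊗ id) T (|y⟩ ⊗ id)`. -/
def IsSlice {H₁ K₁ H₂ K₂ : C} (T : Φ.obj (H₁ ⊗ K₁) →L[ℂ] Φ.obj (H₂ ⊗ K₂))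
    (ω : (Φ.obj K₁ →L[ℂ] Φ.obj K₂) → ℂ) (S : Φ.obj H₁ →L[ℂ] Φ.obj H₂) : Prop :=
  ∀ (x : Φ.obj H₂) (y : Φ.obj H₁),
    inner ℂ x (S y) = ω (ContinuousLinearMap.adjoint (Φ.ket K₂ x) ∘L T ∘L Φ.ket K₁ y)

/-- The closed linear span of all slices `(id ⊗ ω)(T)`, with `ω` running through all normal
functionals on the bounded operators from the Hilbert space of `K₁` to that of `K₂`. -/
noncomputable def slices {H₁ K₁ H₂ K₂ : C} (T : H₁ ⊗ K₁ ⟶ H₂ ⊗ K₂) :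
    Submodule ℂ (Φ.obj H₁ →L[ℂ] Φ.obj H₂) :=
  closedSpan {S | ∃ ω : (Φ.obj K₁ →L[ℂ] Φ.obj K₂) → ℂ,
    IsNormalFunctional ω ∧ Φ.IsSlice (Φ.map T) ω S}

/-- `x ↦ u x u⁻¹` for an isomorphism `u` of the category. -/
def conj {X Y : C} (u : X ≅ Y) (x : Φ.Op X) : Φ.Op Y :=
  Φ.map u.hom ∘L x ∘L Φ.map u.inv

/-- A braiding is regular if it is unitary and the closed span of the slices
`(id ⊗ ω)(c_{H,K})` is the space of compact operators, for all `H` and `K`. -/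
def IsRegularBraiding (c : BraidedCategory C) : Prop :=
  (∀ H K : C, IsUnitaryHom (c.braiding H K).hom) ∧
    ∀ H K : C, (Φ.slices (c.braiding H K).hom : Set (Φ.obj H →L[ℂ] Φ.obj K)) =
      {T : Φ.obj H →L[ℂ] Φ.obj K | IsCompactOperator T}

end FibreFunctor

/-! ### Multiplicative unitaries -/

/-- The operator `F₁₂` on `(L ⊗ L) ⊗ L`. -/
def leg12 {L : C} (F : L ⊗ L ⟶ L ⊗ L) : (L ⊗ L) ⊗ L ⟶ (L ⊗ L) ⊗ L := F ▷ L

/-- The operator `F₂₃` on `(L ⊗ L) ⊗ L`. -/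
def leg23 {L : C} (F : L ⊗ L ⟶ L ⊗ L) : (L ⊗ L) ⊗ L ⟶ (L ⊗ L) ⊗ L :=
  (α_ L L L).hom ≫ L ◁ F ≫ (α_ L L L).inv

/-- A multiplicative unitary: a unitary `F` on `L ⊗ L` with
`F₂₃ F₁₂ = F₁₂ (c⁻¹)₁₂ F₂₃ c₁₂ F₂₃` (here `f ≫ g` is "first `f`, then `g`"). -/
def IsMultiplicativeUnitary (c : BraidedCategory C) {L : C} (F : L ⊗ L ⟶ L ⊗ L) : Prop :=
  IsUnitaryHom F ∧
    leg12 F ≫ leg23 F =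
      leg23 F ≫ leg12 (c.braiding L L).hom ≫ leg23 F ≫ leg12 (c.braiding L L).inv ≫ leg12 F

/-- Regularity of `F`: the closed span `C(F)` of the slices `(id ⊗ ω)(c⁻¹ F)` is the space of
compact operators. -/
def IsRegularUnitary (Φ : FibreFunctor.{w} C) (c : BraidedCategory C) {L : C}
    (F : L ⊗ L ⟶ L ⊗ L) : Prop :=
  (Φ.slices (F ≫ (c.braiding L L).inv) : Set (Φ.Op L)) = {T : Φ.Op L | IsCompactOperator T}

/-! ### The category `Â(𝒞)` of `C⋆`-algebras -/

/-- An object of `Â(𝒞)` over `H`: a nondegenerate `C⋆`-subalgebra of the bounded operators on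
the Hilbert space of `H` that is of the form `Â(X)`, i.e. the closed span of the slices
`(id ⊗ ω)(X)` of an endomorphism `X` of some `H ⊗ K`. It is norm closed by `exists_slices`. -/
structure HatAlg (Φ : FibreFunctor.{w} C) (H : C) where
  alg : NonUnitalStarSubalgebra ℂ (Φ.Op H)
  exists_slices : ∃ (K : C) (X : H ⊗ K ⟶ H ⊗ K), (alg : Set (Φ.Op H)) = Φ.slices X
  nondegenerate : closedSpan {ξ : Φ.obj H | ∃ a ∈ alg, ∃ η : Φ.obj H, ξ = a η} = ⊤

/-- The multiplier algebra of a nondegenerate `C⋆`-subalgebra of bounded operators, as the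
idealiser of the subalgebra. -/
noncomputable def HatAlg.multipliers {Φ : FibreFunctor.{w} C} {H : C} (A : HatAlg Φ H) :
    StarSubalgebra ℂ (Φ.Op H) where
  carrier := {m | ∀ a ∈ A.alg, m * a ∈ A.alg ∧ a * m ∈ A.alg}
  mul_mem' := fun {m n} hm hn a ha => by
    refine ⟨?_, ?_⟩
    · rw [mul_assoc]; exact (hm _ (hn a ha).1).1
    · rw [← mul_assoc]; exact (hn _ (hm a ha).2).2
  one_mem' := fun a ha => by simpa using ha
  add_mem' := fun {m n} hm hn a ha => by
    refine ⟨?_, ?_⟩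
    · rw [add_mul]; exact add_mem (hm a ha).1 (hn a ha).1
    · rw [mul_add]; exact add_mem (hm a ha).2 (hn a ha).2
  zero_mem' := fun a _ => by simp [zero_mem]
  algebraMap_mem' := fun r a ha => by
    refine ⟨?_, ?_⟩
    · rw [← Algebra.smul_def]; exact SMulMemClass.smul_mem r ha
    · rw [← Algebra.commutes, ← Algebra.smul_def]; exact SMulMemClass.smul_mem r ha
  star_mem' := fun {m} hm a ha => by
    refine ⟨?_, ?_⟩
    · have h := star_mem (hm _ (star_mem ha)).2
      simpa using h
    · have h := star_mem (hm _ (star_mem ha)).1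
      simpa using h

/-- A morphism of `Â(𝒞)`: a nondegenerate `⋆`-homomorphism from `A₁` to the multiplier algebra
of `A₂` of the form `a ↦ V (id ⊗ a) V⋆`, with an isometry `V : K ⊗ H₁ ⟶ H₂` of `𝒞`. -/
structure HatHom {Φ : FibreFunctor.{w} C} {H₁ H₂ : C} (A₁ : HatAlg Φ H₁) (A₂ : HatAlg Φ H₂) where
  hom : A₁.alg →⋆ₙₐ[ℂ] A₂.multipliers
  nondegenerate : (closedSpan {x : Φ.Op H₂ | ∃ a : A₁.alg, ∃ b ∈ A₂.alg,
    x = (hom a : Φ.Op H₂) * b} : Set (Φ.Op H₂)) = A₂.alg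
  exists_isometry : ∃ (K : C) (V : K ⊗ H₁ ⟶ H₂), IsIsometric V ∧ ∀ a : A₁.alg,
    (hom a : Φ.Op H₂) = Φ.map V ∘L Φ.idTensor K (a : Φ.Op H₁) ∘L Φ.map (adj V)

variable {Φ : FibreFunctor.{w} C}

/-- The bounded operator underlying the image of `a` under a morphism of `Â(𝒞)`. -/
noncomputable def HatHom.app {H₁ H₂ : C} {A₁ : HatAlg Φ H₁} {A₂ : HatAlg Φ H₂} (f : HatHom A₁ A₂)
    (a : A₁.alg) : Φ.Op H₂ := (f.hom a : Φ.Op H₂)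

/-- `h = g ∘ f` in `Â(𝒞)`: `h` is the composite of `f` with the extension of `g` to a unital
`⋆`-homomorphism of multiplier algebras (which is unique by nondegeneracy of `g`). -/
def IsHatComp {H₁ H₂ H₃ : C} {A₁ : HatAlg Φ H₁} {A₂ : HatAlg Φ H₂} {A₃ : HatAlg Φ H₃}
    (g : HatHom A₂ A₃) (f : HatHom A₁ A₂) (h : HatHom A₁ A₃) : Prop :=
  ∃ e : A₂.multipliers →⋆ₐ[ℂ] A₃.multipliers,
    (∀ (a : A₂.alg) (m : A₂.multipliers), (m : Φ.Op H₂) = a → e m = g.hom a) ∧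
      ∀ a : A₁.alg, h.hom a = e (f.hom a)

/-- `h` is the identity morphism of `A`. -/
def IsHatId {H : C} {A : HatAlg Φ H} (h : HatHom A A) : Prop :=
  ∀ a : A.alg, h.app a = a

/-! ### The tensor product of `Â(𝒞)` defined by a braiding

For a braiding `c`, the two embeddings are `a ↦ c_{H₂,H₁} (id ⊗ a) c_{H₂,H₁}⁻¹` and
`a ↦ id ⊗ a`. The other tensor product is obtained by using the inverse braiding instead of `c`,
i.e. the first embedding is then `a ↦ c_{H₁,H₂}⁻¹ (id ⊗ a) c_{H₁,H₂}`. -/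

/-- The braiding `(c_{Y,X}⁻¹)_{X,Y}` inverse to `c`. -/
@[reducible] def inverseBraiding (c : BraidedCategory C) : BraidedCategory C :=
  @reverseBraiding C _ _ c

/-- `a ⊠ 1 = c_{H₂,H₁} (id ⊗ a) c_{H₂,H₁}⁻¹`. -/
noncomputable def boxLeft (c : BraidedCategory C) {H₁ : C} (H₂ : C) (a : Φ.Op H₁) :
    Φ.Op (H₁ ⊗ H₂) :=
  Φ.conj (c.braiding H₂ H₁) (Φ.idTensor H₂ a)

/-- `1 ⊠ a = id ⊗ a`. -/
noncomputable def boxRight (H₁ : C) {H₂ : C} (a : Φ.Op H₂) : Φ.Op (H₁ ⊗ H₂) :=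
  Φ.idTensor H₁ a

/-- The object `A₁₂` of `Â(𝒞)` is the tensor product `A₁ ⊠ A₂`: it is the closed span of the
products `(a₁ ⊠ 1)(1 ⊠ a₂)`, and `a₁ ↦ a₁ ⊠ 1`, `a₂ ↦ 1 ⊠ a₂` are morphisms of `Â(𝒞)` to it;
in particular it is a crossed product of `A₁` and `A₂`. -/
def IsBox (c : BraidedCategory C) {H₁ H₂ : C} (A₁ : HatAlg Φ H₁) (A₂ : HatAlg Φ H₂)
    (A₁₂ : HatAlg Φ (H₁ ⊗ H₂)) : Prop :=
  (A₁₂.alg : Set (Φ.Op (H₁ ⊗ H₂))) = closedSpan {x | ∃ a₁ ∈ A₁.alg, ∃ a₂ ∈ A₂.alg,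
      x = boxLeft c H₂ a₁ * boxRight H₁ a₂} ∧
    (∃ i₁ : HatHom A₁ A₁₂, ∀ a : A₁.alg, i₁.app a = boxLeft c H₂ (a : Φ.Op H₁)) ∧
    (∃ i₂ : HatHom A₂ A₁₂, ∀ a : A₂.alg, i₂.app a = boxRight H₁ (a : Φ.Op H₂))

/-- The morphism `h` is the tensor product `f ⊠ g`, determined by
`h ((a₁ ⊠ 1)(1 ⊠ a₂)) = (f(a₁) ⊠ 1)(1 ⊠ g(a₂))`. -/
def IsBoxHom (c : BraidedCategory C) {H₁ H₂ H₁' H₂' : C} {A₁ : HatAlg Φ H₁} {A₂ : HatAlg Φ H₂}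
    {A₁' : HatAlg Φ H₁'} {A₂' : HatAlg Φ H₂'} {A₁₂ : HatAlg Φ (H₁ ⊗ H₂)}
    {A₁₂' : HatAlg Φ (H₁' ⊗ H₂')} (f : HatHom A₁ A₁') (g : HatHom A₂ A₂')
    (h : HatHom A₁₂ A₁₂') : Prop :=
  ∀ (a₁ : A₁.alg) (a₂ : A₂.alg) (x : A₁₂.alg),
    (x : Φ.Op (H₁ ⊗ H₂)) = boxLeft c H₂ (a₁ : Φ.Op H₁) * boxRight H₁ (a₂ : Φ.Op H₂) →
      h.app x = boxLeft c H₂' (f.app a₁) * boxRight H₁' (g.app a₂)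

/-- The morphism `h` is the associator `(A₁ ⊠ A₂) ⊠ A₃ → A₁ ⊠ (A₂ ⊠ A₃)`, that is,
conjugation with the associator of `𝒞`. -/
def IsHatAssociator {H₁ H₂ H₃ : C} {B : HatAlg Φ ((H₁ ⊗ H₂) ⊗ H₃)}
    {B' : HatAlg Φ (H₁ ⊗ (H₂ ⊗ H₃))} (h : HatHom B B') : Prop :=
  ∀ x : B.alg, h.app x = Φ.conj (α_ H₁ H₂ H₃) (x : Φ.Op ((H₁ ⊗ H₂) ⊗ H₃))

/-- Coassociativity of `Δ : A → A ⊠ A` in `Â(𝒞)` with the tensor product defined by `c`: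
the tensor products `(A ⊠ A) ⊠ A`, `A ⊠ (A ⊠ A)`, the morphisms `id`, `Δ ⊠ id`, `id ⊠ Δ` and the
associator `a` exist, and `a ∘ (Δ ⊠ id) ∘ Δ = (id ⊠ Δ) ∘ Δ`. -/
def IsCoassociative (c : BraidedCategory C) {H : C} {A : HatAlg Φ H} {AA : HatAlg Φ (H ⊗ H)}
    (Δ : HatHom A AA) : Prop :=
  ∃ (B : HatAlg Φ ((H ⊗ H) ⊗ H)) (B' : HatAlg Φ (H ⊗ (H ⊗ H))),
    IsBox c AA A B ∧ IsBox c A AA B' ∧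
    ∃ (i : HatHom A A) (Δi : HatHom AA B) (iΔ : HatHom AA B') (a : HatHom B B'),
      IsHatId i ∧ IsBoxHom c Δ i Δi ∧ IsBoxHom c i Δ iΔ ∧ IsHatAssociator a ∧
      ∃ (l : HatHom A B) (r : HatHom A B'),
        IsHatComp Δi Δ l ∧ IsHatComp a l r ∧ IsHatComp iΔ Δ r

/-- `(A, δ)` is a bi-simplifiable braided `C⋆`-bialgebra in `Â(𝒞)` with the tensor product `⊠`
defined by `c`: the object `A ⊠ A` exists, `δ` is a coassociative morphism `A → A ⊠ A`, and both
Podleś conditions `A ⊠ A = [δ(A)(A ⊠ 1)] = [δ(A)(1 ⊠ A)]` hold. -/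
def IsBisimplifiableBialgebra (c : BraidedCategory C) {H : C} (A : HatAlg Φ H)
    (δ : Φ.Op H → Φ.Op (H ⊗ H)) : Prop :=
  ∃ (AA : HatAlg Φ (H ⊗ H)) (Δ : HatHom A AA),
    IsBox c A A AA ∧ (∀ a : A.alg, Δ.app a = δ a) ∧ IsCoassociative c Δ ∧
    (AA.alg : Set (Φ.Op (H ⊗ H))) =
      closedSpan {x | ∃ a ∈ A.alg, ∃ b ∈ A.alg, x = δ a * boxLeft c H b} ∧
    (AA.alg : Set (Φ.Op (H ⊗ H))) =
      closedSpan {x | ∃ a ∈ A.alg, ∃ b ∈ A.alg, x = δ a * boxRight H b}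

/-- `Δ̂ᵒᵖ(a) = F⋆ (id ⊗ a) F`. -/
noncomputable def hatDeltaOp {L : C} (F : L ⊗ L ⟶ L ⊗ L) (a : Φ.Op L) : Φ.Op (L ⊗ L) :=
  Φ.map (adj F) ∘L Φ.idTensor L a ∘L Φ.map F

/-- `Δ̂(a) = c_{L,L} Δ̂ᵒᵖ(a) c_{L,L}⁻¹`. -/
noncomputable def hatDelta (c : BraidedCategory C) {L : C} (F : L ⊗ L ⟶ L ⊗ L) (a : Φ.Op L) :
    Φ.Op (L ⊗ L) :=
  Φ.conj (c.braiding L L) (hatDeltaOp F a)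

end Concrete

/-!
The assertions of the theorem are identities `[S] = [T]` between closed linear spans of products of
bounded operators. They become identities between string diagrams in the monoidal category `OpSp Φ`,
whose objects are those of `C`, whose morphisms are the closed linear spaces of bounded operators,
and in which composites and tensor products are closed linear spans of products and of tensor
products. A morphism `f` of `C` gives the line `J Φ f`. The spaces of all vectors and of all
functionals of an object are morphisms `ket` and `bra`, the span of the slices of `P` is
`slice P = ketR ≫ P ≫ braR`, and `bra ≫ ket` consists of the compact operators. So regularity of the
braiding says that `slice c = bra ≫ ket`, and whenever two slices are multiplied, the intermediate
`bra ≫ ket` may be replaced by a crossing of the auxiliary legs (`slice_link`).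

* The slices of `F` form an algebra. By regularity of `F`, a product of a slice of `F⁻¹` with `F` is
  linked by `F c⁻¹`, and multiplicativity moves one copy of `F` to a place where it acts on all
  vectors and disappears (`slice_ketR_comp`). Hence `A = slice F` satisfies `[A A⋆] = A⋆`, and
  moreover `F` is absorbed by `A ⊗ ket` (`slice_selfAdjoint`, `exists_hatAlg`).
* Tensor products exist. Both `[(A₁ ⊠ 1)(1 ⊠ A₂)]` and `[(1 ⊠ A₂)(A₁ ⊠ 1)]` are spaces of slices of
  two operators linked by a crossing of their auxiliary legs. With this crossing the two operators
  can be pulled apart, so both spaces agree (`crossLink_comm`, `box_comm`). All morphisms are of the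
  form `a ↦ V (id ⊗ a) V⋆` with a unitary `V` (`HatHom.ofIso`), and naturality of the braiding shows
  that `f ⊠ id` and `id ⊠ g` are again of this form (`boxFst`, `boxSnd`).
* Podleś conditions. Multiplicativity turns `F₁₂⁻¹ F₂₃ F₁₂` into a product of two copies of `F`,
  one of them crossing the middle leg, so `Δ(A)` is a space of slices of such products; multiplied
  with `1 ⊠ A` or `A ⊠ 1`, one of the two copies is absorbed (`whiskerLeft_comp_comul`,
  `comul_comp_cross`).
* Coassociativity. The two iterates of the comultiplication are implemented by unitaries on
  `L ⊗ L ⊗ L` that differ, by the multiplicativity relation, only by a unitary on the first two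
  legs. That unitary commutes with `id ⊗ id ⊗ a` (`coassoc_of_comm`, `IsMul.coassoc_inv`).

The case of the braiding follows from that of the inverse braiding by conjugation with `c`, where
coassociativity needs the Yang–Baxter equation in addition (`comp_adSp_trans_braiding`,
`IsMul.coassoc`).
-/

/-! ### Tensor products of bounded operators -/

namespace FibreFunctor

variable {C : Type u} [Category.{v} C] [MonoidalCategory C] [MonoidalWStarCategory C]
  (Φ : FibreFunctor.{w} C)

/-- The elementary tensor `x ⊗ y` in the Hilbert space of `H ⊗ K`. -/
noncomputable def tmul {H K : C} (x : Φ.obj H) (y : Φ.obj K) : Φ.obj (H ⊗ K) :=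
  Φ.tensorIso H K ((x ⊗ₜ[ℂ] y : Φ.obj H ⊗[ℂ] Φ.obj K))

variable {Φ} in
theorem clm_ext {H K : C} {E : Type*} [AddCommMonoid E] [Module ℂ E] [TopologicalSpace E]
    [T2Space E] {S T : Φ.obj (H ⊗ K) →L[ℂ] E}
    (h : ∀ x y, S (Φ.tmul x y) = T (Φ.tmul x y)) : S = T := by
  have h1 : ∀ z : UniformSpace.Completion (Φ.obj H ⊗[ℂ] Φ.obj K),
      S (Φ.tensorIso H K z) = T (Φ.tensorIso H K z) := by
    intro z
    induction z using UniformSpace.Completion.induction_on with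
    | hp => exact isClosed_eq (S.continuous.comp (Φ.tensorIso H K).continuous)
              (T.continuous.comp (Φ.tensorIso H K).continuous)
    | ih t =>
      induction t with
      | zero => rw [UniformSpace.Completion.coe_zero, map_zero, map_zero, map_zero]
      | tmul x y => exact h x y
      | add a b ha hb =>
        rw [UniformSpace.Completion.coe_add, map_add, map_add, map_add, ha, hb]
  ext z
  simpa using h1 ((Φ.tensorIso H K).symm z)

theorem inner_tmul {H K : C} (x x' : Φ.obj H) (y y' : Φ.obj K) :
    inner ℂ (Φ.tmul x y) (Φ.tmul x' y') = inner ℂ x x' * inner ℂ y y' := by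
  simp [tmul]

theorem norm_tmul {H K : C} (x : Φ.obj H) (y : Φ.obj K) :
    ‖Φ.tmul x y‖ = ‖x‖ * ‖y‖ := by
  simp [tmul]

/-- For a vector `y` in the Hilbert space of `K`, the operator `x ↦ x ⊗ y`. -/
noncomputable def rket (H : C) {K : C} (y : Φ.obj K) : Φ.obj H →L[ℂ] Φ.obj (H ⊗ K) :=
  (Φ.tensorIso H K).toContinuousLinearEquiv.toContinuousLinearMap ∘L
    UniformSpace.Completion.toComplL ∘L (TensorProduct.mkL ℂ (Φ.obj H) (Φ.obj K)).flip y

theorem rket_apply (H : C) {K : C} (x : Φ.obj H) (y : Φ.obj K) :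
    Φ.rket H y x = Φ.tmul x y := rfl

variable {Φ} in
/-- Vectors of the Hilbert space of `H ⊗ K` are separated by elementary tensors. -/
theorem ext_inner_tmul {H K : C} {z z' : Φ.obj (H ⊗ K)}
    (h : ∀ x y, inner ℂ (Φ.tmul x y) z = inner ℂ (Φ.tmul x y) z') : z = z' := by
  have : innerSL ℂ z = innerSL ℂ z' := by
    refine clm_ext fun x y => ?_
    rw [innerSL_apply_apply, innerSL_apply_apply, ← inner_conj_symm, h, inner_conj_symm]
  refine ext_inner_right ℂ fun w => ?_
  simpa using congrArg (fun f => f w) this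

variable {Φ} in
theorem clm_ext₃ {H K L : C} {E : Type*} [AddCommMonoid E] [Module ℂ E] [TopologicalSpace E]
    [T2Space E] {S T : Φ.obj ((H ⊗ K) ⊗ L) →L[ℂ] E}
    (h : ∀ x y z, S (Φ.tmul (Φ.tmul x y) z) = T (Φ.tmul (Φ.tmul x y) z)) : S = T := by
  refine clm_ext fun w z => ?_
  have : S ∘L Φ.rket (H ⊗ K) z = T ∘L Φ.rket (H ⊗ K) z := clm_ext fun x y => h x y z
  exact congrArg (fun f => f w) this

/-- The operator `S ⊗ T` on completed tensor products. -/
noncomputable def tensorOp {H H' K K' : C} (S : Φ.obj H →L[ℂ] Φ.obj H')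
    (T : Φ.obj K →L[ℂ] Φ.obj K') : Φ.obj (H ⊗ K) →L[ℂ] Φ.obj (H' ⊗ K') :=
  (Φ.tensorIso H' K').toContinuousLinearEquiv.toContinuousLinearMap ∘L
    (TensorProduct.mapL S T).completion ∘L
      (Φ.tensorIso H K).symm.toContinuousLinearEquiv.toContinuousLinearMap

theorem idTensor_eq (K : C) {H : C} (a : Φ.Op H) :
    Φ.idTensor K a = Φ.tensorOp (ContinuousLinearMap.id ℂ (Φ.obj K)) a := rfl

variable {H H' H'' K K' K'' : C}

@[simp] theorem tensorOp_tmul (S : Φ.obj H →L[ℂ] Φ.obj H') (T : Φ.obj K →L[ℂ] Φ.obj K')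
    (x : Φ.obj H) (y : Φ.obj K) :
    Φ.tensorOp S T (Φ.tmul x y) = Φ.tmul (S x) (T y) := by
  simp [tensorOp, tmul]

theorem map_tmul (f : H ⟶ H') (g : K ⟶ K') (x : Φ.obj H) (y : Φ.obj K) :
    Φ.map (f ⊗ₘ g) (Φ.tmul x y) = Φ.tmul (Φ.map f x) (Φ.map g y) :=
  Φ.tensorIso_natural f g x y

theorem map_tensorHom (f : H ⟶ H') (g : K ⟶ K') :
    Φ.map (f ⊗ₘ g) = Φ.tensorOp (Φ.map f) (Φ.map g) :=
  clm_ext fun x y => by rw [map_tmul, tensorOp_tmul]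

theorem tensorOp_id : Φ.tensorOp (ContinuousLinearMap.id ℂ (Φ.obj H))
    (ContinuousLinearMap.id ℂ (Φ.obj K)) = ContinuousLinearMap.id ℂ _ :=
  clm_ext fun x y => by simp

theorem tensorOp_comp (S : Φ.obj H →L[ℂ] Φ.obj H') (S' : Φ.obj H' →L[ℂ] Φ.obj H'')
    (T : Φ.obj K →L[ℂ] Φ.obj K') (T' : Φ.obj K' →L[ℂ] Φ.obj K'') :
    Φ.tensorOp (S' ∘L S) (T' ∘L T) = Φ.tensorOp S' T' ∘L Φ.tensorOp S T :=
  clm_ext fun x y => by simp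

theorem tensorOp_adjoint (S : Φ.obj H →L[ℂ] Φ.obj H') (T : Φ.obj K →L[ℂ] Φ.obj K') :
    ContinuousLinearMap.adjoint (Φ.tensorOp S T) =
      Φ.tensorOp (ContinuousLinearMap.adjoint S) (ContinuousLinearMap.adjoint T) := by
  refine clm_ext fun x y => ext_inner_tmul fun x' y' => ?_
  rw [ContinuousLinearMap.adjoint_inner_right, tensorOp_tmul, tensorOp_tmul, inner_tmul,
    inner_tmul, ContinuousLinearMap.adjoint_inner_right, ContinuousLinearMap.adjoint_inner_right]

theorem tmul_add (x : Φ.obj H) (y y' : Φ.obj K) :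
    Φ.tmul x (y + y') = Φ.tmul x y + Φ.tmul x y' := map_add (Φ.ket K x) y y'

theorem tmul_smul (r : ℂ) (x : Φ.obj H) (y : Φ.obj K) :
    Φ.tmul x (r • y) = r • Φ.tmul x y := map_smul (Φ.ket K x) r y

theorem add_tmul (x x' : Φ.obj H) (y : Φ.obj K) :
    Φ.tmul (x + x') y = Φ.tmul x y + Φ.tmul x' y := map_add (Φ.rket H y) x x'

theorem smul_tmul (r : ℂ) (x : Φ.obj H) (y : Φ.obj K) :
    Φ.tmul (r • x) y = r • Φ.tmul x y := map_smul (Φ.rket H y) r x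

theorem norm_tensorOp_le (S : Φ.obj H →L[ℂ] Φ.obj H') (T : Φ.obj K →L[ℂ] Φ.obj K') :
    ‖Φ.tensorOp S T‖ ≤ ‖S‖ * ‖T‖ := by
  have h1 : ∀ z, ‖(TensorProduct.mapL S T).completion z‖ ≤ ‖S‖ * ‖T‖ * ‖z‖ := by
    intro z
    induction z using UniformSpace.Completion.induction_on with
    | hp => exact isClosed_le (by fun_prop) (by fun_prop)
    | ih t =>
      rw [ContinuousLinearMap.completion_apply_coe, UniformSpace.Completion.norm_coe,
        UniformSpace.Completion.norm_coe]
      exact (TensorProduct.mapL S T).le_of_opNorm_le (TensorProduct.norm_mapL_le S T) t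
  refine ContinuousLinearMap.opNorm_le_bound _ (by positivity) fun z => ?_
  simpa [tensorOp] using h1 ((Φ.tensorIso H K).symm z)

/-- The operator `S ⊗ T` as a bounded bilinear function of `S` and `T`. -/
noncomputable def tensorOpL (H H' K K' : C) : (Φ.obj H →L[ℂ] Φ.obj H') →L[ℂ]
    (Φ.obj K →L[ℂ] Φ.obj K') →L[ℂ] (Φ.obj (H ⊗ K) →L[ℂ] Φ.obj (H' ⊗ K')) :=
  (LinearMap.mk₂ ℂ (fun S T => Φ.tensorOp S T)
    (fun S S' T => clm_ext fun x y => by simp [add_tmul])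
    (fun r S T => clm_ext fun x y => by simp [smul_tmul])
    (fun S T T' => clm_ext fun x y => by simp [tmul_add])
    (fun r S T => clm_ext fun x y => by simp [tmul_smul])).mkContinuous₂ 1
    fun S T => by simpa using Φ.norm_tensorOp_le S T

theorem map_associator_tmul (X Y Z : C) (x : Φ.obj X) (y : Φ.obj Y) (z : Φ.obj Z) :
    Φ.map (α_ X Y Z).hom (Φ.tmul (Φ.tmul x y) z) = Φ.tmul x (Φ.tmul y z) :=
  Φ.tensorIso_assoc X Y Z x y z

theorem exists_smul_unit (z : Φ.obj (𝟙_ C)) : ∃ r : ℂ, z = r • Φ.unitIso 1 :=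
  ⟨Φ.unitIso.symm z, by rw [← map_smul, smul_eq_mul, mul_one]; simp⟩

theorem map_leftUnitor_tmul (X : C) (r : ℂ) (x : Φ.obj X) :
    Φ.map (λ_ X).hom (Φ.tmul (r • Φ.unitIso 1) x) = r • x := by
  rw [smul_tmul, map_smul]; exact congrArg (r • ·) (Φ.tensorIso_leftUnitor X x)

theorem map_rightUnitor_tmul (X : C) (r : ℂ) (x : Φ.obj X) :
    Φ.map (ρ_ X).hom (Φ.tmul x (r • Φ.unitIso 1)) = r • x := by
  rw [tmul_smul, map_smul]; exact congrArg (r • ·) (Φ.tensorIso_rightUnitor X x)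

end FibreFunctor

/-! ### The monoidal category of bounded operators -/

/-- The category with the objects of `C`, in which a morphism from `X` to `Y` is an arbitrary
bounded operator between the underlying Hilbert spaces. -/
structure OpCat {C : Type u} [Category.{v} C] [MonoidalCategory C] [MonoidalWStarCategory C]
    (Φ : FibreFunctor.{w} C) where
  /-- The underlying object of `C`. -/
  as : C

namespace OpCat

variable {C : Type u} [Category.{v} C] [MonoidalCategory C] [MonoidalWStarCategory C]
  {Φ : FibreFunctor.{w} C}

instance : Category (OpCat Φ) where
  Hom X Y := Φ.obj X.as →L[ℂ] Φ.obj Y.as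
  id X := ContinuousLinearMap.id ℂ _
  comp f g := g ∘L f

variable (Φ) in
/-- The operator underlying a morphism of `C`. -/
def ι {X Y : C} (f : X ⟶ Y) : (⟨X⟩ : OpCat Φ) ⟶ ⟨Y⟩ := Φ.map f

variable (Φ) in
theorem ι_comp {X Y Z : C} (f : X ⟶ Y) (g : Y ⟶ Z) : ι Φ (f ≫ g) = ι Φ f ≫ ι Φ g :=
  Φ.map_comp f g

variable (Φ) in
theorem ι_id (X : C) : ι Φ (𝟙 X) = 𝟙 _ := Φ.map_id X

variable (Φ) in
/-- The isomorphism of `OpCat Φ` underlying an isomorphism of `C`. -/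
@[simps] def ιIso {X Y : C} (e : X ≅ Y) : (⟨X⟩ : OpCat Φ) ≅ ⟨Y⟩ where
  hom := ι Φ e.hom
  inv := ι Φ e.inv
  hom_inv_id := by rw [← ι_comp, e.hom_inv_id, ι_id]
  inv_hom_id := by rw [← ι_comp, e.inv_hom_id, ι_id]

noncomputable instance : MonoidalCategoryStruct (OpCat Φ) where
  tensorObj X Y := ⟨X.as ⊗ Y.as⟩
  tensorUnit := ⟨𝟙_ C⟩
  tensorHom f g := Φ.tensorOp f g
  whiskerLeft X _ _ f := Φ.tensorOp (ContinuousLinearMap.id ℂ (Φ.obj X.as)) f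
  whiskerRight f Y := Φ.tensorOp f (ContinuousLinearMap.id ℂ (Φ.obj Y.as))
  associator X Y Z := ιIso Φ (α_ X.as Y.as Z.as)
  leftUnitor X := ιIso Φ (λ_ X.as)
  rightUnitor X := ιIso Φ (ρ_ X.as)

variable (Φ) in
theorem ι_tensorHom {X X' Y Y' : C} (f : X ⟶ X') (g : Y ⟶ Y') :
    ι Φ (f ⊗ₘ g) = ι Φ f ⊗ₘ ι Φ g := Φ.map_tensorHom f g

variable (Φ) in
theorem ι_whiskerLeft (X : C) {Y Y' : C} (g : Y ⟶ Y') :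
    ι Φ (X ◁ g) = (⟨X⟩ : OpCat Φ) ◁ ι Φ g := by
  rw [← id_tensorHom, ι_tensorHom, ι_id]; rfl

variable (Φ) in
theorem ι_whiskerRight {X X' : C} (f : X ⟶ X') (Y : C) :
    ι Φ (f ▷ Y) = ι Φ f ▷ (⟨Y⟩ : OpCat Φ) := by
  rw [← tensorHom_id, ι_tensorHom, ι_id]; rfl

noncomputable instance : MonoidalCategory (OpCat Φ) := .ofTensorHom
  (id_tensorHom_id := fun X Y => Φ.tensorOp_id)
  (tensorHom_comp_tensorHom := fun f g f' g' => (Φ.tensorOp_comp f f' g g').symm)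
  (associator_naturality := fun {X₁ X₂ X₃ Y₁ Y₂ Y₃} f g h => by
    refine FibreFunctor.clm_ext₃ (Φ := Φ) fun x y z => ?_
    change Φ.map (α_ Y₁.as Y₂.as Y₃.as).hom (Φ.tensorOp (Φ.tensorOp f g) h _) =
      Φ.tensorOp f (Φ.tensorOp g h) (Φ.map (α_ X₁.as X₂.as X₃.as).hom _)
    rw [Φ.map_associator_tmul, Φ.tensorOp_tmul, Φ.tensorOp_tmul, Φ.tensorOp_tmul,
      Φ.tensorOp_tmul, Φ.map_associator_tmul])
  (leftUnitor_naturality := fun {X Y} f => by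
    refine FibreFunctor.clm_ext (Φ := Φ) fun x y => ?_
    change Φ.map (λ_ Y.as).hom (Φ.tensorOp (ContinuousLinearMap.id ℂ _) f _) =
      (show Φ.obj X.as →L[ℂ] Φ.obj Y.as from f) (Φ.map (λ_ X.as).hom _)
    obtain ⟨r, rfl⟩ := Φ.exists_smul_unit x
    rw [Φ.tensorOp_tmul, ContinuousLinearMap.id_apply, Φ.map_leftUnitor_tmul,
      Φ.map_leftUnitor_tmul]
    exact (ContinuousLinearMap.map_smul (show Φ.obj X.as →L[ℂ] Φ.obj Y.as from f) r y).symm)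
  (rightUnitor_naturality := fun {X Y} f => by
    refine FibreFunctor.clm_ext (Φ := Φ) fun y x => ?_
    change Φ.map (ρ_ Y.as).hom (Φ.tensorOp f (ContinuousLinearMap.id ℂ _) _) =
      (show Φ.obj X.as →L[ℂ] Φ.obj Y.as from f) (Φ.map (ρ_ X.as).hom _)
    obtain ⟨r, rfl⟩ := Φ.exists_smul_unit x
    rw [Φ.tensorOp_tmul, ContinuousLinearMap.id_apply, Φ.map_rightUnitor_tmul,
      Φ.map_rightUnitor_tmul]
    exact (ContinuousLinearMap.map_smul (show Φ.obj X.as →L[ℂ] Φ.obj Y.as from f) r y).symm)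
  (pentagon := fun W X Y Z => by
    have h := congrArg (ι Φ) (MonoidalCategory.pentagon W.as X.as Y.as Z.as)
    rwa [ι_comp, ι_comp, ι_comp, ι_whiskerRight, ι_whiskerLeft] at h)
  (triangle := fun X Y => by
    have h := congrArg (ι Φ) (MonoidalCategory.triangle X.as Y.as)
    rwa [ι_comp, ι_whiskerRight, ι_whiskerLeft] at h)

/-- The adjoint operator, as a morphism of `OpCat Φ`. -/
noncomputable def dag {X Y : OpCat Φ} (f : X ⟶ Y) : Y ⟶ X :=
  ContinuousLinearMap.adjoint (show Φ.obj X.as →L[ℂ] Φ.obj Y.as from f)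

theorem dag_comp {X Y Z : OpCat Φ} (f : X ⟶ Y) (g : Y ⟶ Z) : dag (f ≫ g) = dag g ≫ dag f :=
  ContinuousLinearMap.adjoint_comp _ _

theorem dag_tensor {X X' Y Y' : OpCat Φ} (f : X ⟶ X') (g : Y ⟶ Y') :
    dag (f ⊗ₘ g) = dag f ⊗ₘ dag g := Φ.tensorOp_adjoint _ _

theorem dag_dag {X Y : OpCat Φ} (f : X ⟶ Y) : dag (dag f) = f :=
  ContinuousLinearMap.adjoint_adjoint _

variable (Φ) in
theorem dag_ι {X Y : C} (f : X ⟶ Y) : dag (ι Φ f) = ι Φ (adj f) := (Φ.map_adj f).symm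

noncomputable instance (X Y : OpCat Φ) : NormedAddCommGroup (X ⟶ Y) :=
  inferInstanceAs (NormedAddCommGroup (Φ.obj X.as →L[ℂ] Φ.obj Y.as))

noncomputable instance (X Y : OpCat Φ) : NormedSpace ℂ (X ⟶ Y) :=
  inferInstanceAs (NormedSpace ℂ (Φ.obj X.as →L[ℂ] Φ.obj Y.as))

/-- Composition as a bounded bilinear map. -/
noncomputable def compL (X Y Z : OpCat Φ) : (X ⟶ Y) →L[ℂ] (Y ⟶ Z) →L[ℂ] (X ⟶ Z) :=
  (ContinuousLinearMap.compL ℂ (Φ.obj X.as) (Φ.obj Y.as) (Φ.obj Z.as)).flip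

/-- The tensor product of operators as a bounded bilinear map. -/
noncomputable def tensorL (X X' Y Y' : OpCat Φ) :
    (X ⟶ X') →L[ℂ] (Y ⟶ Y') →L[ℂ] (X ⊗ Y ⟶ X' ⊗ Y') :=
  Φ.tensorOpL X.as X'.as Y.as Y'.as

end OpCat

/-! ### Closed linear spans -/

section ClosedSpan

variable {E F G : Type w} [NormedAddCommGroup E] [NormedSpace ℂ E] [NormedAddCommGroup F]
  [NormedSpace ℂ F] [NormedAddCommGroup G] [NormedSpace ℂ G]

/-- The closed linear span, as a bundled closed subspace. -/
def cspan (S : Set E) : ClosedSubmodule ℂ E :=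
  ⟨closedSpan S, Submodule.isClosed_topologicalClosure _⟩

theorem subset_cspan (S : Set E) : S ⊆ cspan S :=
  fun _ hx => Submodule.le_topologicalClosure _ (Submodule.subset_span hx)

theorem cspan_le {S : Set E} {P : ClosedSubmodule ℂ E} : cspan S ≤ P ↔ S ⊆ P := by
  refine ⟨fun h x hx => h (subset_cspan S hx), fun h => ?_⟩
  exact Submodule.topologicalClosure_minimal _ (Submodule.span_le.2 h) P.isClosed

theorem cspan_coe (P : ClosedSubmodule ℂ E) : cspan (P : Set E) = P :=
  le_antisymm (cspan_le.2 subset_rfl) (fun _ hx => subset_cspan _ hx)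

/-- A bounded bilinear map does not see the difference between generating sets and their closed
spans. -/
theorem cspan_image2 (B : E →L[ℂ] F →L[ℂ] G) (S : Set E) (T : Set F) :
    cspan (Set.image2 (fun x y => B x y) (cspan S : Set E) (cspan T : Set F)) =
      cspan (Set.image2 (fun x y => B x y) S T) := by
  refine le_antisymm (cspan_le.2 ?_) (cspan_le.2 ?_)
  · set R := cspan (Set.image2 (fun x y => B x y) S T)
    have h1 : ∀ s ∈ S, ∀ t ∈ cspan T, B s t ∈ R := by
      intro s hs
      have : cspan T ≤ R.comap (B s) :=
        cspan_le.2 fun t ht => subset_cspan _ (Set.mem_image2_of_mem hs ht)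
      exact fun t ht => this ht
    have h2 : ∀ t ∈ cspan T, ∀ s ∈ cspan S, B s t ∈ R := by
      intro t ht
      have : cspan S ≤ R.comap (B.flip t) := cspan_le.2 fun s hs => h1 s hs t ht
      exact fun s hs => this hs
    rintro _ ⟨s, hs, t, ht, rfl⟩
    exact h2 t ht s hs
  · rintro _ ⟨s, hs, t, ht, rfl⟩
    exact subset_cspan _ (Set.mem_image2_of_mem (subset_cspan S hs) (subset_cspan T ht))

end ClosedSpan

/-! ### The monoidal category of closed operator spaces -/

/-- The category with the objects of `C`, in which a morphism from `X` to `Y` is a closed linear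
space of bounded operators, and in which the composite of two morphisms is the closed linear span
of all products. With the closed linear span of the tensor products of operators it is a monoidal
category, so that computations with closed linear spans of products of operators become
computations with string diagrams. -/
structure OpSp {C : Type u} [Category.{v} C] [MonoidalCategory C] [MonoidalWStarCategory C]
    (Φ : FibreFunctor.{w} C) where
  /-- The underlying object. -/
  as : OpCat Φ

namespace OpSp

variable {C : Type u} [Category.{v} C] [MonoidalCategory C] [MonoidalWStarCategory C]
  {Φ : FibreFunctor.{w} C}

noncomputable instance : CategoryStruct (OpSp Φ) where
  Hom X Y := ClosedSubmodule ℂ (X.as ⟶ Y.as)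
  id X := cspan {𝟙 X.as}
  comp P Q := cspan (Set.image2 (· ≫ ·) (P.carrier) (Q.carrier))

/-- The closed linear span of a set of operators. -/
noncomputable def gen {X Y : OpSp Φ} (S : Set (X.as ⟶ Y.as)) : X ⟶ Y := cspan S

/-- The set of operators that belong to a morphism. -/
def set {X Y : OpSp Φ} (P : X ⟶ Y) : Set (X.as ⟶ Y.as) :=
  (show ClosedSubmodule ℂ (X.as ⟶ Y.as) from P).carrier

theorem set_injective {X Y : OpSp Φ} {P Q : X ⟶ Y} (h : set P = set Q) : P = Q :=
  SetLike.coe_injective (A := ClosedSubmodule ℂ (X.as ⟶ Y.as)) h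

theorem gen_set {X Y : OpSp Φ} (P : X ⟶ Y) : gen (set P) = P :=
  cspan_coe (show ClosedSubmodule ℂ (X.as ⟶ Y.as) from P)

theorem subset_set_gen {X Y : OpSp Φ} (S : Set (X.as ⟶ Y.as)) : S ⊆ set (gen S) :=
  subset_cspan S

theorem set_gen_subset {X Y : OpSp Φ} {S : Set (X.as ⟶ Y.as)} {P : X ⟶ Y} (h : S ⊆ set P) :
    set (gen S) ⊆ set P :=
  cspan_le (P := (show ClosedSubmodule ℂ (X.as ⟶ Y.as) from P)).2 h

theorem gen_comp {X Y Z : OpSp Φ} (S : Set (X.as ⟶ Y.as)) (T : Set (Y.as ⟶ Z.as)) :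
    gen S ≫ gen T = gen (X := X) (Y := Z) (Set.image2 (· ≫ ·) S T) :=
  cspan_image2 (OpCat.compL X.as Y.as Z.as) S T

theorem exists_gen {X Y : OpSp Φ} (P : X ⟶ Y) : ∃ S, P = gen S := ⟨set P, (gen_set P).symm⟩

noncomputable instance : Category (OpSp Φ) where
  id_comp P := by
    obtain ⟨S, rfl⟩ := exists_gen P
    refine (gen_comp {𝟙 _} S).trans ?_
    simp
  comp_id P := by
    obtain ⟨S, rfl⟩ := exists_gen P
    refine (gen_comp S {𝟙 _}).trans ?_
    simp
  assoc P Q R := by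
    obtain ⟨S, rfl⟩ := exists_gen P
    obtain ⟨T, rfl⟩ := exists_gen Q
    obtain ⟨U, rfl⟩ := exists_gen R
    rw [gen_comp, gen_comp, gen_comp, gen_comp, Set.image2_assoc Category.assoc]

/-- The line spanned by an operator. -/
noncomputable def sing {X Y : OpCat Φ} (T : X ⟶ Y) : (⟨X⟩ : OpSp Φ) ⟶ ⟨Y⟩ := gen {T}

theorem sing_comp {X Y Z : OpCat Φ} (S : X ⟶ Y) (T : Y ⟶ Z) :
    sing (S ≫ T) = sing S ≫ sing T := by
  rw [sing, sing, sing, gen_comp, Set.image2_singleton]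

theorem sing_id (X : OpCat Φ) : sing (𝟙 X) = 𝟙 _ := rfl

/-- The isomorphism given by the lines spanned by an invertible operator and its inverse. -/
@[simps] noncomputable def singIso {X Y : OpCat Φ} (e : X ≅ Y) : (⟨X⟩ : OpSp Φ) ≅ ⟨Y⟩ where
  hom := sing e.hom
  inv := sing e.inv
  hom_inv_id := by rw [← sing_comp, e.hom_inv_id, sing_id]
  inv_hom_id := by rw [← sing_comp, e.inv_hom_id, sing_id]

noncomputable instance : MonoidalCategoryStruct (OpSp Φ) where
  tensorObj X Y := ⟨X.as ⊗ Y.as⟩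
  tensorUnit := ⟨𝟙_ (OpCat Φ)⟩
  tensorHom P Q := gen (Set.image2 (· ⊗ₘ ·) (set P) (set Q))
  whiskerLeft X _ _ Q := gen (Set.image2 (· ⊗ₘ ·) (set (𝟙 X)) (set Q))
  whiskerRight P Y := gen (Set.image2 (· ⊗ₘ ·) (set P) (set (𝟙 Y)))
  associator X Y Z := singIso (α_ X.as Y.as Z.as)
  leftUnitor X := singIso (λ_ X.as)
  rightUnitor X := singIso (ρ_ X.as)

theorem gen_tensor {X X' Y Y' : OpSp Φ} (S : Set (X.as ⟶ X'.as)) (T : Set (Y.as ⟶ Y'.as)) :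
    gen S ⊗ₘ gen T = gen (X := X ⊗ Y) (Y := X' ⊗ Y') (Set.image2 (· ⊗ₘ ·) S T) :=
  cspan_image2 (OpCat.tensorL X.as X'.as Y.as Y'.as) S T

theorem sing_tensor {X X' Y Y' : OpCat Φ} (S : X ⟶ X') (T : Y ⟶ Y') :
    sing (S ⊗ₘ T) = sing S ⊗ₘ sing T := by
  rw [sing, sing, sing, gen_tensor, Set.image2_singleton]

theorem sing_whiskerLeft (X : OpCat Φ) {Y Y' : OpCat Φ} (T : Y ⟶ Y') :
    sing (X ◁ T) = (⟨X⟩ : OpSp Φ) ◁ sing T := by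
  rw [← id_tensorHom, sing_tensor]; rfl

theorem sing_whiskerRight {X X' : OpCat Φ} (T : X ⟶ X') (Y : OpCat Φ) :
    sing (T ▷ Y) = sing T ▷ (⟨Y⟩ : OpSp Φ) := by
  rw [← tensorHom_id, sing_tensor]; rfl

noncomputable instance : MonoidalCategory (OpSp Φ) := .ofTensorHom
  (id_tensorHom_id := fun X Y => by
    refine (gen_tensor {𝟙 _} {𝟙 _}).trans ?_
    rw [Set.image2_singleton, id_tensorHom_id]; rfl)
  (tensorHom_comp_tensorHom := fun P Q P' Q' => by
    obtain ⟨S, rfl⟩ := exists_gen P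
    obtain ⟨T, rfl⟩ := exists_gen Q
    obtain ⟨S', rfl⟩ := exists_gen P'
    obtain ⟨T', rfl⟩ := exists_gen Q'
    rw [gen_tensor, gen_tensor, gen_comp, gen_comp, gen_comp, gen_tensor]
    exact congrArg gen
      (Set.image2_image2_image2_comm fun _ _ _ _ => tensorHom_comp_tensorHom _ _ _ _))
  (associator_naturality := fun P Q R => by
    obtain ⟨S, rfl⟩ := exists_gen P
    obtain ⟨T, rfl⟩ := exists_gen Q
    obtain ⟨U, rfl⟩ := exists_gen R
    rw [gen_tensor, gen_tensor, gen_tensor, gen_tensor]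
    refine (gen_comp _ {_}).trans (Eq.trans ?_ (gen_comp {_} _).symm)
    rw [Set.image2_singleton_right, Set.image2_singleton_left, Set.image_image2,
      Set.image_image2]
    congr 1
    refine Set.image2_assoc fun f g h => ?_
    exact associator_naturality f g h)
  (leftUnitor_naturality := fun P => by
    obtain ⟨S, rfl⟩ := exists_gen P
    refine (congrArg (· ≫ _) (gen_tensor {𝟙 _} S)).trans ?_
    refine (gen_comp _ {_}).trans (Eq.trans ?_ (gen_comp {_} _).symm)
    rw [Set.image2_singleton_right, Set.image2_singleton_left, Set.image2_singleton_left,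
      Set.image_image]
    congr 1
    refine Set.image_congr fun f _ => ?_
    rw [id_tensorHom]
    exact leftUnitor_naturality f)
  (rightUnitor_naturality := fun P => by
    obtain ⟨S, rfl⟩ := exists_gen P
    refine (congrArg (· ≫ _) (gen_tensor S {𝟙 _})).trans ?_
    refine (gen_comp _ {_}).trans (Eq.trans ?_ (gen_comp {_} _).symm)
    rw [Set.image2_singleton_right, Set.image2_singleton_left, Set.image2_singleton_right,
      Set.image_image]
    congr 1
    refine Set.image_congr fun f _ => ?_
    rw [tensorHom_id]
    exact rightUnitor_naturality f)
  (pentagon := fun W X Y Z => by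
    have h := congrArg sing (MonoidalCategory.pentagon W.as X.as Y.as Z.as)
    rwa [sing_comp, sing_comp, sing_comp, sing_whiskerRight, sing_whiskerLeft] at h)
  (triangle := fun X Y => by
    have h := congrArg sing (MonoidalCategory.triangle X.as Y.as)
    rwa [sing_comp, sing_whiskerRight, sing_whiskerLeft] at h)

end OpSp

/-! ### Adjoints, kets and bras -/

theorem IsUnitaryHom.adj_hom {C : Type u} [Category.{v} C] [CStarCategory C] {X Y : C}
    {e : X ≅ Y} (h : IsUnitaryHom e.hom) : adj e.hom = e.inv := by
  rw [← Category.id_comp (adj e.hom), ← e.inv_hom_id, Category.assoc, h.1, Category.comp_id]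

namespace FibreFunctor

variable {C : Type u} [Category.{v} C] [MonoidalCategory C] [MonoidalWStarCategory C]
  (Φ : FibreFunctor.{w} C)

variable {Φ} in
/-- Elementary tensors span a dense subspace. -/
theorem mem_of_tmul_mem {H K : C} (P : ClosedSubmodule ℂ (Φ.obj (H ⊗ K)))
    (h : ∀ x y, Φ.tmul x y ∈ P) (z : Φ.obj (H ⊗ K)) : z ∈ P := by
  have h1 : ∀ z : UniformSpace.Completion (Φ.obj H ⊗[ℂ] Φ.obj K), Φ.tensorIso H K z ∈ P := by
    intro z
    induction z using UniformSpace.Completion.induction_on with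
    | hp => exact P.isClosed.preimage (Φ.tensorIso H K).continuous
    | ih t =>
      induction t with
      | zero => rw [UniformSpace.Completion.coe_zero, map_zero]; exact zero_mem P
      | tmul x y => exact h x y
      | add a b ha hb => rw [UniformSpace.Completion.coe_add, map_add]; exact add_mem ha hb
  simpa using h1 ((Φ.tensorIso H K).symm z)

/-- The unit vector of the Hilbert space of the unit object. -/
noncomputable def unitVec : Φ.obj (𝟙_ C) := Φ.unitIso 1

/-- The operator from the Hilbert space of the unit object that maps the unit vector to `z`. -/
noncomputable def vec {H : C} : Φ.obj H →L[ℂ] (Φ.obj (𝟙_ C) →L[ℂ] Φ.obj H) :=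
  (ContinuousLinearMap.smulRightL ℂ (Φ.obj (𝟙_ C)) (Φ.obj H)) (innerSL ℂ Φ.unitVec)

theorem inner_unitVec : inner ℂ Φ.unitVec Φ.unitVec = (1 : ℂ) := by
  rw [unitVec, LinearIsometryEquiv.inner_map_map]; simp

@[simp] theorem vec_unitVec {H : C} (z : Φ.obj H) : Φ.vec z Φ.unitVec = z := by
  change inner ℂ Φ.unitVec Φ.unitVec • z = z
  rw [inner_unitVec, one_smul]

variable {Φ} in
theorem unit_ext {E : Type*} [AddCommMonoid E] [Module ℂ E] [TopologicalSpace E]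
    {S T : Φ.obj (𝟙_ C) →L[ℂ] E} (h : S Φ.unitVec = T Φ.unitVec) : S = T := by
  ext z
  obtain ⟨r, rfl⟩ := Φ.exists_smul_unit z
  rw [map_smul, map_smul]; exact congrArg (r • ·) h

theorem map_leftUnitor_inv_apply (X : C) (x : Φ.obj X) :
    Φ.map (λ_ X).inv x = Φ.tmul Φ.unitVec x := by
  have h : Φ.map (λ_ X).hom (Φ.tmul Φ.unitVec x) = x := Φ.tensorIso_leftUnitor X x
  conv_lhs => rw [← h]
  rw [← ContinuousLinearMap.comp_apply, ← Φ.map_comp, Iso.hom_inv_id, Φ.map_id]; rfl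

theorem map_rightUnitor_inv_apply (X : C) (x : Φ.obj X) :
    Φ.map (ρ_ X).inv x = Φ.tmul x Φ.unitVec := by
  have h : Φ.map (ρ_ X).hom (Φ.tmul x Φ.unitVec) = x := Φ.tensorIso_rightUnitor X x
  conv_lhs => rw [← h]
  rw [← ContinuousLinearMap.comp_apply, ← Φ.map_comp, Iso.hom_inv_id, Φ.map_id]; rfl

end FibreFunctor

namespace OpSp

variable {C : Type u} [Category.{v} C] [MonoidalCategory C] [MonoidalWStarCategory C]
  {Φ : FibreFunctor.{w} C}

/-- The space of the adjoints of the operators in `P`. -/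
noncomputable def dag {X Y : OpSp Φ} (P : X ⟶ Y) : Y ⟶ X := gen (OpCat.dag '' set P)

theorem continuous_dag {X Y : OpCat Φ} : Continuous (OpCat.dag : (X ⟶ Y) → (Y ⟶ X)) :=
  (ContinuousLinearMap.adjoint (𝕜 := ℂ) (E := Φ.obj X.as) (F := Φ.obj Y.as)).continuous

theorem dag_gen {X Y : OpSp Φ} (S : Set (X.as ⟶ Y.as)) :
    dag (gen S) = gen (X := Y) (Y := X) (OpCat.dag '' S) := by
  refine set_injective (Set.Subset.antisymm (set_gen_subset ?_) (set_gen_subset ?_))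
  · let R : ClosedSubmodule ℂ (Y.as ⟶ X.as) := cspan (OpCat.dag '' S)
    let R' : ClosedSubmodule ℂ (X.as ⟶ Y.as) :=
      ⟨R.toSubmodule.comap (ContinuousLinearMap.adjoint (𝕜 := ℂ) (E := Φ.obj X.as.as)
        (F := Φ.obj Y.as.as)).toLinearEquiv.toLinearMap, R.isClosed.preimage continuous_dag⟩
    have : cspan S ≤ R' :=
      cspan_le.2 fun s hs => subset_cspan _ (Set.mem_image_of_mem _ hs)
    rintro _ ⟨s, hs, rfl⟩
    exact this hs
  · rintro _ ⟨s, hs, rfl⟩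
    exact subset_set_gen _ ⟨s, subset_set_gen _ hs, rfl⟩

theorem dag_dag {X Y : OpSp Φ} (P : X ⟶ Y) : dag (dag P) = P := by
  obtain ⟨S, rfl⟩ := exists_gen P
  rw [dag_gen, dag_gen, Set.image_image]
  simp only [OpCat.dag_dag, Set.image_id']

@[simp] theorem dag_comp {X Y Z : OpSp Φ} (P : X ⟶ Y) (Q : Y ⟶ Z) :
    dag (P ≫ Q) = dag Q ≫ dag P := by
  obtain ⟨S, rfl⟩ := exists_gen P
  obtain ⟨T, rfl⟩ := exists_gen Q
  rw [gen_comp, dag_gen, dag_gen, dag_gen, gen_comp]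
  exact congrArg gen (Set.image_image2_antidistrib OpCat.dag_comp)

@[simp] theorem dag_tensor {X X' Y Y' : OpSp Φ} (P : X ⟶ X') (Q : Y ⟶ Y') :
    dag (P ⊗ₘ Q) = dag P ⊗ₘ dag Q := by
  obtain ⟨S, rfl⟩ := exists_gen P
  obtain ⟨T, rfl⟩ := exists_gen Q
  rw [gen_tensor, dag_gen S, dag_gen T, gen_tensor]
  exact (dag_gen _).trans (congrArg gen (Set.image_image2_distrib OpCat.dag_tensor))

theorem dag_sing {X Y : OpCat Φ} (T : X ⟶ Y) : dag (sing T) = sing (OpCat.dag T) := by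
  rw [sing, dag_gen, Set.image_singleton]; rfl

variable (Φ) in
/-- The line spanned by the operator of a morphism of `C`. -/
noncomputable def J {X Y : C} (f : X ⟶ Y) : (⟨⟨X⟩⟩ : OpSp Φ) ⟶ ⟨⟨Y⟩⟩ := sing (OpCat.ι Φ f)

@[simp] theorem J_comp {X Y Z : C} (f : X ⟶ Y) (g : Y ⟶ Z) : J Φ (f ≫ g) = J Φ f ≫ J Φ g := by
  rw [J, OpCat.ι_comp, sing_comp]; rfl

@[simp] theorem J_id (X : C) : J Φ (𝟙 X) = 𝟙 _ := by rw [J, OpCat.ι_id, sing_id]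

variable (Φ) in
/-- The isomorphism given by the lines spanned by an isomorphism of `C` and its inverse. -/
@[simps] noncomputable def JIso {X Y : C} (e : X ≅ Y) : (⟨⟨X⟩⟩ : OpSp Φ) ≅ ⟨⟨Y⟩⟩ where
  hom := J Φ e.hom
  inv := J Φ e.inv
  hom_inv_id := by rw [← J_comp, e.hom_inv_id, J_id]
  inv_hom_id := by rw [← J_comp, e.inv_hom_id, J_id]

theorem J_whiskerLeft (X : C) {Y Y' : C} (f : Y ⟶ Y') :
    J Φ (X ◁ f) = (⟨⟨X⟩⟩ : OpSp Φ) ◁ J Φ f := by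
  rw [J, OpCat.ι_whiskerLeft, sing_whiskerLeft]; rfl

theorem J_whiskerRight {X X' : C} (f : X ⟶ X') (Y : C) :
    J Φ (f ▷ Y) = J Φ f ▷ (⟨⟨Y⟩⟩ : OpSp Φ) := by
  rw [J, OpCat.ι_whiskerRight, sing_whiskerRight]; rfl

theorem dag_J {X Y : C} (f : X ⟶ Y) : dag (J Φ f) = J Φ (adj f) := by
  rw [J, dag_sing, OpCat.dag_ι]; rfl

theorem dag_J_iso {X Y : C} {e : X ≅ Y} (h : IsUnitaryHom e.hom) :
    dag (J Φ e.hom) = J Φ e.inv := by rw [dag_J, h.adj_hom]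

@[simp] theorem dag_id (X : OpSp Φ) : dag (𝟙 X) = 𝟙 X := by
  calc dag (𝟙 X) = dag (𝟙 X) ≫ dag (dag (𝟙 X)) := by rw [dag_dag, Category.comp_id]
    _ = 𝟙 X := by rw [← dag_comp, Category.comp_id, dag_dag]

@[simp] theorem dag_whiskerLeft (X : OpSp Φ) {Y Y' : OpSp Φ} (P : Y ⟶ Y') :
    dag (X ◁ P) = X ◁ dag P := by
  rw [← id_tensorHom, dag_tensor, dag_id, id_tensorHom]

@[simp] theorem dag_whiskerRight {X X' : OpSp Φ} (P : X ⟶ X') (Y : OpSp Φ) :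
    dag (P ▷ Y) = dag P ▷ Y := by
  rw [← tensorHom_id, dag_tensor, dag_id, tensorHom_id]

@[simp] theorem dag_associator (X Y Z : OpSp Φ) : dag (α_ X Y Z).hom = (α_ X Y Z).inv :=
  dag_J_iso (Φ := Φ) (MonoidalWStarCategory.unitary_associator X.as.as Y.as.as Z.as.as)

@[simp] theorem dag_associator_inv (X Y Z : OpSp Φ) : dag (α_ X Y Z).inv = (α_ X Y Z).hom := by
  rw [← dag_associator, dag_dag]

@[simp] theorem dag_rightUnitor (X : OpSp Φ) : dag (ρ_ X).hom = (ρ_ X).inv :=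
  dag_J_iso (Φ := Φ) (MonoidalWStarCategory.unitary_rightUnitor X.as.as)

@[simp] theorem dag_rightUnitor_inv (X : OpSp Φ) : dag (ρ_ X).inv = (ρ_ X).hom := by
  rw [← dag_rightUnitor, dag_dag]

/-- The space of all operators from the Hilbert space of the unit object, that is, of all vectors
of the Hilbert space of `K`. -/
noncomputable def ket (K : OpSp Φ) : 𝟙_ (OpSp Φ) ⟶ K := gen Set.univ

/-- The space of all operators to the Hilbert space of the unit object, that is, of all bounded
functionals on the Hilbert space of `K`. -/
noncomputable def bra (K : OpSp Φ) : K ⟶ 𝟙_ (OpSp Φ) := gen Set.univ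

@[simp] theorem dag_ket (K : OpSp Φ) : dag (ket K) = bra K := by
  rw [ket, dag_gen, Set.image_univ_of_surjective]
  · rfl
  · exact fun f => ⟨OpCat.dag f, OpCat.dag_dag f⟩

@[simp] theorem dag_bra (K : OpSp Φ) : dag (bra K) = ket K := by rw [← dag_ket, dag_dag]

theorem ket_iso {X Y : C} (e : X ≅ Y) : ket (Φ := Φ) ⟨⟨X⟩⟩ ≫ J Φ e.hom = ket ⟨⟨Y⟩⟩ := by
  refine (gen_comp _ _).trans (congrArg gen (Set.eq_univ_of_forall fun f => ?_))
  refine ⟨f ≫ OpCat.ι Φ e.inv, Set.mem_univ _, _, rfl, ?_⟩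
  change (f ≫ OpCat.ι Φ e.inv) ≫ OpCat.ι Φ e.hom = f
  rw [Category.assoc, ← OpCat.ι_comp, e.inv_hom_id, OpCat.ι_id, Category.comp_id]

theorem iso_bra {X Y : C} (e : X ≅ Y) : J Φ e.hom ≫ bra ⟨⟨Y⟩⟩ = bra (Φ := Φ) ⟨⟨X⟩⟩ := by
  refine (gen_comp _ _).trans (congrArg gen (Set.eq_univ_of_forall fun f => ?_))
  refine ⟨_, rfl, OpCat.ι Φ e.inv ≫ f, Set.mem_univ _, ?_⟩
  change OpCat.ι Φ e.hom ≫ OpCat.ι Φ e.inv ≫ f = f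
  rw [← Category.assoc, ← OpCat.ι_comp, e.hom_inv_id, OpCat.ι_id, Category.id_comp]

/-- The vectors of a tensor product are limits of sums of elementary tensors. -/
theorem ket_tensor (K M : OpSp Φ) : (λ_ (𝟙_ (OpSp Φ))).inv ≫ (ket K ⊗ₘ ket M) = ket (K ⊗ M) := by
  have h0 : (λ_ (𝟙_ (OpSp Φ))).inv ≫ (ket K ⊗ₘ ket M) =
      gen (Y := K ⊗ M) (Set.image2 (fun f g => (λ_ (𝟙_ (OpCat Φ))).inv ≫ (f ⊗ₘ g))
        Set.univ Set.univ) := by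
    rw [ket, ket, gen_tensor]
    refine (gen_comp {_} _).trans ?_
    rw [Set.image2_singleton_left, Set.image_image2]
    rfl
  rw [h0]
  refine set_injective (Set.Subset.antisymm (set_gen_subset ?_) (set_gen_subset ?_))
  · exact fun f _ => subset_set_gen _ (Set.mem_univ f)
  · intro f _
    let R : ClosedSubmodule ℂ (𝟙_ (OpCat Φ) ⟶ K.as ⊗ M.as) :=
      cspan (Set.image2 (fun f g => (λ_ (𝟙_ (OpCat Φ))).inv ≫ (f ⊗ₘ g)) Set.univ Set.univ)
    let V : Φ.obj (K.as.as ⊗ M.as.as) →L[ℂ] (𝟙_ (OpCat Φ) ⟶ K.as ⊗ M.as) := Φ.vec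
    have h : ∀ z, z ∈ R.comap V := by
      refine FibreFunctor.mem_of_tmul_mem _ fun x y => ?_
      refine subset_cspan _ ⟨Φ.vec x, Set.mem_univ _, Φ.vec y, Set.mem_univ _, ?_⟩
      refine FibreFunctor.unit_ext (Φ := Φ) ?_
      change Φ.tensorOp (Φ.vec x) (Φ.vec y) (Φ.map (λ_ (𝟙_ C)).inv Φ.unitVec) =
        Φ.vec (Φ.tmul x y) Φ.unitVec
      rw [Φ.map_leftUnitor_inv_apply, Φ.tensorOp_tmul]; simp
    have hf : f = V ((show Φ.obj (𝟙_ C) →L[ℂ] Φ.obj (K.as.as ⊗ M.as.as) from f) Φ.unitVec) :=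
      FibreFunctor.unit_ext (Φ := Φ) (Φ.vec_unitVec _).symm
    rw [hf]
    exact h _

/-- The functionals on `K` take nonzero values on vectors, unless the Hilbert space of `K` is
zero. -/
theorem ket_bra (K : OpSp Φ) [Nontrivial (Φ.obj K.as.as)] : ket K ≫ bra K = 𝟙 (𝟙_ (OpSp Φ)) := by
  rw [ket, bra, gen_comp]
  refine set_injective (Set.Subset.antisymm (set_gen_subset ?_) (set_gen_subset ?_))
  · rintro _ ⟨f, -, g, -, rfl⟩
    let T : Φ.obj (𝟙_ C) →L[ℂ] Φ.obj (𝟙_ C) := f ≫ g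
    obtain ⟨r, hr⟩ := Φ.exists_smul_unit (T Φ.unitVec)
    have : T = r • ContinuousLinearMap.id ℂ _ := FibreFunctor.unit_ext (Φ := Φ) hr
    change T ∈ cspan {ContinuousLinearMap.id ℂ _}
    rw [this]
    exact Submodule.smul_mem _ _ (subset_cspan _ rfl)
  · rintro _ rfl
    obtain ⟨x, hx⟩ := exists_norm_eq (Φ.obj K.as.as) (zero_le_one (α := ℝ))
    refine subset_set_gen _ ⟨Φ.vec x, Set.mem_univ _,
      ContinuousLinearMap.adjoint (Φ.vec x), Set.mem_univ _, ?_⟩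
    refine FibreFunctor.unit_ext (Φ := Φ) ?_
    change ContinuousLinearMap.adjoint (Φ.vec x) (Φ.vec x Φ.unitVec) = Φ.unitVec
    refine ext_inner_right ℂ fun z => ?_
    obtain ⟨r, rfl⟩ := Φ.exists_smul_unit z
    rw [ContinuousLinearMap.adjoint_inner_left, map_smul]
    change inner ℂ _ (r • Φ.vec x Φ.unitVec) = inner ℂ _ (r • Φ.unitVec)
    rw [inner_smul_right, inner_smul_right, Φ.vec_unitVec, Φ.inner_unitVec,
      inner_self_eq_norm_sq_to_K, hx]
    simp

end OpSp

/-! ### Compact operators and slices -/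

section Compact

variable {E F : Type w} [NormedAddCommGroup E] [InnerProductSpace ℂ E]
  [NormedAddCommGroup F] [InnerProductSpace ℂ F]

open InnerProductSpace in
/-- Compact operators to a Hilbert space are norm limits of operators of finite rank. -/
theorem mem_closedSpan_rankOne [CompleteSpace E] [CompleteSpace F] {T : E →L[ℂ] F}
    (hT : IsCompactOperator T) :
    T ∈ closedSpan {S : E →L[ℂ] F | ∃ x y, S = rankOne ℂ x y} := by
  have hfin : ∀ (U : Submodule ℂ F) [FiniteDimensional ℂ U],
      U.starProjection ∘L T ∈ Submodule.span ℂ {S : E →L[ℂ] F | ∃ x y, S = rankOne ℂ x y} := by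
    intro U _
    have h : U.starProjection ∘L T =
        ∑ i, rankOne ℂ ((stdOrthonormalBasis ℂ U i : F))
          (ContinuousLinearMap.adjoint T (stdOrthonormalBasis ℂ U i : F)) := by
      ext x
      rw [_root_.sum_apply, ContinuousLinearMap.comp_apply,
        (stdOrthonormalBasis ℂ U).starProjection_eq_sum_rankOne, _root_.sum_apply]
      refine Finset.sum_congr rfl fun i _ => ?_
      rw [rankOne_apply, rankOne_apply, ContinuousLinearMap.adjoint_inner_left]
    rw [h]
    exact Submodule.sum_mem _ fun i _ => Submodule.subset_span ⟨_, _, rfl⟩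
  refine Metric.mem_closure_iff.2 fun ε hε => ?_
  have hK : TotallyBounded (T '' Metric.closedBall 0 1) :=
    (hT.isCompact_closure_image_closedBall 1).totallyBounded.subset subset_closure
  obtain ⟨t, htf, ht⟩ := Metric.totallyBounded_iff.1 hK (ε / 2) (half_pos hε)
  let U : Submodule ℂ F := Submodule.span ℂ t
  have : FiniteDimensional ℂ U := FiniteDimensional.span_of_finite ℂ htf
  -- the projection onto the span of an `ε / 2`-net of the image of the unit ball approximates `T`
  refine ⟨_, hfin U, ?_⟩
  rw [dist_eq_norm]
  refine lt_of_le_of_lt ?_ (half_lt_self hε)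
  refine ContinuousLinearMap.opNorm_le_of_unit_norm (half_pos hε).le fun x hx => ?_
  have hx' : T x ∈ T '' Metric.closedBall 0 1 := ⟨x, by simp [hx], rfl⟩
  obtain ⟨y, hy, hxy⟩ := Set.mem_iUnion₂.1 (ht hx')
  rw [_root_.sub_apply, ContinuousLinearMap.comp_apply]
  change ‖T x - U.starProjection (T x)‖ ≤ ε / 2
  rw [Submodule.starProjection_minimal]
  refine (ciInf_le ⟨0, by rintro _ ⟨z, rfl⟩; positivity⟩
    (⟨y, Submodule.subset_span hy⟩ : U)).trans ?_
  rw [← dist_eq_norm]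
  exact (Metric.mem_ball.1 hxy).le

end Compact

namespace OpSp

variable {C : Type u} [Category.{v} C] [MonoidalCategory C] [MonoidalWStarCategory C]
  {Φ : FibreFunctor.{w} C}

/-- The products of a vector and a functional are the operators of rank one, and these span the
compact operators. -/
theorem set_bra_ket (H K : C) : set (bra (Φ := Φ) ⟨⟨H⟩⟩ ≫ ket ⟨⟨K⟩⟩) =
    {T : Φ.obj H →L[ℂ] Φ.obj K | IsCompactOperator T} := by
  rw [bra, ket, gen_comp]
  refine Set.Subset.antisymm ?_ ?_
  · let P : ClosedSubmodule ℂ (Φ.obj H →L[ℂ] Φ.obj K) :=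
      ⟨compactOperator (RingHom.id ℂ) (Φ.obj H) (Φ.obj K), isClosed_setOfPred_isCompactOperator⟩
    refine cspan_le (P := P).2 ?_
    rintro _ ⟨f, -, g, -, rfl⟩
    have : FiniteDimensional ℂ (Φ.obj (𝟙_ C)) :=
      LinearEquiv.finiteDimensional Φ.unitIso.toLinearEquiv
    have : ProperSpace (Φ.obj (𝟙_ C)) := FiniteDimensional.proper ℂ _
    exact (isCompactOperator_of_locallyCompactSpace_dom
      (show Φ.obj H →L[ℂ] Φ.obj (𝟙_ C) from f)).clm_comp
      (show Φ.obj (𝟙_ C) →L[ℂ] Φ.obj K from g)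
  · intro T hT
    refine (cspan_le (P := cspan _)).2 ?_ (mem_closedSpan_rankOne hT)
    rintro _ ⟨x, y, rfl⟩
    refine subset_cspan _ ⟨ContinuousLinearMap.adjoint (Φ.vec y), Set.mem_univ _, Φ.vec x,
      Set.mem_univ _, ?_⟩
    change Φ.vec x ∘L ContinuousLinearMap.adjoint (Φ.vec y) = _
    ext z
    have h : ContinuousLinearMap.adjoint (Φ.vec y) z = inner ℂ y z • Φ.unitVec := by
      refine ext_inner_right ℂ fun t => ?_
      obtain ⟨r, rfl⟩ := Φ.exists_smul_unit t
      rw [ContinuousLinearMap.adjoint_inner_left, map_smul]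
      change inner ℂ z (r • Φ.vec y Φ.unitVec) = inner ℂ _ (r • Φ.unitVec)
      rw [inner_smul_right, inner_smul_right, Φ.vec_unitVec, inner_smul_left, Φ.inner_unitVec,
        inner_conj_symm, mul_one]
    rw [ContinuousLinearMap.comp_apply, h, map_smul, Φ.vec_unitVec,
      InnerProductSpace.rankOne_apply]

/-- The operators `x ↦ x ⊗ ξ` with a vector `ξ` of the Hilbert space of `K`. -/
noncomputable def ketR (H K : OpSp Φ) : H ⟶ H ⊗ K := (ρ_ H).inv ≫ H ◁ ket K

/-- The adjoints of the operators `x ↦ x ⊗ ξ`. -/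
noncomputable def braR (H K : OpSp Φ) : H ⊗ K ⟶ H := H ◁ bra K ≫ (ρ_ H).hom

/-- The closed linear span of the slices `(id ⊗ ω)(T)` of the operators `T` that belong to `P`. -/
noncomputable def slice {H K H' K' : OpSp Φ} (P : H ⊗ K ⟶ H' ⊗ K') : H ⟶ H' :=
  ketR H K ≫ P ≫ braR H' K'

@[simp] theorem dag_ketR (H K : OpSp Φ) : dag (ketR H K) = braR H K := by simp [ketR, braR]

@[simp] theorem dag_braR (H K : OpSp Φ) : dag (braR H K) = ketR H K := by simp [ketR, braR]

theorem dag_slice {H K H' K' : OpSp Φ} (P : H ⊗ K ⟶ H' ⊗ K') :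
    dag (slice P) = slice (dag P) := by simp [slice]

theorem ketR_eq (H K : C) : ketR (Φ := Φ) ⟨⟨H⟩⟩ ⟨⟨K⟩⟩ = gen (Set.range (Φ.rket H (K := K))) := by
  rw [ketR, ← id_tensorHom]
  refine (congrArg (_ ≫ ·) (gen_tensor {𝟙 _} Set.univ)).trans ?_
  refine (gen_comp {_} _).trans (congrArg gen ?_)
  rw [Set.image2_singleton_left, Set.image2_singleton_left, Set.image_image]
  have h : ∀ ξ : Φ.obj K, Φ.tensorOp (ContinuousLinearMap.id ℂ _) (Φ.vec ξ) ∘L Φ.map (ρ_ H).inv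
      = Φ.rket H ξ := by
    intro ξ; ext x
    rw [ContinuousLinearMap.comp_apply, Φ.map_rightUnitor_inv_apply, Φ.tensorOp_tmul,
      Φ.vec_unitVec]; rfl
  refine Set.Subset.antisymm ?_ ?_
  · rintro _ ⟨f, -, rfl⟩
    refine ⟨(show Φ.obj (𝟙_ C) →L[ℂ] Φ.obj K from f) Φ.unitVec, ?_⟩
    rw [← h]
    have : Φ.vec ((show Φ.obj (𝟙_ C) →L[ℂ] Φ.obj K from f) Φ.unitVec) = f :=
      FibreFunctor.unit_ext (Φ := Φ) (Φ.vec_unitVec _)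
    rw [this]
    exact congrArg (fun t => (ρ_ (⟨H⟩ : OpCat Φ)).inv ≫ t) (id_tensorHom (⟨H⟩ : OpCat Φ) f).symm
  · rintro _ ⟨ξ, rfl⟩
    refine ⟨Φ.vec ξ, Set.mem_univ _, ?_⟩
    rw [← h]; rfl

theorem slice_J_eq {H K H' K' : C} (X : H ⊗ K ⟶ H' ⊗ K') :
    slice (H := ⟨⟨H⟩⟩) (K := ⟨⟨K⟩⟩) (H' := ⟨⟨H'⟩⟩) (K' := ⟨⟨K'⟩⟩) (J Φ X) =
      gen {S | ∃ (ξ : Φ.obj K) (η : Φ.obj K'), S = ContinuousLinearMap.adjoint (Φ.rket H' η) ∘L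
        Φ.map X ∘L Φ.rket H ξ} := by
  rw [slice, ← dag_ketR, ketR_eq, ketR_eq, dag_gen]
  refine (congrArg (_ ≫ ·) (gen_comp {_} _)).trans ((gen_comp _ _).trans (congrArg gen ?_))
  rw [Set.image2_singleton_left]
  ext S
  constructor
  · rintro ⟨_, ⟨ξ, rfl⟩, _, ⟨_, ⟨_, ⟨η, rfl⟩, rfl⟩, rfl⟩, rfl⟩
    exact ⟨ξ, η, rfl⟩
  · rintro ⟨ξ, η, rfl⟩
    exact ⟨_, ⟨ξ, rfl⟩, _, ⟨_, ⟨_, ⟨η, rfl⟩, rfl⟩, rfl⟩, rfl⟩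

theorem norm_rket_le (H : C) {K : C} (ξ : Φ.obj K) : ‖Φ.rket H ξ‖ ≤ ‖ξ‖ :=
  ContinuousLinearMap.opNorm_le_bound _ (norm_nonneg _) fun x => by
    rw [Φ.rket_apply, Φ.norm_tmul, mul_comm]

/-- The slices by normal functionals and those by vector functionals have the same closed linear
span, since normal functionals are norm limits of sums of vector functionals. -/
theorem set_slice_J {H K H' K' : C} (X : H ⊗ K ⟶ H' ⊗ K') :
    set (slice (H := ⟨⟨H⟩⟩) (K := ⟨⟨K⟩⟩) (H' := ⟨⟨H'⟩⟩) (K' := ⟨⟨K'⟩⟩) (J Φ X)) = Φ.slices X := by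
  rw [slice_J_eq]
  have hkey : ∀ (ξ : Φ.obj K) (η : Φ.obj K') (x : Φ.obj H') (y : Φ.obj H),
      inner ℂ x ((ContinuousLinearMap.adjoint (Φ.rket H' η) ∘L Φ.map X ∘L Φ.rket H ξ) y) =
        inner ℂ η ((ContinuousLinearMap.adjoint (Φ.ket K' x) ∘L Φ.map X ∘L Φ.ket K y) ξ) := by
    intro ξ η x y
    simp only [ContinuousLinearMap.comp_apply, ContinuousLinearMap.adjoint_inner_right]
    rfl
  refine Set.Subset.antisymm ((cspan_le (P := cspan _)).2 ?_) ((cspan_le (P := cspan _)).2 ?_)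
  -- a vector functional is the normal functional of two sequences with one nonzero entry
  · rintro _ ⟨ξ, η, rfl⟩
    refine subset_cspan _ ⟨fun T => inner ℂ η (T ξ), ⟨fun n => if n = 0 then ξ else 0,
      fun n => if n = 0 then η else 0, ?_, ?_, ?_⟩, ?_⟩
    · exact summable_of_ne_finset_zero (s := {0}) fun n hn => by
        simp [Finset.mem_singleton.not.1 hn]
    · exact summable_of_ne_finset_zero (s := {0}) fun n hn => by
        simp [Finset.mem_singleton.not.1 hn]
    · intro T
      rw [tsum_eq_single 0 fun n hn => by simp [hn]]
      simp
    · exact hkey ξ η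
  · rintro S ⟨ω, ⟨ξ, η, hξ, hη, hω⟩, hS⟩
    let V : ℕ → (Φ.obj H →L[ℂ] Φ.obj H') := fun n =>
      ContinuousLinearMap.adjoint (Φ.rket H' (η n)) ∘L Φ.map X ∘L Φ.rket H (ξ n)
    have hsum : Summable V := by
      refine Summable.of_norm_bounded (g := fun n => ‖Φ.map X‖ * (‖ξ n‖ ^ 2 + ‖η n‖ ^ 2))
        ((hξ.add hη).mul_left _) fun n => ?_
      calc ‖V n‖ ≤ ‖η n‖ * (‖Φ.map X‖ * ‖ξ n‖) := by
            refine (ContinuousLinearMap.opNorm_comp_le _ _).trans ?_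
            rw [LinearIsometryEquiv.norm_map]
            refine mul_le_mul (norm_rket_le _ _) ((ContinuousLinearMap.opNorm_comp_le _ _).trans ?_)
              (norm_nonneg _) (norm_nonneg _)
            exact mul_le_mul_of_nonneg_left (norm_rket_le _ _) (norm_nonneg _)
        _ = ‖Φ.map X‖ * (‖ξ n‖ * ‖η n‖) := by ring
        _ ≤ _ := by
            refine mul_le_mul_of_nonneg_left ?_ (norm_nonneg _)
            nlinarith [sq_nonneg (‖ξ n‖ - ‖η n‖), sq_nonneg (‖ξ n‖), sq_nonneg (‖η n‖)]
    have hSV : S = ∑' n, V n := by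
      refine ContinuousLinearMap.ext fun y => ext_inner_left ℂ fun x => ?_
      rw [hS, hω]
      have h1 := (hsum.hasSum.mapL
        ((innerSL ℂ x) ∘L (ContinuousLinearMap.apply ℂ (Φ.obj H') y))).tsum_eq
      exact (tsum_congr fun n => (hkey _ _ _ _).symm).trans h1
    rw [hSV]
    exact (Submodule.isClosed_topologicalClosure _).mem_of_tendsto hsum.hasSum.tendsto_sum_nat
      (Filter.Eventually.of_forall fun n => Submodule.sum_mem _ fun i _ =>
        subset_cspan _ ⟨_, _, rfl⟩)

end OpSp

/-! ### The diagrammatic calculus of slices -/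

namespace OpSp

variable {C : Type u} [Category.{v} C] [MonoidalCategory C] [MonoidalWStarCategory C]
  {Φ : FibreFunctor.{w} C}

theorem ketR_naturality {H H' : OpSp Φ} (P : H ⟶ H') (K : OpSp Φ) :
    ketR H K ≫ P ▷ K = P ≫ ketR H' K := by
  simp [ketR, whisker_exchange]

theorem braR_naturality {H H' : OpSp Φ} (P : H ⟶ H') (K : OpSp Φ) :
    P ▷ K ≫ braR H' K = braR H K ≫ P := by
  have h := congrArg dag (ketR_naturality (dag P) K)
  simpa [dag_dag] using h

theorem ketR_associator (H K M : OpSp Φ) :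
    ketR (H ⊗ K) M ≫ (α_ H K M).hom = H ◁ ketR K M := by
  simp [ketR]

theorem whiskerLeft_ketR_associator_inv (H K M : OpSp Φ) :
    H ◁ ketR K M ≫ (α_ H K M).inv = ketR (H ⊗ K) M := by
  rw [← ketR_associator, Category.assoc, Iso.hom_inv_id, Category.comp_id]

theorem associator_inv_braR (H K M : OpSp Φ) :
    (α_ H K M).inv ≫ braR (H ⊗ K) M = H ◁ braR K M := by
  have h := congrArg dag (ketR_associator H K M)
  simpa using h

theorem associator_whiskerLeft_braR (H K M : OpSp Φ) :
    (α_ H K M).hom ≫ H ◁ braR K M = braR (H ⊗ K) M := by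
  rw [← associator_inv_braR, Iso.hom_inv_id_assoc]

theorem ketR_tensor (H K M : OpSp Φ) :
    ketR H (K ⊗ M) = ketR H K ≫ ketR (H ⊗ K) M ≫ (α_ H K M).hom := by
  rw [ketR_associator, ketR, ketR, ketR, ← ket_tensor, MonoidalCategory.tensorHom_def]
  rw [Category.assoc, ← whiskerLeft_comp, rightUnitor_inv_naturality_assoc, unitors_inv_equal]

theorem ketR_tensor_associator_inv (H K M : OpSp Φ) :
    ketR H (K ⊗ M) ≫ (α_ H K M).inv = ketR H K ≫ ketR (H ⊗ K) M := by
  simp [ketR_tensor]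

theorem associator_braR_tensor (H K M : OpSp Φ) :
    (α_ H K M).hom ≫ braR H (K ⊗ M) = braR (H ⊗ K) M ≫ braR H K := by
  have h := congrArg dag (ketR_tensor_associator_inv H K M)
  simpa using h

theorem braR_ketR (H K M : OpSp Φ) :
    braR H K ≫ ketR H M = H ◁ (bra K ≫ ket M) := by
  simp [braR, ketR]

theorem ketR_braR (H K : OpSp Φ) [Nontrivial (Φ.obj K.as.as)] : ketR H K ≫ braR H K = 𝟙 H := by
  simp only [ketR, braR, Category.assoc, ← whiskerLeft_comp_assoc, ket_bra]
  simp

theorem ket_ketR (H K : OpSp Φ) : ket H ≫ ketR H K = ket (H ⊗ K) := by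
  rw [← ket_tensor, ketR, MonoidalCategory.tensorHom_def, rightUnitor_inv_naturality_assoc,
    unitors_inv_equal]

/-- An operator `G` whose slices span the compact operators links `T` and `S` in the second leg
in the same way as all rank one operators do, that is, by a product with a slice of `T`. -/
theorem ketR_link {H₁ K₁ H₂ K₂ K₂' M₁ M₂ Z : OpSp Φ} (T : H₁ ⊗ K₁ ⟶ H₂ ⊗ K₂)
    (G : K₂ ⊗ M₁ ⟶ K₂' ⊗ M₂) (S : H₂ ⊗ K₂' ⟶ Z) (hG : slice G = bra K₂ ≫ ket K₂') :
    ketR H₁ (K₁ ⊗ M₁) ≫ (α_ H₁ K₁ M₁).inv ≫ T ▷ M₁ ≫ (α_ H₂ K₂ M₁).hom ≫ H₂ ◁ G ≫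
      (α_ H₂ K₂' M₂).inv ≫ S ▷ M₂ ≫ braR Z M₂ = slice T ≫ ketR H₂ K₂' ≫ S := by
  rw [reassoc_of% ketR_tensor_associator_inv, reassoc_of% ketR_naturality,
    reassoc_of% ketR_associator, braR_naturality, reassoc_of% associator_inv_braR,
    ← whiskerLeft_comp_assoc, ← whiskerLeft_comp_assoc,
    Category.assoc]
  rw [slice] at hG
  rw [hG, ← braR_ketR, slice]
  simp only [Category.assoc]

/-- The space of products of slices is a space of slices. -/
theorem slice_link {H₁ K₁ H₂ K₂ K₂' M₁ M₂ H₃ K₃ : OpSp Φ} (T : H₁ ⊗ K₁ ⟶ H₂ ⊗ K₂)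
    (G : K₂ ⊗ M₁ ⟶ K₂' ⊗ M₂) (S : H₂ ⊗ K₂' ⟶ H₃ ⊗ K₃) (hG : slice G = bra K₂ ≫ ket K₂') :
    slice ((α_ H₁ K₁ M₁).inv ≫ T ▷ M₁ ≫ (α_ H₂ K₂ M₁).hom ≫ H₂ ◁ G ≫
      (α_ H₂ K₂' M₂).inv ≫ S ▷ M₂ ≫ (α_ H₃ K₃ M₂).hom) = slice T ≫ slice S := by
  rw [slice]
  simp only [Category.assoc]
  rw [associator_braR_tensor, reassoc_of% ketR_link T G _ hG, slice, slice]

theorem slice_whiskerLeft (H : OpSp Φ) {H₁ K₁ H₂ K₂ : OpSp Φ} (P : H₁ ⊗ K₁ ⟶ H₂ ⊗ K₂) :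
    slice ((α_ H H₁ K₁).hom ≫ H ◁ P ≫ (α_ H H₂ K₂).inv) = H ◁ slice P := by
  simp only [slice, Category.assoc]
  rw [associator_inv_braR, reassoc_of% ketR_associator]
  simp

theorem slice_whiskerRight_comp {H H₁ K₁ H₂ K₂ : OpSp Φ} (Q : H ⟶ H₁) (P : H₁ ⊗ K₁ ⟶ H₂ ⊗ K₂) :
    slice (Q ▷ K₁ ≫ P) = Q ≫ slice P := by
  simp only [slice, Category.assoc]
  rw [reassoc_of% ketR_naturality]

theorem slice_comp_whiskerRight {H H₁ K₁ H₂ K₂ : OpSp Φ} (P : H₁ ⊗ K₁ ⟶ H₂ ⊗ K₂) (Q : H₂ ⟶ H) :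
    slice (P ≫ Q ▷ K₂) = slice P ≫ Q := by
  simp only [slice, Category.assoc]
  rw [braR_naturality]

theorem slice_whiskerLeft_comp {H H' K K' M : OpSp Φ} (Q : M ⟶ K) (P : H ⊗ K ⟶ H' ⊗ K')
    (hQ : ket M ≫ Q = ket K) : slice (H ◁ Q ≫ P) = slice P := by
  simp only [slice, ketR, Category.assoc]
  rw [← whiskerLeft_comp_assoc, hQ]

theorem slice_comp_whiskerLeft {H H' K K' M : OpSp Φ} (P : H ⊗ K ⟶ H' ⊗ K') (Q : K' ⟶ M)
    (hQ : Q ≫ bra M = bra K') : slice (P ≫ H' ◁ Q) = slice P := by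
  simp only [slice, braR, Category.assoc]
  rw [← whiskerLeft_comp_assoc, hQ]

/-! ### The space of slices of a regular multiplicative unitary -/

variable {L : OpSp Φ} {F F' c' : L ⊗ L ⟶ L ⊗ L}

/-- The operators `x ↦ F (a x ⊗ ξ)`, where `a` is a slice of `F'` and `ξ` a vector, have the same
closed linear span as the operators `x ↦ a x ⊗ ξ`. By regularity, the compact operators that link
`F'` to `F` can be taken to be slices of `F ≫ c'`; multiplicativity, in the form of `hmul`, then
cancels the second copy of `F`. -/
theorem slice_ketR_comp (hF : ket (L ⊗ L) ≫ F = ket (L ⊗ L))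
    (hc : slice c' = bra L ≫ ket L) (hreg : slice (F ≫ c') = bra L ≫ ket L)
    (hmul : F' ▷ L ≫ (α_ L L L).hom ≫ L ◁ (F ≫ c') ≫ (α_ L L L).inv ≫ F ▷ L =
      (α_ L L L).hom ≫ L ◁ F ≫ (α_ L L L).inv ≫ F' ▷ L ≫ (α_ L L L).hom ≫ L ◁ c' ≫
        (α_ L L L).inv) :
    slice F' ≫ ketR L L ≫ F = slice F' ≫ ketR L L := by
  rw [← ketR_link F' _ F hreg]
  have h1 := congrArg (fun P => ketR L (L ⊗ L) ≫ (α_ L L L).inv ≫ P ≫ braR (L ⊗ L) L) hmul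
  simp only [Category.assoc, Iso.inv_hom_id_assoc] at h1
  rw [h1]
  have h2 : ketR L (L ⊗ L) ≫ L ◁ F = ketR L (L ⊗ L) := by
    rw [ketR, Category.assoc, ← whiskerLeft_comp, hF]
  rw [← Category.assoc (ketR L (L ⊗ L)), h2]
  have h3 := ketR_link F' c' (𝟙 (L ⊗ L)) hc
  rw [id_whiskerRight, Category.id_comp, Category.comp_id] at h3
  exact h3

/-- The space of slices is a `C⋆`-algebra: one has `[A A⋆] = A⋆` for `A = slice F`, so that `A` is
selfadjoint. -/
theorem slice_selfAdjoint [Nontrivial (Φ.obj L.as.as)] (hF' : F' = dag F)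
    (h : slice F' ≫ ketR L L ≫ F = slice F' ≫ ketR L L) :
    dag (slice F) = slice F ∧ slice F ≫ slice F = slice F := by
  have h1 : slice F' ≫ slice F = slice F' := by
    rw [slice, slice, ← slice, ← Category.assoc (ketR L L), ← Category.assoc, h,
      Category.assoc, ketR_braR, Category.comp_id]
  have h2 : dag (slice F') = slice F := by rw [dag_slice, hF', dag_dag]
  have h3 : slice F' = slice F := by
    have := congrArg dag h1
    rw [dag_comp, h2, dag_slice, ← hF', h1] at this
    exact this
  rw [h3] at h1 h2
  exact ⟨h2, h1⟩

theorem ket_slice [Nontrivial (Φ.obj L.as.as)] (hF : ket (L ⊗ L) ≫ F = ket (L ⊗ L)) :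
    ket L ≫ slice F = ket L := by
  rw [slice, ← Category.assoc, ket_ketR, ← Category.assoc, hF, ← ket_ketR, Category.assoc,
    ketR_braR, Category.comp_id]

end OpSp

/-! ### Crossed products -/

section Monoidal

variable {D : Type u} [Category.{v} D] [MonoidalCategory D]
  {H₁ H₂ K₁ K₂ : D} (X : H₁ ⊗ K₁ ⟶ H₁ ⊗ K₁) (Y : H₂ ⊗ K₂ ⟶ H₂ ⊗ K₂)
  (a : H₂ ⊗ H₁ ≅ H₁ ⊗ H₂) (b : H₂ ⊗ K₁ ≅ K₁ ⊗ H₂) (g : K₂ ⊗ K₁ ≅ K₁ ⊗ K₂)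

/-- An operator on `H₁ ⊗ K₁` that crosses `H₂` by means of `a`. -/
def crossLeft : (H₁ ⊗ H₂) ⊗ K₁ ⟶ (H₁ ⊗ H₂) ⊗ K₁ :=
  a.inv ▷ K₁ ≫ (α_ H₂ H₁ K₁).hom ≫ H₂ ◁ X ≫ (α_ H₂ H₁ K₁).inv ≫ a.hom ▷ K₁

/-- An operator on `H₂ ⊗ K₂`, acting trivially on `H₁`. -/
def crossRight (H₁ : D) : (H₁ ⊗ H₂) ⊗ K₂ ⟶ (H₁ ⊗ H₂) ⊗ K₂ :=
  (α_ H₁ H₂ K₂).hom ≫ H₁ ◁ Y ≫ (α_ H₁ H₂ K₂).inv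

/-- The operators `crossRight Y H₁` and `crossLeft X a`, in this order, linked by the crossing `g`
of their auxiliary legs. -/
def crossLink : (H₁ ⊗ H₂) ⊗ (K₂ ⊗ K₁) ⟶ (H₁ ⊗ H₂) ⊗ (K₁ ⊗ K₂) :=
  (α_ _ _ _).inv ≫ crossRight Y H₁ ▷ K₁ ≫ (α_ _ _ _).hom ≫ (H₁ ⊗ H₂) ◁ g.hom ≫
    (α_ _ _ _).inv ≫ crossLeft X a ▷ K₂ ≫ (α_ _ _ _).hom

/-- The operators `crossLeft X a` and `crossRight Y H₁` linked by `g⁻¹` in the opposite order. -/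
def crossLink' : (H₁ ⊗ H₂) ⊗ (K₁ ⊗ K₂) ⟶ (H₁ ⊗ H₂) ⊗ (K₂ ⊗ K₁) :=
  (α_ _ _ _).inv ≫ crossLeft X a ▷ K₂ ≫ (α_ _ _ _).hom ≫ (H₁ ⊗ H₂) ◁ g.inv ≫
    (α_ _ _ _).inv ≫ crossRight Y H₁ ▷ K₁ ≫ (α_ _ _ _).hom

variable {X Y a b g}

/-- The two ways of linking agree, because `X` and `Y` can be pulled apart through the crossings
`b` and `g`. -/
theorem crossLink_comm
    (hX : H₂ ◁ X ≫ (α_ _ _ _).inv ≫ a.hom ▷ K₁ ≫ (α_ _ _ _).hom ≫ H₁ ◁ b.hom ≫ (α_ _ _ _).inv =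
      ((α_ _ _ _).inv ≫ a.hom ▷ K₁ ≫ (α_ _ _ _).hom ≫ H₁ ◁ b.hom ≫ (α_ _ _ _).inv) ≫ X ▷ H₂)
    (hY : Y ▷ K₁ ≫ (α_ _ _ _).hom ≫ H₂ ◁ g.hom ≫ (α_ _ _ _).inv ≫ b.hom ▷ K₂ ≫ (α_ _ _ _).hom =
      ((α_ _ _ _).hom ≫ H₂ ◁ g.hom ≫ (α_ _ _ _).inv ≫ b.hom ▷ K₂ ≫ (α_ _ _ _).hom) ≫ K₁ ◁ Y) :
    (H₁ ⊗ H₂) ◁ g.hom ≫ crossLink' X Y a g = crossLink X Y a g ≫ (H₁ ⊗ H₂) ◁ g.inv := by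
  let m : (H₁ ⊗ H₂) ⊗ K₁ ≅ (H₁ ⊗ K₁) ⊗ H₂ :=
    α_ _ _ _ ≪≫ whiskerLeftIso H₁ b ≪≫ (α_ _ _ _).symm
  let N : (H₁ ⊗ H₂) ⊗ (K₂ ⊗ K₁) ≅ (H₁ ⊗ K₁) ⊗ (H₂ ⊗ K₂) :=
    whiskerLeftIso (H₁ ⊗ H₂) g ≪≫ (α_ _ _ _).symm ≪≫ whiskerRightIso m K₂ ≪≫ α_ _ _ _
  let y : (H₁ ⊗ H₂) ⊗ (K₂ ⊗ K₁) ⟶ (H₁ ⊗ H₂) ⊗ (K₂ ⊗ K₁) :=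
    (α_ _ _ _).inv ≫ crossRight Y H₁ ▷ K₁ ≫ (α_ _ _ _).hom
  let w : (H₁ ⊗ H₂) ⊗ (K₂ ⊗ K₁) ⟶ (H₁ ⊗ H₂) ⊗ (K₂ ⊗ K₁) :=
    (H₁ ⊗ H₂) ◁ g.hom ≫ (α_ _ _ _).inv ≫ crossLeft X a ▷ K₂ ≫ (α_ _ _ _).hom ≫
      (H₁ ⊗ H₂) ◁ g.inv
  have hm : crossLeft X a ≫ m.hom = m.hom ≫ X ▷ H₂ := by
    have h := congrArg (fun P => a.inv ▷ K₁ ≫ (α_ _ _ _).hom ≫ P) hX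
    simpa [crossLeft, m] using h
  have hw : w ≫ N.hom = N.hom ≫ X ▷ (H₂ ⊗ K₂) := by
    have h := congrArg (fun P => (H₁ ⊗ H₂) ◁ g.hom ≫ (α_ _ _ _).inv ≫ P ▷ K₂ ≫ (α_ _ _ _).hom) hm
    simp only [w, N, Iso.trans_hom, whiskerLeftIso_hom, Iso.symm_hom, whiskerRightIso_hom,
      Category.assoc, whiskerLeft_inv_hom_assoc, Iso.hom_inv_id_assoc, comp_whiskerRight] at h ⊢
    rw [h]
    simp
  have hy : y ≫ N.hom = N.hom ≫ (H₁ ⊗ K₁) ◁ Y := by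
    have h := congrArg (fun P => (α_ _ _ _).hom ≫ H₁ ◁ ((α_ _ _ _).inv ≫ P) ≫ (α_ _ _ _).inv) hY
    have e1 : N.hom = (α_ _ _ _).hom ≫ H₁ ◁ ((α_ _ _ _).inv ≫ (α_ _ _ _).hom ≫ H₂ ◁ g.hom ≫
      (α_ _ _ _).inv ≫ b.hom ▷ K₂ ≫ (α_ _ _ _).hom) ≫ (α_ _ _ _).inv := by
      simp only [N, m, Iso.trans_hom, whiskerLeftIso_hom, Iso.symm_hom, whiskerRightIso_hom]
      monoidal
    have e2 : y = (α_ _ _ _).hom ≫ H₁ ◁ ((α_ _ _ _).inv ≫ Y ▷ K₁ ≫ (α_ _ _ _).hom) ≫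
        (α_ _ _ _).inv := by
      simp only [y, crossRight]
      monoidal
    rw [e1, e2]
    simp only [Category.assoc, whiskerLeft_comp, Iso.inv_hom_id_assoc] at h ⊢
    rw [h]
    simp
  have hyw : y ≫ w = w ≫ y := by
    rw [← cancel_mono N.hom, Category.assoc, hw, reassoc_of% hy, Category.assoc, hy,
      reassoc_of% hw, whisker_exchange]
  have l1 : (H₁ ⊗ H₂) ◁ g.hom ≫ crossLink' X Y a g = w ≫ y := by
    simp only [crossLink', w, y, Category.assoc]
  have l2 : crossLink X Y a g ≫ (H₁ ⊗ H₂) ◁ g.inv = y ≫ w := by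
    simp only [crossLink, w, y, Category.assoc]
  rw [l1, l2, hyw]

end Monoidal

namespace OpSp

variable {C : Type u} [Category.{v} C] [MonoidalCategory C] [MonoidalWStarCategory C]
  {Φ : FibreFunctor.{w} C} {H₁ H₂ K₁ K₂ : OpSp Φ} {X : H₁ ⊗ K₁ ⟶ H₁ ⊗ K₁}
  {Y : H₂ ⊗ K₂ ⟶ H₂ ⊗ K₂} {a : H₂ ⊗ H₁ ≅ H₁ ⊗ H₂} {b : H₂ ⊗ K₁ ≅ K₁ ⊗ H₂}
  {g : K₂ ⊗ K₁ ≅ K₁ ⊗ K₂}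

theorem slice_crossLeft : slice (crossLeft X a) = a.inv ≫ H₂ ◁ slice X ≫ a.hom := by
  rw [crossLeft, slice_whiskerRight_comp, ← slice_whiskerLeft, ← slice_comp_whiskerRight]
  simp only [Category.assoc]

theorem slice_crossRight : slice (crossRight Y H₁) = H₁ ◁ slice Y := slice_whiskerLeft _ _

theorem slice_crossLink (hg : slice g.hom = bra K₂ ≫ ket K₁) :
    slice (crossLink X Y a g) = (H₁ ◁ slice Y) ≫ a.inv ≫ H₂ ◁ slice X ≫ a.hom := by
  rw [crossLink, slice_link _ _ _ hg, slice_crossLeft, slice_crossRight]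

theorem slice_crossLink' (hg : slice g.inv = bra K₁ ≫ ket K₂) :
    slice (crossLink' X Y a g) = (a.inv ≫ H₂ ◁ slice X ≫ a.hom) ≫ (H₁ ◁ slice Y) := by
  rw [crossLink', slice_link _ _ _ hg, slice_crossLeft, slice_crossRight]

/-! ### Simplifiability -/

variable {L : OpSp Φ} {F F' : L ⊗ L ⟶ L ⊗ L} {c : L ⊗ L ≅ L ⊗ L} {A : L ⟶ L}

/-- The image of the comultiplication, as a space of slices: multiplicativity expresses
`F₁₂⁻¹ F₂₃ F₁₂` as a product of two copies of `F`, one of them crossing the middle leg, that share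
the last leg. -/
theorem comul_eq_slice (hA : A = slice F)
    (hmul : F ▷ L ≫ (α_ L L L).hom ≫ L ◁ F ≫ (α_ L L L).inv ≫ F' ▷ L =
      (α_ L L L).hom ≫ L ◁ F ≫ (α_ L L L).inv ≫ c.hom ▷ L ≫ (α_ L L L).hom ≫ L ◁ F ≫
        (α_ L L L).inv ≫ c.inv ▷ L) :
    F ≫ L ◁ A ≫ F' = L ◁ ketR L L ≫ L ◁ F ≫ (α_ L L L).inv ≫ c.hom ▷ L ≫ (α_ L L L).hom ≫
      L ◁ F ≫ L ◁ braR L L ≫ c.inv := by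
  rw [hA, ← slice_whiskerLeft, ← slice_comp_whiskerRight, ← slice_whiskerRight_comp]
  simp only [Category.assoc]
  rw [hmul, slice]
  simp only [Category.assoc]
  rw [reassoc_of% ketR_associator, braR_naturality, reassoc_of% associator_inv_braR]

/-- The identity `[Δ(A)(1 ⊗ A)] = [(A ⊠ 1)(1 ⊗ A)]` for `Δ(a) = F' (1 ⊗ a) F`: with `Δ(A)` written
as a space of slices by `comul_eq_slice`, its first factor `F` is absorbed by `1 ⊗ A`. -/
theorem whiskerLeft_comp_comul (hA : A = slice F) (hF : A ≫ ketR L L ≫ F = A ≫ ketR L L)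
    (hmul : F ▷ L ≫ (α_ L L L).hom ≫ L ◁ F ≫ (α_ L L L).inv ≫ F' ▷ L =
      (α_ L L L).hom ≫ L ◁ F ≫ (α_ L L L).inv ≫ c.hom ▷ L ≫ (α_ L L L).hom ≫ L ◁ F ≫
        (α_ L L L).inv ≫ c.inv ▷ L) :
    L ◁ A ≫ F ≫ L ◁ A ≫ F' = L ◁ A ≫ c.hom ≫ L ◁ A ≫ c.inv := by
  rw [comul_eq_slice hA hmul]
  have h1 : L ◁ A ≫ L ◁ ketR L L ≫ L ◁ F = L ◁ A ≫ L ◁ ketR L L := by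
    rw [← whiskerLeft_comp, ← whiskerLeft_comp, hF, whiskerLeft_comp]
  rw [reassoc_of% h1, reassoc_of% whiskerLeft_ketR_associator_inv, reassoc_of% ketR_naturality,
    reassoc_of% ketR_associator]
  simp only [hA, slice, whiskerLeft_comp, Category.assoc]

/-- The identity `[(A ⊠ 1) Δ(A)] = [(A ⊠ 1)(1 ⊗ A)]` for `Δ(a) = F' (1 ⊗ a) F`: with `Δ(A)` written
as a space of slices by `comul_eq_slice`, its last factor `F` is absorbed by `A ⊠ 1`. -/
theorem comul_comp_cross (hA : A = slice F) (hF : F ≫ braR L L ≫ A = braR L L ≫ A)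
    (hmul : F ▷ L ≫ (α_ L L L).hom ≫ L ◁ F ≫ (α_ L L L).inv ≫ F' ▷ L =
      (α_ L L L).hom ≫ L ◁ F ≫ (α_ L L L).inv ≫ c.hom ▷ L ≫ (α_ L L L).hom ≫ L ◁ F ≫
        (α_ L L L).inv ≫ c.inv ▷ L) :
    (F ≫ L ◁ A ≫ F') ≫ c.hom ≫ L ◁ A ≫ c.inv = L ◁ A ≫ c.hom ≫ L ◁ A ≫ c.inv := by
  rw [comul_eq_slice hA hmul]
  have h1 : L ◁ F ≫ L ◁ braR L L ≫ L ◁ A = L ◁ braR L L ≫ L ◁ A := by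
    rw [← whiskerLeft_comp, ← whiskerLeft_comp, hF, whiskerLeft_comp]
  simp only [Category.assoc, Iso.inv_hom_id_assoc]
  rw [reassoc_of% h1, reassoc_of% associator_whiskerLeft_braR, reassoc_of% braR_naturality,
    reassoc_of% associator_inv_braR]
  simp only [hA, slice, whiskerLeft_comp, Category.assoc]

end OpSp

/-! ### Ampliations followed by conjugations -/

section Monoidal

variable {D : Type u} [Category.{v} D] [MonoidalCategory D]
  {K K' H H' H'' H₁ H₁' H₂ H₂' H₃ L : D}

/-- The ampliation of `a` by `K`, conjugated by `V`. -/
def ad (V : K ⊗ H ≅ H') (a : H ⟶ H) : H' ⟶ H' := V.inv ≫ K ◁ a ≫ V.hom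

theorem ad_comp (V : K ⊗ H ≅ H') (a b : H ⟶ H) : ad V (a ≫ b) = ad V a ≫ ad V b := by
  simp [ad]

theorem ad_eq_of_comm {V : K ⊗ H ≅ H'} {a : H ⟶ H} {b : H' ⟶ H'}
    (h : K ◁ a ≫ V.hom = V.hom ≫ b) : ad V a = b := by
  rw [ad, h, Iso.inv_hom_id_assoc]

/-- The isomorphism that implements `f ⊠ id`, where `V` implements `f`. -/
@[simps!] def boxFst (V : K ⊗ H₁ ≅ H₁') (H₂ : D) : K ⊗ (H₁ ⊗ H₂) ≅ H₁' ⊗ H₂ :=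
  (α_ K H₁ H₂).symm ≪≫ whiskerRightIso V H₂

/-- The isomorphism that implements `id ⊠ g`, where `U` implements `g` and `s` is the crossing of
`K` and `H₁`. -/
@[simps!] def boxSnd (s : K ⊗ H₁ ≅ H₁ ⊗ K) (U : K ⊗ H₂ ≅ H₂') : K ⊗ (H₁ ⊗ H₂) ≅ H₁ ⊗ H₂' :=
  (α_ K H₁ H₂).symm ≪≫ whiskerRightIso s H₂ ≪≫ α_ H₁ K H₂ ≪≫ whiskerLeftIso H₁ U

/-- The isomorphism that implements the composite of the maps implemented by `U` and `V`. -/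
@[simps!] def adTrans (U : K ⊗ H ≅ H') (V : K' ⊗ H' ≅ H'') : (K' ⊗ K) ⊗ H ≅ H'' :=
  α_ K' K H ≪≫ whiskerLeftIso K' U ≪≫ V

theorem ad_adTrans (U : K ⊗ H ≅ H') (V : K' ⊗ H' ≅ H'') (a : H ⟶ H) :
    ad (adTrans U V) a = ad V (ad U a) := by
  simp [ad]

theorem ad_leftUnitor (e : H ≅ H') (a : H ⟶ H) :
    ad (λ_ H ≪≫ e) a = e.inv ≫ a ≫ e.hom := by
  simp [ad]

theorem ad_boxFst_left {V : K ⊗ H₁ ≅ H₁'} {s : H₂ ⊗ K ≅ K ⊗ H₂} {c : H₂ ⊗ H₁ ≅ H₁ ⊗ H₂}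
    {c' : H₂ ⊗ H₁' ≅ H₁' ⊗ H₂}
    (h : H₂ ◁ V.hom ≫ c'.hom = (α_ _ _ _).inv ≫ s.hom ▷ H₁ ≫ (α_ _ _ _).hom ≫ K ◁ c.hom ≫
      (α_ _ _ _).inv ≫ V.hom ▷ H₂) (a : H₁ ⟶ H₁) :
    ad (boxFst V H₂) (ad c a) = ad c' (ad V a) := by
  have h' : c'.hom = H₂ ◁ V.inv ≫ (α_ _ _ _).inv ≫ s.hom ▷ H₁ ≫ (α_ _ _ _).hom ≫ K ◁ c.hom ≫
      (boxFst V H₂).hom := by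
    rw [← cancel_epi (H₂ ◁ V.hom), h]; simp
  refine (ad_eq_of_comm ?_).symm
  have h1 : H₂ ◁ K ◁ a ≫ (α_ _ _ _).inv ≫ s.hom ▷ H₁ ≫ (α_ _ _ _).hom =
      (α_ _ _ _).inv ≫ s.hom ▷ H₁ ≫ (α_ _ _ _).hom ≫ K ◁ H₂ ◁ a := by
    rw [associator_inv_naturality_right_assoc, whisker_exchange_assoc,
      associator_naturality_right]
  rw [h']
  simp only [ad, whiskerLeft_comp, Category.assoc, whiskerLeft_hom_inv_assoc,
    Iso.hom_inv_id_assoc]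
  rw [reassoc_of% h1]

theorem ad_boxFst_right (V : K ⊗ H₁ ≅ H₁') (a : H₂ ⟶ H₂) :
    ad (boxFst V H₂) (H₁ ◁ a) = H₁' ◁ a := by
  refine ad_eq_of_comm ?_
  rw [boxFst_hom, associator_inv_naturality_right_assoc, whisker_exchange, Category.assoc]

theorem ad_boxSnd_left {U : K ⊗ H₂ ≅ H₂'} {s : K ⊗ H₁ ≅ H₁ ⊗ K} {c : H₂ ⊗ H₁ ≅ H₁ ⊗ H₂}
    {c' : H₂' ⊗ H₁ ≅ H₁ ⊗ H₂'}
    (h : U.hom ▷ H₁ ≫ c'.hom = (α_ _ _ _).hom ≫ K ◁ c.hom ≫ (α_ _ _ _).inv ≫ s.hom ▷ H₂ ≫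
      (α_ _ _ _).hom ≫ H₁ ◁ U.hom) (a : H₁ ⟶ H₁) :
    ad (boxSnd s U) (ad c a) = ad c' a := by
  have h' : c'.hom = U.inv ▷ H₁ ≫ (α_ _ _ _).hom ≫ K ◁ c.hom ≫ (boxSnd s U).hom := by
    rw [← cancel_epi (U.hom ▷ H₁), h]; simp
  refine (ad_eq_of_comm ?_).symm
  rw [h', whisker_exchange_assoc]
  simp [ad]

theorem ad_boxSnd_right (U : K ⊗ H₂ ≅ H₂') (s : K ⊗ H₁ ≅ H₁ ⊗ K) (a : H₂ ⟶ H₂) :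
    ad (boxSnd s U) (H₁ ◁ a) = H₁ ◁ ad U a := by
  refine ad_eq_of_comm ?_
  rw [boxSnd_hom, associator_inv_naturality_right_assoc, whisker_exchange_assoc]
  simp [ad]

/-- Conjugation with the associator maps the first leg of `(A₁ ⊠ A₂) ⊠ A₃` to that of
`A₁ ⊠ (A₂ ⊠ A₃)`. -/
theorem associator_conj_left {c₂₁ : H₂ ⊗ H₁ ≅ H₁ ⊗ H₂} {c₃₂ : H₃ ⊗ H₂ ≅ H₂ ⊗ H₃}
    {e : H₃ ⊗ (H₁ ⊗ H₂) ≅ (H₁ ⊗ H₂) ⊗ H₃} {e' : (H₂ ⊗ H₃) ⊗ H₁ ≅ H₁ ⊗ (H₂ ⊗ H₃)}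
    (h : H₃ ◁ c₂₁.hom ≫ e.hom ≫ (α_ _ _ _).hom =
      (α_ _ _ _).inv ≫ c₃₂.hom ▷ H₁ ≫ e'.hom) (a : H₁ ⟶ H₁) :
    (α_ H₁ H₂ H₃).inv ≫ ad e (ad c₂₁ a) ≫ (α_ H₁ H₂ H₃).hom = ad e' a := by
  refine (ad_eq_of_comm ?_).symm
  have h' : e'.hom = c₃₂.inv ▷ H₁ ≫ (α_ _ _ _).hom ≫ H₃ ◁ c₂₁.hom ≫ e.hom ≫
      (α_ _ _ _).hom := by
    rw [h]; simp
  rw [h', whisker_exchange_assoc]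
  simp [ad]

/-- Conjugation with the associator maps the second leg of `(A₁ ⊠ A₂) ⊠ A₃` to that of
`A₁ ⊠ (A₂ ⊠ A₃)`. -/
theorem associator_conj_middle {c₃₁ : H₃ ⊗ H₁ ≅ H₁ ⊗ H₃} {c₃₂ : H₃ ⊗ H₂ ≅ H₂ ⊗ H₃}
    {e : H₃ ⊗ (H₁ ⊗ H₂) ≅ (H₁ ⊗ H₂) ⊗ H₃}
    (h : e.hom ≫ (α_ _ _ _).hom =
      (α_ _ _ _).inv ≫ c₃₁.hom ▷ H₂ ≫ (α_ _ _ _).hom ≫ H₁ ◁ c₃₂.hom) (a : H₂ ⟶ H₂) :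
    (α_ H₁ H₂ H₃).inv ≫ ad e (H₁ ◁ a) ≫ (α_ H₁ H₂ H₃).hom = H₁ ◁ ad c₃₂ a := by
  rw [← cancel_epi ((α_ H₁ H₂ H₃).hom), Iso.hom_inv_id_assoc, ← cancel_epi e.hom,
    reassoc_of% h, ad]
  simp only [Category.assoc, Iso.hom_inv_id_assoc, h]
  rw [associator_inv_naturality_right_assoc, whisker_exchange_assoc]
  simp [ad]

theorem associator_conj_right (a : H₃ ⟶ H₃) :
    (α_ H₁ H₂ H₃).inv ≫ (H₁ ⊗ H₂) ◁ a ≫ (α_ H₁ H₂ H₃).hom = H₁ ◁ H₂ ◁ a := by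
  simp

/-- Coassociativity of a comultiplication implemented by `V`: the two ways to iterate it are
implemented by isomorphisms that differ by `t` on the first two strands, and these are the strands
by which `a` is ampliated. -/
theorem coassoc_of_comm {V s t : L ⊗ L ≅ L ⊗ L}
    (h : (α_ _ _ _).inv ≫ t.hom ▷ L ≫ (α_ _ _ _).hom ≫ L ◁ V.hom ≫ (α_ _ _ _).inv ≫ s.hom ▷ L ≫
        (α_ _ _ _).hom ≫ L ◁ V.hom =
      L ◁ V.hom ≫ (α_ _ _ _).inv ≫ V.hom ▷ L ≫ (α_ _ _ _).hom) (a : L ⟶ L) :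
    (α_ L L L).inv ≫ ad (boxFst V L) (ad V a) ≫ (α_ L L L).hom = ad (boxSnd s V) (ad V a) := by
  let R : L ⊗ (L ⊗ L) ≅ L ⊗ (L ⊗ L) := whiskerLeftIso L V ≪≫ (α_ _ _ _).symm ≪≫
    whiskerRightIso V L ≪≫ α_ _ _ _
  let R' : L ⊗ (L ⊗ L) ≅ L ⊗ (L ⊗ L) := whiskerLeftIso L V ≪≫ boxSnd s V
  let T : L ⊗ (L ⊗ L) ≅ L ⊗ (L ⊗ L) := (α_ _ _ _).symm ≪≫ whiskerRightIso t L ≪≫ α_ _ _ _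
  have hR : R = T ≪≫ R' := by
    ext; simpa [R, R', T] using h.symm
  have h1 : (α_ L L L).inv ≫ ad (boxFst V L) (ad V a) ≫ (α_ L L L).hom = ad R (L ◁ a) := by
    simp [ad, R]
  have h2 : ad (boxSnd s V) (ad V a) = ad R' (L ◁ a) := by
    simp [ad, R']
  have h3 : T.inv ≫ L ◁ L ◁ a ≫ T.hom = L ◁ L ◁ a := by
    rw [Iso.inv_comp_eq]
    simp only [T, Iso.trans_hom, Iso.symm_hom, whiskerRightIso_hom, Category.assoc]
    rw [associator_inv_naturality_right_assoc, whisker_exchange_assoc,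
      associator_naturality_right]
  rw [h1, h2, hR, ad, ad, Iso.trans_hom, Iso.trans_inv]
  simp only [Category.assoc]
  rw [reassoc_of% h3]

end Monoidal

/-! ### Algebras and morphisms as operator spaces -/

namespace OpSp

variable {C : Type u} [Category.{v} C] [MonoidalCategory C] [MonoidalWStarCategory C]
  {Φ : FibreFunctor.{w} C}

theorem mem_comp {X Y Z : OpSp Φ} {P : X ⟶ Y} {Q : Y ⟶ Z} {f : X.as ⟶ Y.as} {g : Y.as ⟶ Z.as}
    (hf : f ∈ set P) (hg : g ∈ set Q) : f ≫ g ∈ set (P ≫ Q) := by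
  rw [← gen_set P, ← gen_set Q, gen_comp]
  exact subset_set_gen _ ⟨f, hf, g, hg, rfl⟩

theorem set_comp_subset {X Y Z : OpSp Φ} {P : X ⟶ Y} {Q : Y ⟶ Z} {R : X ⟶ Z}
    (h : ∀ f ∈ set P, ∀ g ∈ set Q, f ≫ g ∈ set R) : set (P ≫ Q) ⊆ set R := by
  rw [← gen_set P, ← gen_set Q, gen_comp]
  refine set_gen_subset ?_
  rintro _ ⟨f, hf, g, hg, rfl⟩
  exact h f hf g hg

theorem mem_dag {X Y : OpSp Φ} {P : X ⟶ Y} {f : X.as ⟶ Y.as} (hf : f ∈ set P) :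
    OpCat.dag f ∈ set (dag P) := subset_set_gen _ ⟨f, hf, rfl⟩

theorem whiskerLeft_gen (X : OpSp Φ) {Y Z : OpSp Φ} (S : Set (Y.as ⟶ Z.as)) :
    X ◁ gen S = gen (X := X ⊗ Y) (Y := X ⊗ Z) ((X.as ◁ ·) '' S) := by
  rw [← id_tensorHom]
  refine (gen_tensor {𝟙 _} S).trans (congrArg gen ?_)
  rw [Set.image2_singleton_left]
  exact Set.image_congr fun f _ => id_tensorHom _ _

variable (Φ) in
/-- The closed linear span of the slices of a morphism of `C`. -/
noncomputable def sliceJ {H K H' K' : C} (X : H ⊗ K ⟶ H' ⊗ K') : (⟨⟨H⟩⟩ : OpSp Φ) ⟶ ⟨⟨H'⟩⟩ :=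
  slice (H := ⟨⟨H⟩⟩) (K := ⟨⟨K⟩⟩) (H' := ⟨⟨H'⟩⟩) (K' := ⟨⟨K'⟩⟩) (J Φ X)

theorem set_sliceJ {H K H' K' : C} (X : H ⊗ K ⟶ H' ⊗ K') : set (sliceJ Φ X) = Φ.slices X :=
  set_slice_J X

theorem add_mem_set {X Y : OpSp Φ} {P : X ⟶ Y} {f g : X.as ⟶ Y.as} (hf : f ∈ set P)
    (hg : g ∈ set P) : f + g ∈ set P :=
  (show ClosedSubmodule ℂ (X.as ⟶ Y.as) from P).add_mem hf hg

theorem zero_mem_set {X Y : OpSp Φ} (P : X ⟶ Y) : 0 ∈ set P :=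
  (show ClosedSubmodule ℂ (X.as ⟶ Y.as) from P).zero_mem

theorem smul_mem_set {X Y : OpSp Φ} {P : X ⟶ Y} {f : X.as ⟶ Y.as} (r : ℂ) (hf : f ∈ set P) :
    r • f ∈ set P :=
  (show ClosedSubmodule ℂ (X.as ⟶ Y.as) from P).smul_mem r hf

end OpSp

open OpSp

section Algebras

variable {C : Type u} [Category.{v} C] [MonoidalCategory C] [MonoidalWStarCategory C]
  {Φ : FibreFunctor.{w} C} {H H' H'' K K' : C}

namespace FibreFunctor

/-- The ampliation of `a` by `K`, conjugated by an isomorphism of `C`. -/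
noncomputable def adOp (V : K ⊗ H ≅ H') (a : Φ.Op H) : Φ.Op H' := Φ.conj V (Φ.idTensor K a)

/-- The map `a ↦ V (id ⊗ a) V⋆` of a unitary `V`, as a unital `⋆`-homomorphism. -/
noncomputable def adHom (V : K ⊗ H ≅ H') (hV : IsUnitaryHom V.hom) : Φ.Op H →⋆ₐ[ℂ] Φ.Op H' :=
  have hlin : ∀ a b : Φ.Op H, Φ.adOp V (a + b) = Φ.adOp V a + Φ.adOp V b := fun a b => by
    have : Φ.idTensor K (a + b) = Φ.idTensor K a + Φ.idTensor K b :=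
      map_add (Φ.tensorOpL K K H H (ContinuousLinearMap.id ℂ _)) a b
    rw [adOp, this, conj, ContinuousLinearMap.add_comp, ContinuousLinearMap.comp_add]; rfl
  have hone : Φ.adOp V (1 : Φ.Op H) = 1 := by
    have h1 : Φ.idTensor K (1 : Φ.Op H) = ContinuousLinearMap.id ℂ _ := Φ.tensorOp_id
    rw [adOp, conj, h1, ContinuousLinearMap.id_comp, ← Φ.map_comp, V.inv_hom_id, Φ.map_id]; rfl
  have hsmul : ∀ (r : ℂ) (a : Φ.Op H), Φ.adOp V (r • a) = r • Φ.adOp V a := fun r a => by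
    have : Φ.idTensor K (r • a) = r • Φ.idTensor K a :=
      map_smul (Φ.tensorOpL K K H H (ContinuousLinearMap.id ℂ _)) r a
    rw [adOp, this, conj, ContinuousLinearMap.smul_comp, ContinuousLinearMap.comp_smul]; rfl
  { toFun := Φ.adOp V
    map_one' := hone
    map_mul' := fun a b => ad_comp (D := OpCat Φ) (K := ⟨K⟩) (H := ⟨H⟩) (OpCat.ιIso Φ V) b a
    map_zero' := by simpa using hsmul 0 0
    map_add' := hlin
    commutes' := fun r => by rw [Algebra.algebraMap_eq_smul_one, hsmul, hone,
      Algebra.algebraMap_eq_smul_one]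
    map_star' := fun a => by
      have h1 : ContinuousLinearMap.adjoint (Φ.idTensor K a) =
          Φ.idTensor K (ContinuousLinearMap.adjoint a) := by
        rw [idTensor_eq, tensorOp_adjoint, idTensor_eq, ContinuousLinearMap.adjoint_id]
      have h2 : ContinuousLinearMap.adjoint (Φ.map V.hom) = Φ.map V.inv := by
        rw [← Φ.map_adj, hV.adj_hom]
      change Φ.adOp V (ContinuousLinearMap.adjoint a) = ContinuousLinearMap.adjoint (Φ.adOp V a)
      rw [adOp, adOp, conj, conj, ContinuousLinearMap.adjoint_comp,
        ContinuousLinearMap.adjoint_comp, h1, h2, ← h2, ContinuousLinearMap.adjoint_adjoint]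
      rfl }

end FibreFunctor

namespace OpSp

/-- The space of the operators `V (id ⊗ a) V⁻¹` with `a` in `P`. -/
noncomputable def adSp (V : K ⊗ H ≅ H') (P : (⟨⟨H⟩⟩ : OpSp Φ) ⟶ ⟨⟨H⟩⟩) :
    (⟨⟨H'⟩⟩ : OpSp Φ) ⟶ ⟨⟨H'⟩⟩ := ad (K := ⟨⟨K⟩⟩) (H := ⟨⟨H⟩⟩) (JIso Φ V) P

theorem adSp_comp (V : K ⊗ H ≅ H') (P Q : (⟨⟨H⟩⟩ : OpSp Φ) ⟶ ⟨⟨H⟩⟩) :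
    adSp V (P ≫ Q) = adSp V P ≫ adSp V Q :=
  ad_comp (K := (⟨⟨K⟩⟩ : OpSp Φ)) (H := ⟨⟨H⟩⟩) (JIso Φ V) P Q

theorem dag_adSp {V : K ⊗ H ≅ H'} (hV : IsUnitaryHom V.hom) (P : (⟨⟨H⟩⟩ : OpSp Φ) ⟶ ⟨⟨H⟩⟩) :
    dag (adSp V P) = adSp V (dag P) := by
  have h1 : dag (J Φ V.hom) = J Φ V.inv := dag_J_iso hV
  have h2 : dag (J Φ V.inv) = J Φ V.hom := by rw [← h1, dag_dag]
  have h3 : dag ((⟨⟨K⟩⟩ : OpSp Φ) ◁ P) = ⟨⟨K⟩⟩ ◁ dag P := dag_whiskerLeft _ _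
  change dag (J Φ V.inv ≫ ((⟨⟨K⟩⟩ : OpSp Φ) ◁ P) ≫ J Φ V.hom) =
    J Φ V.inv ≫ ((⟨⟨K⟩⟩ : OpSp Φ) ◁ dag P) ≫ J Φ V.hom
  refine (dag_comp _ _).trans ?_
  rw [h2]
  refine (congrArg (· ≫ _) (dag_comp _ _)).trans ?_
  rw [h1, h3]
  exact Category.assoc _ _ _

theorem adSp_gen (V : K ⊗ H ≅ H') (S : Set (Φ.Op H)) :
    adSp V (gen (X := ⟨⟨H⟩⟩) (Y := ⟨⟨H⟩⟩) S) = gen (Φ.adOp V '' S) := by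
  have h : (⟨⟨K⟩⟩ : OpSp Φ) ◁ gen (X := ⟨⟨H⟩⟩) (Y := ⟨⟨H⟩⟩) S = _ := whiskerLeft_gen _ _
  rw [adSp, ad, h]
  refine (congrArg (_ ≫ ·) (gen_comp _ {_})).trans ((gen_comp {_} _).trans (congrArg gen ?_))
  rw [Set.image2_singleton_left, Set.image2_singleton_right, Set.image_image, Set.image_image]
  rfl

theorem set_adSp_eq (V : K ⊗ H ≅ H') (P : (⟨⟨H⟩⟩ : OpSp Φ) ⟶ ⟨⟨H⟩⟩) :
    adSp V P = gen (Φ.adOp V '' set P) := by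
  rw [← adSp_gen, gen_set]

end OpSp

namespace HatAlg

/-- The operator space underlying an algebra. -/
noncomputable def sp (A : HatAlg Φ H) : (⟨⟨H⟩⟩ : OpSp Φ) ⟶ ⟨⟨H⟩⟩ :=
  gen (A.alg : Set (Φ.Op H))

theorem set_sp (A : HatAlg Φ H) : set A.sp = A.alg := by
  obtain ⟨K, X, h⟩ := A.exists_slices
  rw [sp, h, ← set_sliceJ, gen_set]

theorem dag_sp (A : HatAlg Φ H) : dag A.sp = A.sp := by
  rw [sp, dag_gen]
  refine congrArg gen (Set.Subset.antisymm ?_ ?_)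
  · rintro _ ⟨a, ha, rfl⟩; exact star_mem (s := A.alg) ha
  · intro a ha
    have h : star (show Φ.Op H from a) ∈ A.alg := star_mem (s := A.alg) ha
    exact ⟨_, h, ContinuousLinearMap.adjoint_adjoint _⟩

theorem exists_sp_eq (A : HatAlg Φ H) : ∃ (K : C) (X : H ⊗ K ⟶ H ⊗ K), A.sp = sliceJ Φ X := by
  obtain ⟨K, X, h⟩ := A.exists_slices
  exact ⟨K, X, set_injective (by rw [set_sp, h, set_sliceJ])⟩

theorem ket_sp (A : HatAlg Φ H) : ket ⟨⟨H⟩⟩ ≫ A.sp = ket ⟨⟨H⟩⟩ := by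
  rw [ket, sp, gen_comp]
  refine set_injective (Set.Subset.antisymm (set_gen_subset ?_) (set_gen_subset ?_))
  · exact fun f _ => subset_set_gen _ (Set.mem_univ f)
  · intro f _
    let R : ClosedSubmodule ℂ (Φ.obj (𝟙_ C) →L[ℂ] Φ.obj H) :=
      cspan (Set.image2 (fun (p : 𝟙_ (OpCat Φ) ⟶ ⟨H⟩) (q : (⟨H⟩ : OpCat Φ) ⟶ ⟨H⟩) => p ≫ q)
        Set.univ A.alg)
    have h : cspan {ξ : Φ.obj H | ∃ a ∈ A.alg, ∃ η : Φ.obj H, ξ = a η} ≤ R.comap Φ.vec := by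
      refine cspan_le.2 ?_
      rintro _ ⟨a, ha, η, rfl⟩
      refine subset_cspan _ ⟨Φ.vec η, Set.mem_univ _, a, ha, ?_⟩
      refine FibreFunctor.unit_ext (Φ := Φ) ?_
      change a (Φ.vec η Φ.unitVec) = Φ.vec (a η) Φ.unitVec
      rw [Φ.vec_unitVec, Φ.vec_unitVec]
    have hf : f = Φ.vec ((show Φ.obj (𝟙_ C) →L[ℂ] Φ.obj H from f) Φ.unitVec) :=
      FibreFunctor.unit_ext (Φ := Φ) (Φ.vec_unitVec _).symm
    rw [hf]
    refine h ?_
    have htop := A.nondegenerate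
    change _ ∈ closedSpan _
    rw [htop]
    trivial

/-- The algebra with a given underlying operator space. -/
noncomputable def ofSp (P : (⟨⟨H⟩⟩ : OpSp Φ) ⟶ ⟨⟨H⟩⟩) (hdag : dag P = P) (hmul : P ≫ P = P)
    (hslice : ∃ (K : C) (X : H ⊗ K ⟶ H ⊗ K), P = sliceJ Φ X)
    (hket : ket ⟨⟨H⟩⟩ ≫ P = ket ⟨⟨H⟩⟩) : HatAlg Φ H where
  alg :=
    { carrier := set P
      add_mem' := add_mem_set
      zero_mem' := zero_mem_set P
      mul_mem' := fun {a b} ha hb => by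
        have h := mem_comp hb ha
        rw [hmul] at h
        exact h
      smul_mem' := fun r _ ha => smul_mem_set r ha
      star_mem' := fun {a} ha => by
        have h := mem_dag ha
        rw [hdag] at h
        exact h }
  exists_slices := by
    obtain ⟨K, X, h⟩ := hslice
    exact ⟨K, X, by rw [← set_sliceJ, ← h]; rfl⟩
  nondegenerate := by
    refine eq_top_iff.2 fun ζ _ => ?_
    let ev : (Φ.obj (𝟙_ C) →L[ℂ] Φ.obj H) →L[ℂ] Φ.obj H :=
      ContinuousLinearMap.apply ℂ (Φ.obj H) Φ.unitVec
    have h1 : Φ.vec ζ ∈ set (ket (Φ := Φ) ⟨⟨H⟩⟩ ≫ P) := by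
      rw [hket]; exact subset_set_gen _ (Set.mem_univ _)
    let R : ClosedSubmodule ℂ (Φ.obj H) :=
      cspan {ξ : Φ.obj H | ∃ a : Φ.Op H, a ∈ OpSp.set P ∧ ∃ η : Φ.obj H, ξ = a η}
    have h2 : OpSp.set (ket (Φ := Φ) ⟨⟨H⟩⟩ ≫ P) ⊆
        OpSp.set (X := 𝟙_ (OpSp Φ)) (Y := ⟨⟨H⟩⟩) (R.comap ev) := by
      refine set_comp_subset fun f _ a ha => ?_
      exact subset_cspan _ ⟨a, ha, _, rfl⟩
    have h3 : ev (Φ.vec ζ) ∈ R := h2 h1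
    have h4 : ev (Φ.vec ζ) = ζ := Φ.vec_unitVec ζ
    rw [h4] at h3
    exact h3

theorem sp_ofSp (P : (⟨⟨H⟩⟩ : OpSp Φ) ⟶ ⟨⟨H⟩⟩) (hdag : dag P = P) (hmul : P ≫ P = P)
    (hslice : ∃ (K : C) (X : H ⊗ K ⟶ H ⊗ K), P = sliceJ Φ X)
    (hket : ket ⟨⟨H⟩⟩ ≫ P = ket ⟨⟨H⟩⟩) : (ofSp P hdag hmul hslice hket).sp = P :=
  gen_set P

theorem mem_multipliers {A : HatAlg Φ H} {m : Φ.Op H}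
    (h : ∀ a ∈ A.alg, m * a ∈ A.alg) (h' : ∀ a ∈ A.alg, star m * a ∈ A.alg) :
    m ∈ A.multipliers := by
  refine fun a ha => ⟨h a ha, ?_⟩
  have := star_mem (h' _ (star_mem ha))
  simpa using this

end HatAlg

namespace HatHom

variable {A₁ : HatAlg Φ H} {A₂ : HatAlg Φ H'} {A₃ : HatAlg Φ H''}

theorem adOp_mul_mem {V : K ⊗ H ≅ H'}
    (h : A₂.sp ≫ adSp V A₁.sp = A₂.sp) {m : Φ.Op H} (hm : ∀ a ∈ A₁.alg, m * a ∈ A₁.alg)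
    {b : Φ.Op H'} (hb : b ∈ A₂.alg) : Φ.adOp V m * b ∈ A₂.alg := by
  have h' : A₂.sp ≫ adSp V (A₁.sp ≫ sing (Φ := Φ) (X := ⟨H⟩) (Y := ⟨H⟩) m) =
      A₂.sp ≫ adSp V (sing (Φ := Φ) (X := ⟨H⟩) (Y := ⟨H⟩) m) := by
    rw [adSp_comp, ← Category.assoc, h]
  have h1 : (show (⟨H'⟩ : OpCat Φ) ⟶ ⟨H'⟩ from b) ≫ Φ.adOp V m ∈
      set (A₂.sp ≫ adSp V (A₁.sp ≫ sing (Φ := Φ) (X := ⟨H⟩) (Y := ⟨H⟩) m)) := by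
    rw [h']
    refine mem_comp (by rw [A₂.set_sp]; exact hb) ?_
    rw [set_adSp_eq]
    exact subset_set_gen _ ⟨m, subset_set_gen _ rfl, rfl⟩
  have h2 : set (A₁.sp ≫ sing (Φ := Φ) (X := ⟨H⟩) (Y := ⟨H⟩) m) ⊆ set A₁.sp := by
    rw [sing, HatAlg.sp, gen_comp]
    refine set_gen_subset ?_
    rintro _ ⟨a, ha, _, rfl, rfl⟩
    exact subset_set_gen _ (hm a ha)
  have h3 : set (adSp V (A₁.sp ≫ sing (Φ := Φ) (X := ⟨H⟩) (Y := ⟨H⟩) m)) ⊆ set (adSp V A₁.sp) := by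
    rw [set_adSp_eq, set_adSp_eq]
    exact set_gen_subset ((Set.image_mono h2).trans (subset_set_gen _))
  have h4 := set_comp_subset (R := A₂.sp) (P := A₂.sp)
    (Q := adSp V (A₁.sp ≫ sing (Φ := Φ) (X := ⟨H⟩) (Y := ⟨H⟩) m))
    (fun f hf g hg => by
      have := mem_comp hf (h3 hg)
      rwa [h] at this)
  have h5 := h4 h1
  rw [A₂.set_sp] at h5
  exact h5

theorem adOp_mem_multipliers {V : K ⊗ H ≅ H'} (hV : IsUnitaryHom V.hom)
    (h : A₂.sp ≫ adSp V A₁.sp = A₂.sp) {m : Φ.Op H} (hm : m ∈ A₁.multipliers) :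
    Φ.adOp V m ∈ A₂.multipliers := by
  refine HatAlg.mem_multipliers (fun b hb => adOp_mul_mem h (fun a ha => (hm a ha).1) hb)
    fun b hb => ?_
  have h1 : star (Φ.adOp V m) = Φ.adOp V (star m) := (map_star (Φ.adHom V hV) m).symm
  rw [h1]
  exact adOp_mul_mem h (fun a ha => ((star_mem hm : star m ∈ A₁.multipliers) a ha).1) hb

/-- The morphism `a ↦ V (id ⊗ a) V⋆` of a unitary `V`. -/
noncomputable def ofIso (V : K ⊗ H ≅ H') (hV : IsUnitaryHom V.hom)
    (h : A₂.sp ≫ adSp V A₁.sp = A₂.sp) : HatHom A₁ A₂ where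
  hom :=
    { toFun := fun a => ⟨Φ.adOp V a, adOp_mem_multipliers hV h
        fun b hb => ⟨mul_mem a.2 hb, mul_mem hb a.2⟩⟩
      map_smul' := fun r a => Subtype.ext (map_smul (Φ.adHom V hV) r (a : Φ.Op H))
      map_zero' := Subtype.ext (map_zero (Φ.adHom V hV))
      map_add' := fun a b => Subtype.ext (map_add (Φ.adHom V hV) (a : Φ.Op H) b)
      map_mul' := fun a b => Subtype.ext (map_mul (Φ.adHom V hV) (a : Φ.Op H) b)
      map_star' := fun a => Subtype.ext (map_star (Φ.adHom V hV) (a : Φ.Op H)) }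
  nondegenerate := by
    rw [← A₂.set_sp]
    conv_rhs => rw [← h, set_adSp_eq, ← gen_set A₂.sp, gen_comp, A₂.set_sp, A₁.set_sp]
    refine congrArg
      (fun S : Set (Φ.Op H') => ((closedSpan S : Submodule ℂ (Φ.Op H')) : Set (Φ.Op H'))) ?_
    ext x
    constructor
    · rintro ⟨a, b, hb, rfl⟩
      exact ⟨b, hb, _, ⟨a, a.2, rfl⟩, rfl⟩
    · rintro ⟨b, hb, _, ⟨a, ha, rfl⟩, rfl⟩
      exact ⟨⟨a, ha⟩, b, hb, rfl⟩
  exists_isometry := ⟨K, V.hom, hV.1, fun a => by rw [hV.adj_hom]; rfl⟩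

theorem ofIso_app (V : K ⊗ H ≅ H') (hV : IsUnitaryHom V.hom)
    (h : A₂.sp ≫ adSp V A₁.sp = A₂.sp) (a : A₁.alg) :
    (ofIso V hV h).app a = Φ.adOp V a := rfl

/-- The extension of a morphism that is implemented by `V` to multipliers is implemented by
`V`. -/
theorem isHatComp_ofIso {V : K ⊗ H' ≅ H''} (hV : IsUnitaryHom V.hom)
    (hg : A₃.sp ≫ adSp V A₂.sp = A₃.sp) {f : HatHom A₁ A₂} {h : HatHom A₁ A₃}
    (hh : ∀ a, h.app a = Φ.adOp V (f.app a)) : IsHatComp (ofIso V hV hg) f h := by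
  refine ⟨{ toFun := fun m => ⟨Φ.adOp V m, adOp_mem_multipliers hV hg m.2⟩
            map_one' := Subtype.ext (map_one (Φ.adHom V hV))
            map_mul' := fun a b => Subtype.ext (map_mul (Φ.adHom V hV) (a : Φ.Op H') b)
            map_zero' := Subtype.ext (map_zero (Φ.adHom V hV))
            map_add' := fun a b => Subtype.ext (map_add (Φ.adHom V hV) (a : Φ.Op H') b)
            commutes' := fun r => Subtype.ext (AlgHomClass.commutes (Φ.adHom V hV) r)
            map_star' := fun a => Subtype.ext (map_star (Φ.adHom V hV) (a : Φ.Op H')) },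
    fun a m hm => Subtype.ext ?_, fun a => Subtype.ext (hh a)⟩
  change Φ.adOp V (m : Φ.Op H') = Φ.adOp V a
  rw [hm]

end HatHom

end Algebras

/-! ### Unitaries -/

section Unitary

variable {C : Type u} [Category.{v} C] [MonoidalCategory C] [MonoidalWStarCategory C]

theorem adj_id (X : C) : adj (𝟙 X) = 𝟙 X := by
  have h := CStarCategory.adj_comp (adj (𝟙 X)) (𝟙 X)
  rw [Category.comp_id, CStarCategory.adj_adj, Category.comp_id] at h
  exact h.symm

theorem IsUnitaryHom.comp {X Y Z : C} {f : X ⟶ Y} {g : Y ⟶ Z} (hf : IsUnitaryHom f)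
    (hg : IsUnitaryHom g) : IsUnitaryHom (f ≫ g) := by
  refine ⟨?_, ?_⟩
  · rw [CStarCategory.adj_comp, Category.assoc, ← Category.assoc g, hg.1, Category.id_comp, hf.1]
  · rw [CStarCategory.adj_comp, Category.assoc, ← Category.assoc (adj f), hf.2, Category.id_comp,
      hg.2]

theorem IsUnitaryHom.inv {X Y : C} {e : X ≅ Y} (h : IsUnitaryHom e.hom) : IsUnitaryHom e.inv := by
  rw [← h.adj_hom]
  exact ⟨by rw [CStarCategory.adj_adj]; exact h.2, by rw [CStarCategory.adj_adj]; exact h.1⟩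

theorem isUnitaryHom_id (X : C) : IsUnitaryHom (𝟙 X) := by
  constructor <;> simp [adj_id]

theorem IsUnitaryHom.tensor {X X' Y Y' : C} {f : X ⟶ X'} {g : Y ⟶ Y'} (hf : IsUnitaryHom f)
    (hg : IsUnitaryHom g) : IsUnitaryHom (f ⊗ₘ g) := by
  refine ⟨?_, ?_⟩
  · rw [MonoidalWStarCategory.adj_tensor, tensorHom_comp_tensorHom, hf.1, hg.1, id_tensorHom_id]
  · rw [MonoidalWStarCategory.adj_tensor, tensorHom_comp_tensorHom, hf.2, hg.2, id_tensorHom_id]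

theorem IsUnitaryHom.whiskerLeft (X : C) {Y Y' : C} {g : Y ⟶ Y'} (hg : IsUnitaryHom g) :
    IsUnitaryHom (X ◁ g) := by
  rw [← id_tensorHom]; exact (isUnitaryHom_id X).tensor hg

theorem IsUnitaryHom.whiskerRight {X X' : C} {f : X ⟶ X'} (hf : IsUnitaryHom f) (Y : C) :
    IsUnitaryHom (f ▷ Y) := by
  rw [← tensorHom_id]; exact hf.tensor (isUnitaryHom_id Y)

theorem isUnitaryHom_associator (X Y Z : C) : IsUnitaryHom (α_ X Y Z).hom :=
  MonoidalWStarCategory.unitary_associator X Y Z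

theorem IsUnitaryHom.boxFst {K H H' : C} {V : K ⊗ H ≅ H'} (hV : IsUnitaryHom V.hom) (H₂ : C) :
    IsUnitaryHom (boxFst V H₂).hom := by
  rw [boxFst_hom]
  exact (isUnitaryHom_associator _ _ _).inv.comp (hV.whiskerRight _)

theorem IsUnitaryHom.boxSnd {K H H' H₁ : C} {V : K ⊗ H ≅ H'} (hV : IsUnitaryHom V.hom)
    {s : K ⊗ H₁ ≅ H₁ ⊗ K} (hs : IsUnitaryHom s.hom) : IsUnitaryHom (boxSnd s V).hom := by
  rw [boxSnd_hom]
  exact (isUnitaryHom_associator _ _ _).inv.comp ((hs.whiskerRight _).comp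
    ((isUnitaryHom_associator _ _ _).comp (hV.whiskerLeft _)))

theorem IsUnitaryHom.adTrans {K K' H H' H'' : C} {U : K ⊗ H ≅ H'} {V : K' ⊗ H' ≅ H''}
    (hU : IsUnitaryHom U.hom) (hV : IsUnitaryHom V.hom) : IsUnitaryHom (adTrans U V).hom := by
  rw [adTrans_hom]
  exact (isUnitaryHom_associator _ _ _).comp ((hU.whiskerLeft _).comp hV)

end Unitary

/-! ### Tensor products of algebras -/

section Box

variable {C : Type u} [Category.{v} C] [MonoidalCategory C] [MonoidalWStarCategory C]

/-- Regularity of a braiding in terms of operator spaces. -/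
structure IsRegularSp (Φ : FibreFunctor.{w} C) (c : BraidedCategory C) : Prop where
  unitary : ∀ H K : C, IsUnitaryHom (c.braiding H K).hom
  slice_hom : ∀ H K : C, sliceJ Φ (c.braiding H K).hom = bra ⟨⟨H⟩⟩ ≫ ket ⟨⟨K⟩⟩

variable {Φ : FibreFunctor.{w} C} {c : BraidedCategory C} {H H' H₁ H₁' H₂ H₂' H₃ K L : C}

theorem FibreFunctor.IsRegularBraiding.isRegularSp (h : Φ.IsRegularBraiding c) :
    IsRegularSp Φ c where
  unitary := h.1
  slice_hom H K := set_injective (by rw [set_sliceJ, set_bra_ket]; exact h.2 H K)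

theorem IsRegularSp.slice_inv (h : IsRegularSp Φ c) (H K : C) :
    sliceJ Φ (c.braiding H K).inv = bra ⟨⟨K⟩⟩ ≫ ket ⟨⟨H⟩⟩ := by
  have h1 := congrArg dag (h.slice_hom H K)
  rw [dag_comp, dag_ket, dag_bra, sliceJ, dag_slice] at h1
  rw [← h1, sliceJ]
  exact congrArg slice (dag_J_iso (h.unitary H K)).symm

theorem IsRegularSp.inverse (h : IsRegularSp Φ c) : IsRegularSp Φ (inverseBraiding c) where
  unitary H K := (h.unitary K H).inv
  slice_hom H K := h.slice_inv K H

namespace OpSp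

variable (c) in
/-- The operator space of the operators `a ⊠ 1`. -/
noncomputable def boxL (H₂ : C) (P : (⟨⟨H₁⟩⟩ : OpSp Φ) ⟶ ⟨⟨H₁⟩⟩) :
    (⟨⟨H₁ ⊗ H₂⟩⟩ : OpSp Φ) ⟶ ⟨⟨H₁ ⊗ H₂⟩⟩ := adSp (c.braiding H₂ H₁) P

/-- The operator space of the operators `1 ⊠ a`. -/
noncomputable def boxR (H₁ : C) (P : (⟨⟨H₂⟩⟩ : OpSp Φ) ⟶ ⟨⟨H₂⟩⟩) :
    (⟨⟨H₁ ⊗ H₂⟩⟩ : OpSp Φ) ⟶ ⟨⟨H₁ ⊗ H₂⟩⟩ := (⟨⟨H₁⟩⟩ : OpSp Φ) ◁ P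

theorem boxL_comp (H₂ : C) (P Q : (⟨⟨H₁⟩⟩ : OpSp Φ) ⟶ ⟨⟨H₁⟩⟩) :
    boxL c H₂ (P ≫ Q) = boxL c H₂ P ≫ boxL c H₂ Q := adSp_comp _ _ _

theorem boxR_comp (H₁ : C) (P Q : (⟨⟨H₂⟩⟩ : OpSp Φ) ⟶ ⟨⟨H₂⟩⟩) :
    boxR H₁ (P ≫ Q) = boxR H₁ P ≫ boxR H₁ Q := whiskerLeft_comp _ _ _

theorem dag_boxL (hc : IsRegularSp Φ c) (H₂ : C) (P : (⟨⟨H₁⟩⟩ : OpSp Φ) ⟶ ⟨⟨H₁⟩⟩) :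
    dag (boxL c H₂ P) = boxL c H₂ (dag P) := dag_adSp (hc.unitary _ _) _

theorem dag_boxR (H₁ : C) (P : (⟨⟨H₂⟩⟩ : OpSp Φ) ⟶ ⟨⟨H₂⟩⟩) :
    dag (boxR H₁ P) = boxR H₁ (dag P) := dag_whiskerLeft _ _

theorem boxL_gen (H₂ : C) (S : Set (Φ.Op H₁)) :
    boxL c H₂ (gen (X := ⟨⟨H₁⟩⟩) (Y := ⟨⟨H₁⟩⟩) S) = gen (boxLeft c H₂ '' S) := adSp_gen _ _

theorem boxR_gen (H₁ : C) (S : Set (Φ.Op H₂)) :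
    boxR H₁ (gen (X := ⟨⟨H₂⟩⟩) (Y := ⟨⟨H₂⟩⟩) S) = gen (boxRight H₁ '' S) := whiskerLeft_gen _ _

theorem ket_boxR {P : (⟨⟨H₂⟩⟩ : OpSp Φ) ⟶ ⟨⟨H₂⟩⟩} (h : ket ⟨⟨H₂⟩⟩ ≫ P = ket ⟨⟨H₂⟩⟩) :
    ket ⟨⟨H₁ ⊗ H₂⟩⟩ ≫ boxR H₁ P = ket ⟨⟨H₁ ⊗ H₂⟩⟩ := by
  have h1 : ket ((⟨⟨H₁⟩⟩ : OpSp Φ) ⊗ ⟨⟨H₂⟩⟩) ≫ ⟨⟨H₁⟩⟩ ◁ P = ket (⟨⟨H₁⟩⟩ ⊗ ⟨⟨H₂⟩⟩) := by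
    rw [← ket_tensor, Category.assoc, MonoidalCategory.tensorHom_def, Category.assoc,
      ← whiskerLeft_comp, h]
  exact h1

theorem ket_boxL {P : (⟨⟨H₁⟩⟩ : OpSp Φ) ⟶ ⟨⟨H₁⟩⟩} (h : ket ⟨⟨H₁⟩⟩ ≫ P = ket ⟨⟨H₁⟩⟩) :
    ket ⟨⟨H₁ ⊗ H₂⟩⟩ ≫ boxL c H₂ P = ket ⟨⟨H₁ ⊗ H₂⟩⟩ := by
  have h1 : ket (Φ := Φ) ⟨⟨H₁ ⊗ H₂⟩⟩ ≫ J Φ (c.braiding H₂ H₁).inv = ket ⟨⟨H₂ ⊗ H₁⟩⟩ :=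
    ket_iso (c.braiding H₂ H₁).symm
  change ket (Φ := Φ) ⟨⟨H₁ ⊗ H₂⟩⟩ ≫ J Φ (c.braiding H₂ H₁).inv ≫ boxR H₂ P ≫
    J Φ (c.braiding H₂ H₁).hom = _
  rw [reassoc_of% h1, ← Category.assoc, ket_boxR h, ket_iso]

/-- The two legs of a tensor product of algebras commute up to closed linear spans, and their
products span a space of slices. -/
theorem box_comm (hc : IsRegularSp Φ c) (A₁ : HatAlg Φ H₁) (A₂ : HatAlg Φ H₂) :
    boxR H₁ A₂.sp ≫ boxL c H₂ A₁.sp = boxL c H₂ A₁.sp ≫ boxR H₁ A₂.sp ∧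
      ∃ (K : C) (X : (H₁ ⊗ H₂) ⊗ K ⟶ (H₁ ⊗ H₂) ⊗ K),
        boxR H₁ A₂.sp ≫ boxL c H₂ A₁.sp = sliceJ Φ X := by
  obtain ⟨K₁, X, hX⟩ := A₁.exists_sp_eq
  obtain ⟨K₂, Y, hY⟩ := A₂.exists_sp_eq
  rw [hX, hY]
  let X' : (⟨⟨H₁⟩⟩ : OpSp Φ) ⊗ ⟨⟨K₁⟩⟩ ⟶ ⟨⟨H₁⟩⟩ ⊗ ⟨⟨K₁⟩⟩ := J Φ X
  let Y' : (⟨⟨H₂⟩⟩ : OpSp Φ) ⊗ ⟨⟨K₂⟩⟩ ⟶ ⟨⟨H₂⟩⟩ ⊗ ⟨⟨K₂⟩⟩ := J Φ Y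
  let a : (⟨⟨H₂⟩⟩ : OpSp Φ) ⊗ ⟨⟨H₁⟩⟩ ≅ ⟨⟨H₁⟩⟩ ⊗ ⟨⟨H₂⟩⟩ := JIso Φ (c.braiding H₂ H₁)
  let b : (⟨⟨H₂⟩⟩ : OpSp Φ) ⊗ ⟨⟨K₁⟩⟩ ≅ ⟨⟨K₁⟩⟩ ⊗ ⟨⟨H₂⟩⟩ := JIso Φ (c.braiding H₂ K₁)
  let g : (⟨⟨K₂⟩⟩ : OpSp Φ) ⊗ ⟨⟨K₁⟩⟩ ≅ ⟨⟨K₁⟩⟩ ⊗ ⟨⟨K₂⟩⟩ := JIso Φ (c.braiding K₂ K₁)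
  have hXa : (⟨⟨H₂⟩⟩ : OpSp Φ) ◁ X' ≫ (α_ _ _ _).inv ≫ a.hom ▷ ⟨⟨K₁⟩⟩ ≫ (α_ _ _ _).hom ≫
      ⟨⟨H₁⟩⟩ ◁ b.hom ≫ (α_ _ _ _).inv = ((α_ _ _ _).inv ≫ a.hom ▷ ⟨⟨K₁⟩⟩ ≫ (α_ _ _ _).hom ≫
      ⟨⟨H₁⟩⟩ ◁ b.hom ≫ (α_ _ _ _).inv) ≫ X' ▷ ⟨⟨H₂⟩⟩ := by
    have h := congrArg (J Φ) (BraidedCategory.braiding_naturality_right H₂ X)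
    rw [BraidedCategory.braiding_tensor_right_hom] at h
    simp only [J_comp, J_whiskerLeft, J_whiskerRight] at h
    exact h
  have hYb : Y' ▷ (⟨⟨K₁⟩⟩ : OpSp Φ) ≫ (α_ _ _ _).hom ≫ ⟨⟨H₂⟩⟩ ◁ g.hom ≫ (α_ _ _ _).inv ≫
      b.hom ▷ ⟨⟨K₂⟩⟩ ≫ (α_ _ _ _).hom = ((α_ _ _ _).hom ≫ ⟨⟨H₂⟩⟩ ◁ g.hom ≫ (α_ _ _ _).inv ≫
      b.hom ▷ ⟨⟨K₂⟩⟩ ≫ (α_ _ _ _).hom) ≫ ⟨⟨K₁⟩⟩ ◁ Y' := by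
    have h := congrArg (J Φ) (BraidedCategory.braiding_naturality_left Y K₁)
    rw [BraidedCategory.braiding_tensor_left_hom] at h
    simp only [J_comp, J_whiskerLeft, J_whiskerRight] at h
    exact h
  have h1 := crossLink_comm hXa hYb
  have h2 : slice (crossLink X' Y' a g) = (⟨⟨H₁⟩⟩ : OpSp Φ) ◁ slice Y' ≫ a.inv ≫
      ⟨⟨H₂⟩⟩ ◁ slice X' ≫ a.hom := slice_crossLink (hc.slice_hom K₂ K₁)
  have h3 : slice (crossLink' X' Y' a g) = (a.inv ≫ (⟨⟨H₂⟩⟩ : OpSp Φ) ◁ slice X' ≫ a.hom) ≫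
      ⟨⟨H₁⟩⟩ ◁ slice Y' := slice_crossLink' (hc.slice_inv K₂ K₁)
  have h4 := slice_comp_whiskerLeft (crossLink X' Y' a g) g.inv
    (iso_bra (c.braiding K₂ K₁).symm)
  have h5 := slice_whiskerLeft_comp g.hom (crossLink' X' Y' a g) (ket_iso (c.braiding K₂ K₁))
  refine ⟨?_, K₂ ⊗ K₁, crossLink X Y (c.braiding H₂ H₁) (c.braiding K₂ K₁) ≫
    (H₁ ⊗ H₂) ◁ (c.braiding K₂ K₁).inv, ?_⟩
  · rw [← h4, ← h1, h5, h3] at h2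
    exact h2.symm
  · refine (h2.symm.trans h4.symm).trans ?_
    rw [sliceJ]
    refine congrArg slice ?_
    simp only [crossLink, crossLeft, crossRight, J_comp, J_whiskerLeft, J_whiskerRight]
    rfl

end OpSp

/-- The tensor product `A₁ ⊠ A₂`. -/
noncomputable def HatAlg.box (hc : IsRegularSp Φ c) (A₁ : HatAlg Φ H₁) (A₂ : HatAlg Φ H₂)
    (h₁ : A₁.sp ≫ A₁.sp = A₁.sp) (h₂ : A₂.sp ≫ A₂.sp = A₂.sp) : HatAlg Φ (H₁ ⊗ H₂) :=
  HatAlg.ofSp (boxR H₁ A₂.sp ≫ boxL c H₂ A₁.sp)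
    (by rw [dag_comp, dag_boxL hc, dag_boxR, A₁.dag_sp, A₂.dag_sp, (box_comm hc A₁ A₂).1])
    (by
      conv_lhs => rw [Category.assoc, ← Category.assoc (boxL c H₂ _), ← (box_comm hc A₁ A₂).1,
        Category.assoc, ← boxL_comp, h₁, ← Category.assoc, ← boxR_comp, h₂])
    (box_comm hc A₁ A₂).2
    (by rw [← Category.assoc, ket_boxR A₂.ket_sp, ket_boxL A₁.ket_sp])

variable {A₁ : HatAlg Φ H₁} {A₂ : HatAlg Φ H₂} {A₁' : HatAlg Φ H₁'} {A₂' : HatAlg Φ H₂'}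

/-- `A` is the tensor product of `A₁` and `A₂` as an operator space. -/
structure IsBoxSp (c : BraidedCategory C) (A₁ : HatAlg Φ H₁) (A₂ : HatAlg Φ H₂)
    (A : HatAlg Φ (H₁ ⊗ H₂)) : Prop where
  idem₁ : A₁.sp ≫ A₁.sp = A₁.sp
  idem₂ : A₂.sp ≫ A₂.sp = A₂.sp
  sp_eq : A.sp = boxR H₁ A₂.sp ≫ boxL c H₂ A₁.sp
  sp_eq' : A.sp = boxL c H₂ A₁.sp ≫ boxR H₁ A₂.sp

theorem isBoxSp_box (hc : IsRegularSp Φ c) (h₁ : A₁.sp ≫ A₁.sp = A₁.sp)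
    (h₂ : A₂.sp ≫ A₂.sp = A₂.sp) : IsBoxSp c A₁ A₂ (A₁.box hc A₂ h₁ h₂) where
  idem₁ := h₁
  idem₂ := h₂
  sp_eq := HatAlg.sp_ofSp _ _ _ _ _
  sp_eq' := (HatAlg.sp_ofSp _ _ _ _ _).trans (box_comm hc A₁ A₂).1

namespace IsBoxSp

variable {A₁₂ : HatAlg Φ (H₁ ⊗ H₂)}

theorem comp_boxL (h : IsBoxSp c A₁ A₂ A₁₂) : A₁₂.sp ≫ boxL c H₂ A₁.sp = A₁₂.sp := by
  rw [h.sp_eq, Category.assoc, ← boxL_comp, h.idem₁]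

theorem comp_boxR (h : IsBoxSp c A₁ A₂ A₁₂) : A₁₂.sp ≫ boxR H₁ A₂.sp = A₁₂.sp := by
  rw [h.sp_eq', Category.assoc, ← boxR_comp, h.idem₂]

theorem idem (h : IsBoxSp c A₁ A₂ A₁₂) : A₁₂.sp ≫ A₁₂.sp = A₁₂.sp := by
  conv_lhs => arg 2; rw [h.sp_eq]
  rw [← Category.assoc, h.comp_boxR, h.comp_boxL]

end IsBoxSp

end Box

/-! ### Tensor products of morphisms -/

section BoxHom

variable {C : Type u} [Category.{v} C] [MonoidalCategory C] [MonoidalWStarCategory C]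
  {Φ : FibreFunctor.{w} C} {c : BraidedCategory C} {H H' H₁ H₁' H₂ H₂' H₃ K L : C}
  {A₁ : HatAlg Φ H₁} {A₂ : HatAlg Φ H₂} {A₁' : HatAlg Φ H₁'} {A₂' : HatAlg Φ H₂'}
  {A₁₂ : HatAlg Φ (H₁ ⊗ H₂)}

theorem adOp_refl (a : Φ.Op H₂) : Φ.adOp (Iso.refl (H₁ ⊗ H₂)) a = boxRight H₁ a := by
  rw [FibreFunctor.adOp, FibreFunctor.conj, Iso.refl_hom, Iso.refl_inv, Φ.map_id]
  rfl

theorem adSp_refl (P : (⟨⟨H₂⟩⟩ : OpSp Φ) ⟶ ⟨⟨H₂⟩⟩) : adSp (Iso.refl (H₁ ⊗ H₂)) P = boxR H₁ P := by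
  rw [set_adSp_eq]
  conv_rhs => rw [← gen_set P, boxR_gen]
  exact congrArg gen (Set.image_congr fun a _ => adOp_refl a)

theorem IsBoxSp.isBox (hc : IsRegularSp Φ c) (h : IsBoxSp c A₁ A₂ A₁₂) : IsBox c A₁ A₂ A₁₂ := by
  refine ⟨?_, ⟨HatHom.ofIso (c.braiding H₂ H₁) (hc.unitary _ _) h.comp_boxL, fun a => rfl⟩,
    ⟨HatHom.ofIso (Iso.refl (H₁ ⊗ H₂)) (isUnitaryHom_id _)
      (by rw [adSp_refl, h.comp_boxR]), fun a => adOp_refl _⟩⟩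
  rw [← A₁₂.set_sp, h.sp_eq, HatAlg.sp, HatAlg.sp, boxR_gen, boxL_gen, gen_comp]
  refine congrArg (fun S : Set (Φ.Op (H₁ ⊗ H₂)) =>
    ((closedSpan S : Submodule ℂ (Φ.Op (H₁ ⊗ H₂))) : Set (Φ.Op (H₁ ⊗ H₂)))) ?_
  ext x
  constructor
  · rintro ⟨_, ⟨b, hb, rfl⟩, _, ⟨a, ha, rfl⟩, rfl⟩
    exact ⟨a, ha, b, hb, rfl⟩
  · rintro ⟨a, ha, b, hb, rfl⟩
    exact ⟨_, ⟨b, hb, rfl⟩, _, ⟨a, ha, rfl⟩, rfl⟩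

/-- `f ⊠ id` on the first leg: `V` is natural for the crossing with `H₂`. -/
theorem adOp_boxFst_left (V : K ⊗ H₁ ≅ H₁') (a : Φ.Op H₁) :
    Φ.adOp (boxFst V H₂) (boxLeft c H₂ a) = boxLeft c H₂ (Φ.adOp V a) := by
  have h : H₂ ◁ V.hom ≫ (c.braiding H₂ H₁').hom = (α_ _ _ _).inv ≫ (c.braiding H₂ K).hom ▷ H₁ ≫
      (α_ _ _ _).hom ≫ K ◁ (c.braiding H₂ H₁).hom ≫ (α_ _ _ _).inv ≫ V.hom ▷ H₂ := by
    rw [BraidedCategory.braiding_naturality_right, BraidedCategory.braiding_tensor_right_hom]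
    simp only [Category.assoc]
  have h' := congrArg (OpCat.ι Φ) h
  simp only [OpCat.ι_comp, OpCat.ι_whiskerLeft, OpCat.ι_whiskerRight] at h'
  have h1 := ad_boxFst_left (D := OpCat Φ) (K := ⟨K⟩) (H₁ := ⟨H₁⟩) (H₁' := ⟨H₁'⟩) (H₂ := ⟨H₂⟩)
    (V := OpCat.ιIso Φ V) (s := OpCat.ιIso Φ (c.braiding H₂ K))
    (c := OpCat.ιIso Φ (c.braiding H₂ H₁)) (c' := OpCat.ιIso Φ (c.braiding H₂ H₁')) h' a
  have e : (OpCat.ιIso Φ (boxFst V H₂)) =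
      boxFst (D := OpCat Φ) (K := ⟨K⟩) (H₁ := ⟨H₁⟩) (OpCat.ιIso Φ V) ⟨H₂⟩ := by
    ext
    simp only [OpCat.ιIso_hom, boxFst_hom, OpCat.ι_comp, OpCat.ι_whiskerRight]
    rfl
  rw [← e] at h1
  exact h1

/-- `f ⊠ id` on the second leg. -/
theorem adOp_boxFst_right (V : K ⊗ H₁ ≅ H₁') (a : Φ.Op H₂) :
    Φ.adOp (boxFst V H₂) (boxRight H₁ a) = boxRight H₁' a := by
  have h1 := ad_boxFst_right (D := OpCat Φ) (K := ⟨K⟩) (H₁ := ⟨H₁⟩) (H₁' := ⟨H₁'⟩) (H₂ := ⟨H₂⟩)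
    (OpCat.ιIso Φ V) a
  have e : (OpCat.ιIso Φ (boxFst V H₂)) =
      boxFst (D := OpCat Φ) (K := ⟨K⟩) (H₁ := ⟨H₁⟩) (OpCat.ιIso Φ V) ⟨H₂⟩ := by
    ext
    simp only [OpCat.ιIso_hom, boxFst_hom, OpCat.ι_comp, OpCat.ι_whiskerRight]
    rfl
  rw [← e] at h1
  exact h1

theorem ιIso_boxSnd (s : K ⊗ H₁ ≅ H₁ ⊗ K) (U : K ⊗ H₂ ≅ H₂') : OpCat.ιIso Φ (boxSnd s U) =
    boxSnd (D := OpCat Φ) (K := ⟨K⟩) (H₁ := ⟨H₁⟩) (H₂ := ⟨H₂⟩) (OpCat.ιIso Φ s)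
      (OpCat.ιIso Φ U) := by
  ext
  simp only [OpCat.ιIso_hom, boxSnd_hom, OpCat.ι_comp, OpCat.ι_whiskerRight, OpCat.ι_whiskerLeft]
  rfl

/-- `id ⊠ g` on the first leg: the crossing of `K` and `H₁` removes `K` from this leg. -/
theorem adOp_boxSnd_left (U : K ⊗ H₂ ≅ H₂') (a : Φ.Op H₁) :
    Φ.adOp (boxSnd (c.braiding K H₁) U) (boxLeft c H₂ a) = boxLeft c H₂' a := by
  have h : U.hom ▷ H₁ ≫ (c.braiding H₂' H₁).hom = (α_ _ _ _).hom ≫ K ◁ (c.braiding H₂ H₁).hom ≫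
      (α_ _ _ _).inv ≫ (c.braiding K H₁).hom ▷ H₂ ≫ (α_ _ _ _).hom ≫ H₁ ◁ U.hom := by
    rw [BraidedCategory.braiding_naturality_left, BraidedCategory.braiding_tensor_left_hom]
    simp only [Category.assoc]
  have h' := congrArg (OpCat.ι Φ) h
  simp only [OpCat.ι_comp, OpCat.ι_whiskerLeft, OpCat.ι_whiskerRight] at h'
  have h1 := ad_boxSnd_left (D := OpCat Φ) (K := ⟨K⟩) (H₁ := ⟨H₁⟩) (H₂ := ⟨H₂⟩) (H₂' := ⟨H₂'⟩)
    (U := OpCat.ιIso Φ U) (s := OpCat.ιIso Φ (c.braiding K H₁))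
    (c := OpCat.ιIso Φ (c.braiding H₂ H₁)) (c' := OpCat.ιIso Φ (c.braiding H₂' H₁)) h' a
  rw [← ιIso_boxSnd] at h1
  exact h1

/-- `id ⊠ g` on the second leg. -/
theorem adOp_boxSnd_right (U : K ⊗ H₂ ≅ H₂') (s : K ⊗ H₁ ≅ H₁ ⊗ K) (a : Φ.Op H₂) :
    Φ.adOp (boxSnd s U) (boxRight H₁ a) = boxRight H₁ (Φ.adOp U a) := by
  have h1 := ad_boxSnd_right (D := OpCat Φ) (K := ⟨K⟩) (H₁ := ⟨H₁⟩) (H₂ := ⟨H₂⟩) (H₂' := ⟨H₂'⟩)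
    (OpCat.ιIso Φ U) (OpCat.ιIso Φ s) a
  rw [← ιIso_boxSnd] at h1
  exact h1

theorem adSp_boxFst_left (V : K ⊗ H₁ ≅ H₁') (P : (⟨⟨H₁⟩⟩ : OpSp Φ) ⟶ ⟨⟨H₁⟩⟩) :
    adSp (boxFst V H₂) (boxL c H₂ P) = boxL c H₂ (adSp V P) := by
  obtain ⟨S, rfl⟩ := exists_gen P
  rw [boxL_gen, adSp_gen, adSp_gen, boxL_gen, Set.image_image, Set.image_image]
  exact congrArg gen (Set.image_congr fun a _ => adOp_boxFst_left V a)

theorem adSp_boxFst_right (V : K ⊗ H₁ ≅ H₁') (P : (⟨⟨H₂⟩⟩ : OpSp Φ) ⟶ ⟨⟨H₂⟩⟩) :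
    adSp (boxFst V H₂) (boxR H₁ P) = boxR H₁' P := by
  obtain ⟨S, rfl⟩ := exists_gen P
  rw [boxR_gen, adSp_gen, boxR_gen, Set.image_image]
  exact congrArg gen (Set.image_congr fun a _ => adOp_boxFst_right V a)

theorem adSp_boxSnd_left (U : K ⊗ H₂ ≅ H₂') (P : (⟨⟨H₁⟩⟩ : OpSp Φ) ⟶ ⟨⟨H₁⟩⟩) :
    adSp (boxSnd (c.braiding K H₁) U) (boxL c H₂ P) = boxL c H₂' P := by
  obtain ⟨S, rfl⟩ := exists_gen P
  rw [boxL_gen, adSp_gen, boxL_gen, Set.image_image]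
  exact congrArg gen (Set.image_congr fun a _ => adOp_boxSnd_left U a)

theorem adSp_boxSnd_right (U : K ⊗ H₂ ≅ H₂') (s : K ⊗ H₁ ≅ H₁ ⊗ K)
    (P : (⟨⟨H₂⟩⟩ : OpSp Φ) ⟶ ⟨⟨H₂⟩⟩) :
    adSp (boxSnd s U) (boxR H₁ P) = boxR H₁ (adSp U P) := by
  obtain ⟨S, rfl⟩ := exists_gen P
  rw [boxR_gen, adSp_gen, adSp_gen, boxR_gen, Set.image_image, Set.image_image]
  exact congrArg gen (Set.image_congr fun a _ => adOp_boxSnd_right U s a)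

/-- The morphism `f ⊠ id` is nondegenerate. -/
theorem IsBoxSp.comp_adSp_boxFst {B : HatAlg Φ (H₁' ⊗ H₂)} (h : IsBoxSp c A₁ A₂ A₁₂)
    (h' : IsBoxSp c A₁' A₂ B) {V : K ⊗ H₁ ≅ H₁'} (hV : A₁'.sp ≫ adSp V A₁.sp = A₁'.sp) :
    B.sp ≫ adSp (boxFst V H₂) A₁₂.sp = B.sp := by
  rw [h.sp_eq, adSp_comp, adSp_boxFst_left, adSp_boxFst_right, ← Category.assoc, h'.comp_boxR]
  conv_lhs => rw [h'.sp_eq, Category.assoc, ← boxL_comp, hV]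
  exact h'.sp_eq.symm

/-- The morphism `id ⊠ g` is nondegenerate. -/
theorem IsBoxSp.comp_adSp_boxSnd {B : HatAlg Φ (H₁ ⊗ H₂')} (h : IsBoxSp c A₁ A₂ A₁₂)
    (h' : IsBoxSp c A₁ A₂' B) {U : K ⊗ H₂ ≅ H₂'} (hU : A₂'.sp ≫ adSp U A₂.sp = A₂'.sp) :
    B.sp ≫ adSp (boxSnd (c.braiding K H₁) U) A₁₂.sp = B.sp := by
  rw [h.sp_eq', adSp_comp, adSp_boxSnd_left, adSp_boxSnd_right, ← Category.assoc, h'.comp_boxL]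
  conv_lhs => rw [h'.sp_eq', Category.assoc, ← boxR_comp, hU]
  exact h'.sp_eq'.symm

/-- `f ⊠ id` is given on products by the defining formula. -/
theorem isBoxHom_boxFst {B : HatAlg Φ (H₁' ⊗ H₂)} {V : K ⊗ H₁ ≅ H₁'}
    {hV : IsUnitaryHom V.hom} {h : A₁'.sp ≫ adSp V A₁.sp = A₁'.sp} {i : HatHom A₂ A₂}
    (hi : IsHatId i) {hV' : IsUnitaryHom (boxFst V H₂).hom}
    {h' : B.sp ≫ adSp (boxFst V H₂) A₁₂.sp = B.sp} :
    IsBoxHom c (HatHom.ofIso V hV h) i (HatHom.ofIso (boxFst V H₂) hV' h') := by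
  intro a₁ a₂ x hx
  rw [HatHom.ofIso_app, HatHom.ofIso_app, hx, hi a₂]
  refine (map_mul (Φ.adHom (boxFst V H₂) hV') _ _).trans ?_
  exact congrArg₂ (· * ·) (adOp_boxFst_left V _) (adOp_boxFst_right V _)

/-- `id ⊠ g` is given on products by the defining formula. -/
theorem isBoxHom_boxSnd {B : HatAlg Φ (H₁ ⊗ H₂')} {U : K ⊗ H₂ ≅ H₂'}
    {hU : IsUnitaryHom U.hom} {h : A₂'.sp ≫ adSp U A₂.sp = A₂'.sp} {i : HatHom A₁ A₁}
    (hi : IsHatId i) {hU' : IsUnitaryHom (boxSnd (c.braiding K H₁) U).hom}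
    {h' : B.sp ≫ adSp (boxSnd (c.braiding K H₁) U) A₁₂.sp = B.sp} :
    IsBoxHom c i (HatHom.ofIso U hU h) (HatHom.ofIso (boxSnd (c.braiding K H₁) U) hU' h') := by
  intro a₁ a₂ x hx
  rw [HatHom.ofIso_app, HatHom.ofIso_app, hx, hi a₁]
  refine (map_mul (Φ.adHom _ hU') _ _).trans ?_
  exact congrArg₂ (· * ·) (adOp_boxSnd_left U _) (adOp_boxSnd_right U _ _)

/-! ### The associator -/

theorem adOp_leftUnitor (e : H ≅ H') (a : Φ.Op H) : Φ.adOp (λ_ H ≪≫ e) a = Φ.conj e a := by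
  have h := ad_leftUnitor (D := OpCat Φ) (H := ⟨H⟩) (H' := ⟨H'⟩) (OpCat.ιIso Φ e) a
  have e1 : OpCat.ιIso Φ (λ_ H ≪≫ e) = λ_ (⟨H⟩ : OpCat Φ) ≪≫ OpCat.ιIso Φ e := by
    ext
    simp only [OpCat.ιIso_hom, Iso.trans_hom, OpCat.ι_comp]
    rfl
  rw [← e1] at h
  exact h

theorem adSp_leftUnitor (e : H ≅ H') (P : (⟨⟨H⟩⟩ : OpSp Φ) ⟶ ⟨⟨H⟩⟩) :
    adSp (λ_ H ≪≫ e) P = J Φ e.inv ≫ P ≫ J Φ e.hom := by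
  have h := ad_leftUnitor (D := OpSp Φ) (H := ⟨⟨H⟩⟩) (H' := ⟨⟨H'⟩⟩) (JIso Φ e) P
  have e1 : JIso Φ (λ_ H ≪≫ e) = λ_ (⟨⟨H⟩⟩ : OpSp Φ) ≪≫ JIso Φ e := by
    ext
    simp only [JIso_hom, Iso.trans_hom, J_comp]
    rfl
  rw [← e1] at h
  exact h

/-- The tensor product is associative. -/
theorem IsBoxSp.associator {A₃ : HatAlg Φ H₃} {A₂₃ : HatAlg Φ (H₂ ⊗ H₃)}
    {B : HatAlg Φ ((H₁ ⊗ H₂) ⊗ H₃)} {B' : HatAlg Φ (H₁ ⊗ (H₂ ⊗ H₃))}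
    (h₁₂ : IsBoxSp c A₁ A₂ A₁₂) (h₂₃ : IsBoxSp c A₂ A₃ A₂₃) (h : IsBoxSp c A₁₂ A₃ B)
    (h' : IsBoxSp c A₁ A₂₃ B') : adSp (λ_ _ ≪≫ α_ H₁ H₂ H₃) B.sp = B'.sp := by
  have e1 : J Φ (α_ H₁ H₂ H₃).inv ≫ boxL c H₃ (boxL c H₂ A₁.sp) ≫ J Φ (α_ H₁ H₂ H₃).hom =
      boxL c (H₂ ⊗ H₃) A₁.sp := by
    have hh : H₃ ◁ (c.braiding H₂ H₁).hom ≫ (c.braiding H₃ (H₁ ⊗ H₂)).hom ≫ (α_ _ _ _).hom =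
        (α_ _ _ _).inv ≫ (c.braiding H₃ H₂).hom ▷ H₁ ≫ (c.braiding (H₂ ⊗ H₃) H₁).hom := by
      rw [BraidedCategory.braiding_naturality_right_assoc,
        BraidedCategory.braiding_tensor_right_hom, BraidedCategory.braiding_tensor_left_hom]
      simp only [Category.assoc]
    have hh' := congrArg (J Φ) hh
    simp only [J_comp, J_whiskerLeft, J_whiskerRight] at hh'
    exact associator_conj_left (D := OpSp Φ) (H₁ := ⟨⟨H₁⟩⟩) (H₂ := ⟨⟨H₂⟩⟩) (H₃ := ⟨⟨H₃⟩⟩)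
      (c₂₁ := JIso Φ (c.braiding H₂ H₁)) (c₃₂ := JIso Φ (c.braiding H₃ H₂))
      (e := JIso Φ (c.braiding H₃ (H₁ ⊗ H₂))) (e' := JIso Φ (c.braiding (H₂ ⊗ H₃) H₁)) hh' A₁.sp
  have e2 : J Φ (α_ H₁ H₂ H₃).inv ≫ boxL c H₃ (boxR H₁ A₂.sp) ≫ J Φ (α_ H₁ H₂ H₃).hom =
      boxR H₁ (boxL c H₃ A₂.sp) := by
    have hh : (c.braiding H₃ (H₁ ⊗ H₂)).hom ≫ (α_ _ _ _).hom = (α_ _ _ _).inv ≫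
        (c.braiding H₃ H₁).hom ▷ H₂ ≫ (α_ _ _ _).hom ≫ H₁ ◁ (c.braiding H₃ H₂).hom := by
      rw [BraidedCategory.braiding_tensor_right_hom]
      simp only [Category.assoc, Iso.inv_hom_id, Category.comp_id]
    have hh' := congrArg (J Φ) hh
    simp only [J_comp, J_whiskerLeft, J_whiskerRight] at hh'
    exact associator_conj_middle (D := OpSp Φ) (H₁ := ⟨⟨H₁⟩⟩) (H₂ := ⟨⟨H₂⟩⟩) (H₃ := ⟨⟨H₃⟩⟩)
      (c₃₁ := JIso Φ (c.braiding H₃ H₁)) (c₃₂ := JIso Φ (c.braiding H₃ H₂))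
      (e := JIso Φ (c.braiding H₃ (H₁ ⊗ H₂))) hh' A₂.sp
  have e3 : J Φ (α_ H₁ H₂ H₃).inv ≫ boxR (H₁ ⊗ H₂) A₃.sp ≫ J Φ (α_ H₁ H₂ H₃).hom =
      boxR H₁ (boxR H₂ A₃.sp) :=
    associator_conj_right (D := OpSp Φ) (H₁ := ⟨⟨H₁⟩⟩) (H₂ := ⟨⟨H₂⟩⟩) (H₃ := ⟨⟨H₃⟩⟩) A₃.sp
  have hα : J Φ (α_ H₁ H₂ H₃).hom ≫ J Φ (α_ H₁ H₂ H₃).inv = 𝟙 _ := (JIso Φ (α_ _ _ _)).hom_inv_id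
  rw [adSp_leftUnitor, h.sp_eq, h₁₂.sp_eq, h'.sp_eq, h₂₃.sp_eq, boxL_comp, boxR_comp, ← e1, ← e2,
    ← e3]
  simp only [Category.assoc]
  rw [reassoc_of% hα, reassoc_of% hα]

end BoxHom

/-! ### Bialgebras with a comultiplication implemented by a unitary -/

section Bialgebra

variable {C : Type u} [Category.{v} C] [MonoidalCategory C] [MonoidalWStarCategory C]
  {Φ : FibreFunctor.{w} C} {c : BraidedCategory C} {H H' H'' K K' L : C}

theorem adOp_adTrans (U : K ⊗ H ≅ H') (V : K' ⊗ H' ≅ H'') (a : Φ.Op H) :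
    Φ.adOp (adTrans U V) a = Φ.adOp V (Φ.adOp U a) := by
  have h := ad_adTrans (D := OpCat Φ) (K := ⟨K⟩) (K' := ⟨K'⟩) (H := ⟨H⟩) (H' := ⟨H'⟩)
    (H'' := ⟨H''⟩) (OpCat.ιIso Φ U) (OpCat.ιIso Φ V) a
  have e : OpCat.ιIso Φ (adTrans U V) = adTrans (D := OpCat Φ) (K := ⟨K⟩) (K' := ⟨K'⟩) (H := ⟨H⟩)
      (H' := ⟨H'⟩) (H'' := ⟨H''⟩) (OpCat.ιIso Φ U) (OpCat.ιIso Φ V) := by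
    ext
    simp only [OpCat.ιIso_hom, adTrans_hom, OpCat.ι_comp, OpCat.ι_whiskerLeft]
    rfl
  rw [← e] at h
  exact h

theorem adSp_adTrans (U : K ⊗ H ≅ H') (V : K' ⊗ H' ≅ H'') (P : (⟨⟨H⟩⟩ : OpSp Φ) ⟶ ⟨⟨H⟩⟩) :
    adSp (adTrans U V) P = adSp V (adSp U P) := by
  obtain ⟨S, rfl⟩ := exists_gen P
  rw [adSp_gen, adSp_gen, adSp_gen, Set.image_image]
  exact congrArg gen (Set.image_congr fun a _ => adOp_adTrans U V a)

/-- Composites of nondegenerate maps are nondegenerate. -/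
theorem HatAlg.comp_adSp_adTrans {A₁ : HatAlg Φ H} {A₂ : HatAlg Φ H'} {A₃ : HatAlg Φ H''}
    {U : K ⊗ H ≅ H'} {V : K' ⊗ H' ≅ H''} (hU : A₂.sp ≫ adSp U A₁.sp = A₂.sp)
    (hV : A₃.sp ≫ adSp V A₂.sp = A₃.sp) : A₃.sp ≫ adSp (adTrans U V) A₁.sp = A₃.sp := by
  conv_lhs => rw [adSp_adTrans, ← hV, Category.assoc, ← adSp_comp, hU, hV]

theorem adOp_leftUnitor_refl (a : Φ.Op H) : Φ.adOp (λ_ H ≪≫ Iso.refl H) a = a := by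
  rw [adOp_leftUnitor, FibreFunctor.conj, Iso.refl_hom, Iso.refl_inv, Φ.map_id]
  rfl

theorem adSp_leftUnitor_refl (P : (⟨⟨H⟩⟩ : OpSp Φ) ⟶ ⟨⟨H⟩⟩) :
    adSp (λ_ H ≪≫ Iso.refl H) P = P := by
  rw [set_adSp_eq]
  conv_rhs => rw [← gen_set P]
  refine congrArg gen ?_
  conv_rhs => rw [← Set.image_id (set P)]
  exact Set.image_congr fun a _ => adOp_leftUnitor_refl a

/-- A comultiplication `a ↦ V (id ⊗ a) V⋆` is coassociative if both ways to iterate it are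
implemented by unitaries that differ by one acting on the ampliation only. -/
theorem isCoassociative_ofIso (hc : IsRegularSp Φ c) {A : HatAlg Φ L} {AA : HatAlg Φ (L ⊗ L)}
    (hAA : IsBoxSp c A A AA) {V t : L ⊗ L ≅ L ⊗ L} (hV : IsUnitaryHom V.hom)
    (h : AA.sp ≫ adSp V A.sp = AA.sp)
    (hco : (α_ _ _ _).inv ≫ t.hom ▷ L ≫ (α_ _ _ _).hom ≫ L ◁ V.hom ≫ (α_ _ _ _).inv ≫
        (c.braiding L L).hom ▷ L ≫ (α_ _ _ _).hom ≫ L ◁ V.hom =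
      L ◁ V.hom ≫ (α_ _ _ _).inv ≫ V.hom ▷ L ≫ (α_ _ _ _).hom) :
    IsCoassociative c (HatHom.ofIso V hV h) := by
  have hB := isBoxSp_box (A₁ := AA) (A₂ := A) hc hAA.idem hAA.idem₁
  have hB' := isBoxSp_box (A₁ := A) (A₂ := AA) hc hAA.idem₁ hAA.idem
  have hs := hc.unitary L L
  have hΔi := hAA.comp_adSp_boxFst hB h
  have hiΔ := hAA.comp_adSp_boxSnd hB' h
  have hα : IsUnitaryHom (λ_ _ ≪≫ α_ L L L).hom :=
    (MonoidalWStarCategory.unitary_leftUnitor _).comp (isUnitaryHom_associator _ _ _)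
  have hid : IsUnitaryHom (λ_ L ≪≫ Iso.refl L).hom :=
    (MonoidalWStarCategory.unitary_leftUnitor _).comp (isUnitaryHom_id _)
  have hi : IsHatId (HatHom.ofIso (A₁ := A) (A₂ := A) (λ_ L ≪≫ Iso.refl L) hid
      (by rw [adSp_leftUnitor_refl, hAA.idem₁])) := fun a => adOp_leftUnitor_refl _
  refine ⟨AA.box hc A hAA.idem hAA.idem₁, A.box hc AA hAA.idem₁ hAA.idem, hB.isBox hc, hB'.isBox hc,
    _, HatHom.ofIso _ (hV.boxFst L) hΔi, HatHom.ofIso _ (hV.boxSnd hs) hiΔ,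
    HatHom.ofIso _ hα (by rw [hAA.associator hAA hB hB', hB'.idem]), hi, isBoxHom_boxFst hi,
    isBoxHom_boxSnd hi, fun x => adOp_leftUnitor _ _,
    HatHom.ofIso _ (hV.adTrans (hV.boxFst L)) (HatAlg.comp_adSp_adTrans h hΔi),
    HatHom.ofIso _ (hV.adTrans (hV.boxSnd hs)) (HatAlg.comp_adSp_adTrans h hiΔ),
    HatHom.isHatComp_ofIso _ _ fun a => adOp_adTrans _ _ _,
    HatHom.isHatComp_ofIso _ _ fun a => ?_,
    HatHom.isHatComp_ofIso _ _ fun a => adOp_adTrans _ _ _⟩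
  have h' := congrArg (OpCat.ι Φ) hco
  simp only [OpCat.ι_comp, OpCat.ι_whiskerLeft, OpCat.ι_whiskerRight] at h'
  have h1 := coassoc_of_comm (D := OpCat Φ) (L := ⟨L⟩) (V := OpCat.ιIso Φ V)
    (s := OpCat.ιIso Φ (c.braiding L L)) (t := OpCat.ιIso Φ t) h' (a : Φ.Op L)
  have e : (OpCat.ιIso Φ (boxFst V L)) =
      boxFst (D := OpCat Φ) (K := ⟨L⟩) (H₁ := ⟨L⟩) (OpCat.ιIso Φ V) ⟨L⟩ := by
    ext
    simp only [OpCat.ιIso_hom, boxFst_hom, OpCat.ι_comp, OpCat.ι_whiskerRight]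
    rfl
  rw [← ιIso_boxSnd, ← e] at h1
  rw [HatHom.ofIso_app, HatHom.ofIso_app, adOp_adTrans, adOp_adTrans, adOp_leftUnitor]
  exact h1.symm

/-- A criterion for a comultiplication `a ↦ V (id ⊗ a) V⋆` to define a bi-simplifiable
bialgebra. -/
theorem isBisimplifiableBialgebra_adOp (hc : IsRegularSp Φ c) {A : HatAlg Φ L}
    (hA : A.sp ≫ A.sp = A.sp) {V t : L ⊗ L ≅ L ⊗ L} (hV : IsUnitaryHom V.hom)
    (h₁ : boxR L A.sp ≫ adSp V A.sp = boxR L A.sp ≫ boxL c L A.sp)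
    (h₂ : adSp V A.sp ≫ boxL c L A.sp = boxR L A.sp ≫ boxL c L A.sp)
    (hco : (α_ _ _ _).inv ≫ t.hom ▷ L ≫ (α_ _ _ _).hom ≫ L ◁ V.hom ≫ (α_ _ _ _).inv ≫
        (c.braiding L L).hom ▷ L ≫ (α_ _ _ _).hom ≫ L ◁ V.hom =
      L ◁ V.hom ≫ (α_ _ _ _).inv ≫ V.hom ▷ L ≫ (α_ _ _ _).hom) :
    IsBisimplifiableBialgebra c A (Φ.adOp V) := by
  have hAA := isBoxSp_box (A₁ := A) (A₂ := A) hc hA hA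
  have h₃ : boxL c L A.sp ≫ adSp V A.sp = boxL c L A.sp ≫ boxR L A.sp := by
    have := congrArg dag h₂
    rwa [dag_comp, dag_comp, dag_boxL hc, dag_boxR, dag_adSp hV, A.dag_sp] at this
  have h : (A.box hc A hA hA).sp ≫ adSp V A.sp = (A.box hc A hA hA).sp := by
    conv_lhs => rw [hAA.sp_eq, Category.assoc, h₃, ← hAA.sp_eq', hAA.sp_eq, ← Category.assoc,
      ← boxR_comp, hA]
    exact hAA.sp_eq.symm
  refine ⟨A.box hc A hA hA, HatHom.ofIso V hV h, hAA.isBox hc, fun a => rfl,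
    isCoassociative_ofIso hc hAA hV h hco, ?_, ?_⟩
  · rw [← HatAlg.set_sp, hAA.sp_eq', ← h₃, set_adSp_eq, A.set_sp, HatAlg.sp, boxL_gen, gen_comp]
    refine congrArg (fun S : Set (Φ.Op (L ⊗ L)) =>
      ((closedSpan S : Submodule ℂ (Φ.Op (L ⊗ L))) : Set (Φ.Op (L ⊗ L)))) ?_
    ext x
    constructor
    · rintro ⟨_, ⟨b, hb, rfl⟩, _, ⟨a, ha, rfl⟩, rfl⟩
      exact ⟨a, ha, b, hb, rfl⟩
    · rintro ⟨a, ha, b, hb, rfl⟩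
      exact ⟨_, ⟨b, hb, rfl⟩, _, ⟨a, ha, rfl⟩, rfl⟩
  · rw [← HatAlg.set_sp, hAA.sp_eq, ← h₁, set_adSp_eq, A.set_sp, HatAlg.sp, boxR_gen, gen_comp]
    refine congrArg (fun S : Set (Φ.Op (L ⊗ L)) =>
      ((closedSpan S : Submodule ℂ (Φ.Op (L ⊗ L))) : Set (Φ.Op (L ⊗ L)))) ?_
    ext x
    constructor
    · rintro ⟨_, ⟨b, hb, rfl⟩, _, ⟨a, ha, rfl⟩, rfl⟩
      exact ⟨a, ha, b, hb, rfl⟩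
    · rintro ⟨a, ha, b, hb, rfl⟩
      exact ⟨_, ⟨b, hb, rfl⟩, _, ⟨a, ha, rfl⟩, rfl⟩

end Bialgebra

/-! ### Multiplicative unitaries and the braiding -/

section Legs

variable {D : Type u} [Category.{v} D] {X : D} {f₁ f₂ c₁ c₂ : X ≅ X}

/-- The multiplicativity relation, inverted. Here and below, `f₁, f₂` and `c₁, c₂` stand for the
legs `F₁₂, F₂₃` and `c₁₂, c₂₃`. -/
theorem leg_inv_of_mul
    (hmul : f₁.hom ≫ f₂.hom = f₂.hom ≫ c₁.hom ≫ f₂.hom ≫ c₁.inv ≫ f₁.hom) :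
    f₁.inv ≫ c₁.hom ≫ f₂.inv ≫ c₁.inv ≫ f₂.inv = f₂.inv ≫ f₁.inv := by
  rw [← cancel_epi f₂.hom, ← cancel_epi f₁.hom, reassoc_of% hmul]
  simp

/-- Multiplicativity with a copy of the braiding inserted. -/
theorem leg_conj_of_mul
    (hmul : f₁.hom ≫ f₂.hom = f₂.hom ≫ c₁.hom ≫ f₂.hom ≫ c₁.inv ≫ f₁.hom)
    (hf : f₁.hom ≫ c₂.hom ≫ c₁.hom = c₂.hom ≫ c₁.hom ≫ f₂.hom) :
    f₁.inv ≫ f₂.hom ≫ c₂.inv ≫ f₁.hom = f₂.hom ≫ f₁.inv ≫ c₂.inv := by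
  have h : c₂.inv ≫ f₁.hom = c₁.hom ≫ f₂.hom ≫ c₁.inv ≫ c₂.inv := by
    rw [Iso.inv_comp_eq, ← reassoc_of% hf]
    simp
  rw [Iso.inv_comp_eq, reassoc_of% hmul, h]
  simp

/-- The multiplicativity relation for `F⁻¹` followed by the braiding. The hypotheses `hf` and
`hf'` are naturality of the braiding, and `hc` is the Yang–Baxter equation. -/
theorem leg_comul_of_mul
    (hmul : f₁.hom ≫ f₂.hom = f₂.hom ≫ c₁.hom ≫ f₂.hom ≫ c₁.inv ≫ f₁.hom)
    (hf : f₁.hom ≫ c₂.hom ≫ c₁.hom = c₂.hom ≫ c₁.hom ≫ f₂.hom)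
    (hf' : f₂.hom ≫ c₁.hom ≫ c₂.hom = c₁.hom ≫ c₂.hom ≫ f₁.hom)
    (hc : c₁.hom ≫ c₂.hom ≫ c₁.hom = c₂.hom ≫ c₁.hom ≫ c₂.hom) :
    c₁.inv ≫ f₁.hom ≫ f₂.inv ≫ c₂.hom ≫ c₁.hom ≫ f₂.inv ≫ c₂.hom =
      f₂.inv ≫ c₂.hom ≫ f₁.inv ≫ c₁.hom := by
  have h1 : c₂.hom ≫ c₁.hom ≫ f₂.inv = f₁.inv ≫ c₂.hom ≫ c₁.hom := by
    rw [← cancel_mono f₂.hom]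
    simp only [Category.assoc, Iso.inv_hom_id, Category.comp_id]
    rw [← hf, Iso.inv_hom_id_assoc]
  have h2 : f₂.inv ≫ c₁.hom ≫ c₂.hom = c₁.hom ≫ c₂.hom ≫ f₁.inv := by
    rw [Iso.inv_comp_eq, reassoc_of% hf', Iso.hom_inv_id, Category.comp_id]
  rw [reassoc_of% h1, ← hc, ← reassoc_of% (leg_inv_of_mul hmul), reassoc_of% h2]
  simp only [Iso.hom_inv_id_assoc, Iso.inv_hom_id_assoc]

end Legs

section Multiplicative

variable {D : Type u} [Category.{v} D] [MonoidalCategory D] (c : BraidedCategory D) {L : D}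

/-- An endomorphism of `L ⊗ L` can be pulled through a third strand. -/
theorem whiskerRight_comp_braiding (G : L ⊗ L ⟶ L ⊗ L) :
    G ▷ L ≫ ((α_ L L L).hom ≫ L ◁ (c.braiding L L).hom ≫ (α_ L L L).inv) ≫
        (c.braiding L L).hom ▷ L =
      ((α_ L L L).hom ≫ L ◁ (c.braiding L L).hom ≫ (α_ L L L).inv) ≫ (c.braiding L L).hom ▷ L ≫
        (α_ L L L).hom ≫ L ◁ G ≫ (α_ L L L).inv := by
  have h := BraidedCategory.braiding_naturality_left G L
  rw [BraidedCategory.braiding_tensor_left_hom] at h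
  rw [← cancel_mono (α_ L L L).hom]
  simpa only [Category.assoc, Iso.inv_hom_id, Category.comp_id] using h

/-- An endomorphism of `L ⊗ L` can be pulled through a first strand. -/
theorem whiskerLeft_comp_braiding (G : L ⊗ L ⟶ L ⊗ L) :
    ((α_ L L L).hom ≫ L ◁ G ≫ (α_ L L L).inv) ≫ (c.braiding L L).hom ▷ L ≫
        (α_ L L L).hom ≫ L ◁ (c.braiding L L).hom ≫ (α_ L L L).inv =
      (c.braiding L L).hom ▷ L ≫ ((α_ L L L).hom ≫ L ◁ (c.braiding L L).hom ≫ (α_ L L L).inv) ≫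
        G ▷ L := by
  have h := BraidedCategory.braiding_naturality_right L G
  rw [BraidedCategory.braiding_tensor_right_hom] at h
  rw [← cancel_epi (α_ L L L).inv]
  simpa only [Category.assoc, Iso.inv_hom_id_assoc] using h

variable {c} {F : L ⊗ L ≅ L ⊗ L}

/-- The multiplicativity relation `F₂₃ F₁₂ = F₁₂ (c⁻¹)₁₂ F₂₃ c₁₂ F₂₃` for an isomorphism `F` of a
braided category. -/
def IsMul (c : BraidedCategory D) (F : L ⊗ L ≅ L ⊗ L) : Prop :=
  F.hom ▷ L ≫ (α_ L L L).hom ≫ L ◁ F.hom ≫ (α_ L L L).inv =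
    ((α_ L L L).hom ≫ L ◁ F.hom ≫ (α_ L L L).inv) ≫ (c.braiding L L).hom ▷ L ≫
      ((α_ L L L).hom ≫ L ◁ F.hom ≫ (α_ L L L).inv) ≫ (c.braiding L L).inv ▷ L ≫ F.hom ▷ L

/-- An isomorphism of `L ⊗ L`, acting on the first two strands. -/
@[simps!] def legFst (F : L ⊗ L ≅ L ⊗ L) : (L ⊗ L) ⊗ L ≅ (L ⊗ L) ⊗ L := whiskerRightIso F L

/-- An isomorphism of `L ⊗ L`, acting on the last two strands. -/
@[simps!] def legSnd (F : L ⊗ L ≅ L ⊗ L) : (L ⊗ L) ⊗ L ≅ (L ⊗ L) ⊗ L :=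
  α_ L L L ≪≫ whiskerLeftIso L F ≪≫ (α_ L L L).symm

theorem IsMul.legs (h : IsMul c F) : (legFst F).hom ≫ (legSnd F).hom = (legSnd F).hom ≫
    (legFst (c.braiding L L)).hom ≫ (legSnd F).hom ≫ (legFst (c.braiding L L)).inv ≫
      (legFst F).hom := by
  rw [IsMul] at h
  simpa only [legFst_hom, legFst_inv, legSnd_hom, Category.assoc] using h

/-- The relation that makes the slices of `F` an algebra. -/
theorem IsMul.conj_whiskerRight (h : IsMul c F) :
    F.inv ▷ L ≫ (α_ L L L).hom ≫ L ◁ (F.hom ≫ (c.braiding L L).inv) ≫ (α_ L L L).inv ≫ F.hom ▷ L =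
      (α_ L L L).hom ≫ L ◁ F.hom ≫ (α_ L L L).inv ≫ F.inv ▷ L ≫ (α_ L L L).hom ≫
        L ◁ (c.braiding L L).inv ≫ (α_ L L L).inv := by
  have h1 := leg_conj_of_mul (c₂ := legSnd (c.braiding L L)) h.legs
    (by simpa using whiskerRight_comp_braiding c F.hom)
  simpa using h1

/-- The relation behind the Podleś conditions. -/
theorem IsMul.comul (h : IsMul c F) :
    F.hom ▷ L ≫ (α_ L L L).hom ≫ L ◁ F.hom ≫ (α_ L L L).inv ≫ F.inv ▷ L =
      (α_ L L L).hom ≫ L ◁ F.hom ≫ (α_ L L L).inv ≫ (c.braiding L L).hom ▷ L ≫ (α_ L L L).hom ≫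
        L ◁ F.hom ≫ (α_ L L L).inv ≫ (c.braiding L L).inv ▷ L := by
  have h1 := congrArg (· ≫ F.inv ▷ L) h
  simpa using h1

/-- The relation behind coassociativity of `a ↦ F⁻¹ (id ⊗ a) F` for the inverse braiding. -/
theorem IsMul.coassoc_inv (h : IsMul c F) :
    (α_ L L L).inv ≫ (F.symm ≪≫ c.braiding L L).hom ▷ L ≫ (α_ L L L).hom ≫ L ◁ F.symm.hom ≫
        (α_ L L L).inv ≫ (c.braiding L L).inv ▷ L ≫ (α_ L L L).hom ≫ L ◁ F.symm.hom =
      L ◁ F.symm.hom ≫ (α_ L L L).inv ≫ F.symm.hom ▷ L ≫ (α_ L L L).hom := by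
  have h1 := leg_inv_of_mul h.legs
  rw [← cancel_mono (α_ L L L).inv, ← cancel_epi (α_ L L L).hom]
  simpa using h1

/-- The relation behind coassociativity of `a ↦ c F⁻¹ (id ⊗ a) F c⁻¹` for the braiding. -/
theorem IsMul.coassoc (h : IsMul c F) :
    (α_ L L L).inv ≫ ((c.braiding L L).symm ≪≫ F).hom ▷ L ≫ (α_ L L L).hom ≫
        L ◁ (F.symm ≪≫ c.braiding L L).hom ≫ (α_ L L L).inv ≫ (c.braiding L L).hom ▷ L ≫
        (α_ L L L).hom ≫ L ◁ (F.symm ≪≫ c.braiding L L).hom =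
      L ◁ (F.symm ≪≫ c.braiding L L).hom ≫ (α_ L L L).inv ≫ (F.symm ≪≫ c.braiding L L).hom ▷ L ≫
        (α_ L L L).hom := by
  have h1 := leg_comul_of_mul (c₂ := legSnd (c.braiding L L)) h.legs
    (by simpa using whiskerRight_comp_braiding c F.hom)
    (by simpa using whiskerLeft_comp_braiding c F.hom)
    (by simpa using whiskerRight_comp_braiding c (c.braiding L L).hom)
  rw [← cancel_mono (α_ L L L).inv, ← cancel_epi (α_ L L L).hom]
  simpa using h1

end Multiplicative

/-! ### The bialgebras of a regular multiplicative unitary -/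

section Main

variable {C : Type u} [Category.{v} C] [MonoidalCategory C] [MonoidalWStarCategory C]
  {Φ : FibreFunctor.{w} C} {c : BraidedCategory C} {L : C} {F : L ⊗ L ≅ L ⊗ L}

theorem OpSp.hom_subsingleton {X Y : OpSp Φ} (h : Subsingleton (Φ.obj Y.as.as)) (P Q : X ⟶ Y) :
    P = Q := by
  refine set_injective (Set.ext fun f => ?_)
  have hf : f = 0 := ContinuousLinearMap.ext fun x => h.elim _ _
  rw [hf]
  exact iff_of_true (zero_mem_set P) (zero_mem_set Q)

/-- The instance of `slice_ketR_comp` for a regular multiplicative unitary. -/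
theorem slice_comp_ketR_of_regular (hc : IsRegularSp Φ c) (hF : IsUnitaryHom F.hom)
    (hmul : IsMul c F)
    (hreg : sliceJ Φ (F.hom ≫ (c.braiding L L).inv) = bra ⟨⟨L⟩⟩ ≫ ket ⟨⟨L⟩⟩) :
    dag (sliceJ Φ F.hom) ≫ ketR ⟨⟨L⟩⟩ ⟨⟨L⟩⟩ ≫ J Φ F.hom =
      dag (sliceJ Φ F.hom) ≫ ketR ⟨⟨L⟩⟩ ⟨⟨L⟩⟩ := by
  have h1 := congrArg (J Φ) hmul.conj_whiskerRight
  simp only [J_comp, J_whiskerLeft, J_whiskerRight] at h1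
  have h2 : dag (sliceJ Φ F.hom) = sliceJ Φ F.inv := by
    rw [sliceJ, dag_slice, sliceJ]
    exact congrArg slice (dag_J_iso hF)
  rw [sliceJ, J_comp] at hreg
  rw [h2]
  refine slice_ketR_comp (L := (⟨⟨L⟩⟩ : OpSp Φ)) (F := J Φ F.hom) (F' := J Φ F.inv)
    (c' := J Φ (c.braiding L L).inv) ?_ ?_ ?_ ?_
  · exact ket_iso F
  · exact hc.slice_inv L L
  · exact hreg
  · exact h1

/-- The algebra of slices of a regular multiplicative unitary. -/
theorem exists_hatAlg (hc : IsRegularSp Φ c) (hF : IsUnitaryHom F.hom)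
    (hmul : IsMul c F)
    (hreg : sliceJ Φ (F.hom ≫ (c.braiding L L).inv) = bra ⟨⟨L⟩⟩ ≫ ket ⟨⟨L⟩⟩) :
    ∃ A : HatAlg Φ L, A.sp = sliceJ Φ F.hom ∧ A.sp ≫ A.sp = A.sp ∧
      A.sp ≫ ketR ⟨⟨L⟩⟩ ⟨⟨L⟩⟩ ≫ J Φ F.hom = A.sp ≫ ketR ⟨⟨L⟩⟩ ⟨⟨L⟩⟩ := by
  have h1 := slice_comp_ketR_of_regular hc hF hmul hreg
  have h2 : (dag (sliceJ Φ F.hom) = sliceJ Φ F.hom ∧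
      sliceJ Φ F.hom ≫ sliceJ Φ F.hom = sliceJ Φ F.hom) ∧
      ket ⟨⟨L⟩⟩ ≫ sliceJ Φ F.hom = ket ⟨⟨L⟩⟩ := by
    rcases subsingleton_or_nontrivial (Φ.obj L) with hL | hL
    -- over the zero Hilbert space all spaces of operators agree
    · exact ⟨⟨hom_subsingleton hL _ _, hom_subsingleton hL _ _⟩, hom_subsingleton hL _ _⟩
    · rw [sliceJ, dag_slice] at h1
      exact ⟨slice_selfAdjoint (L := (⟨⟨L⟩⟩ : OpSp Φ)) rfl h1,
        ket_slice (L := (⟨⟨L⟩⟩ : OpSp Φ)) (ket_iso F)⟩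
  refine ⟨HatAlg.ofSp _ h2.1.1 h2.1.2 ⟨L, F.hom, rfl⟩ h2.2, ?_⟩
  rw [HatAlg.sp_ofSp]
  rw [h2.1.1] at h1
  exact ⟨rfl, h2.1.2, h1⟩

/-- The two absorption relations behind the Podleś conditions for `F⋆ (id ⊗ a) F`. -/
theorem comp_adSp_symm (hF : IsUnitaryHom F.hom)
    (hmul : IsMul c F) {A : HatAlg Φ L} (hA : A.sp = sliceJ Φ F.hom)
    (hAF : A.sp ≫ ketR ⟨⟨L⟩⟩ ⟨⟨L⟩⟩ ≫ J Φ F.hom = A.sp ≫ ketR ⟨⟨L⟩⟩ ⟨⟨L⟩⟩) :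
    boxR L A.sp ≫ adSp F.symm A.sp = boxR L A.sp ≫ boxL (inverseBraiding c) L A.sp ∧
      adSp F.symm A.sp ≫ boxL (inverseBraiding c) L A.sp =
        boxR L A.sp ≫ boxL (inverseBraiding c) L A.sp := by
  have h1 := congrArg (J Φ) hmul.comul
  simp only [J_comp, J_whiskerLeft, J_whiskerRight] at h1
  have hJ : J Φ F.hom ≫ J Φ F.inv = 𝟙 _ := (JIso Φ F).hom_inv_id
  have h2 : J Φ F.hom ≫ braR ⟨⟨L⟩⟩ ⟨⟨L⟩⟩ ≫ A.sp = braR ⟨⟨L⟩⟩ ⟨⟨L⟩⟩ ≫ A.sp := by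
    have h3 : A.sp ≫ ketR ⟨⟨L⟩⟩ ⟨⟨L⟩⟩ ≫ J Φ F.inv = A.sp ≫ ketR ⟨⟨L⟩⟩ ⟨⟨L⟩⟩ := by
      conv_rhs => rw [← Category.comp_id (ketR _ _)]
      have := congrArg (· ≫ J Φ F.inv) hAF
      simp only [Category.assoc] at this
      exact this.symm.trans (congrArg (fun P => A.sp ≫ ketR (⟨⟨L⟩⟩ : OpSp Φ) ⟨⟨L⟩⟩ ≫ P) hJ)
    have h4 := congrArg dag h3
    have h5 : dag (J Φ F.inv) = J Φ F.hom := by rw [← dag_J_iso hF, dag_dag]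
    simp only [dag_comp, dag_ketR, A.dag_sp, h5, Category.assoc] at h4
    exact h4
  exact ⟨whiskerLeft_comp_comul (L := (⟨⟨L⟩⟩ : OpSp Φ)) (F := J Φ F.hom) (F' := J Φ F.inv)
      (c := JIso Φ (c.braiding L L)) hA hAF h1,
    comul_comp_cross (L := (⟨⟨L⟩⟩ : OpSp Φ)) (F := J Φ F.hom) (F' := J Φ F.inv)
      (c := JIso Φ (c.braiding L L)) hA h2 h1⟩

/-- Conjugation with the braiding carries the absorption relations for the inverse braiding to
those for the braiding. -/
theorem comp_adSp_trans_braiding (hc : IsRegularSp Φ c) {A : HatAlg Φ L} {V : L ⊗ L ≅ L ⊗ L}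
    (hV : IsUnitaryHom V.hom)
    (h₁ : boxR L A.sp ≫ adSp V A.sp = boxR L A.sp ≫ boxL (inverseBraiding c) L A.sp)
    (h₂ : adSp V A.sp ≫ boxL (inverseBraiding c) L A.sp =
        boxR L A.sp ≫ boxL (inverseBraiding c) L A.sp) :
    boxR L A.sp ≫ adSp (V ≪≫ c.braiding L L) A.sp = boxR L A.sp ≫ boxL c L A.sp ∧
      adSp (V ≪≫ c.braiding L L) A.sp ≫ boxL c L A.sp = boxR L A.sp ≫ boxL c L A.sp := by
  have hcomm := (box_comm hc.inverse A A).1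
  have h₁' := congrArg dag h₁
  have h₂' := congrArg dag h₂
  rw [dag_comp, dag_comp, dag_boxL hc.inverse, dag_boxR, dag_adSp hV, A.dag_sp] at h₁' h₂'
  have hJ : J Φ (c.braiding L L).hom ≫ J Φ (c.braiding L L).inv = 𝟙 _ :=
    (JIso Φ (c.braiding L L)).hom_inv_id
  have hJ' : J Φ (c.braiding L L).inv ≫ J Φ (c.braiding L L).hom = 𝟙 _ :=
    (JIso Φ (c.braiding L L)).inv_hom_id
  have hL : boxL c L A.sp = J Φ (c.braiding L L).inv ≫ boxR L A.sp ≫ J Φ (c.braiding L L).hom :=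
    rfl
  have hL' : boxL (inverseBraiding c) L A.sp =
      J Φ (c.braiding L L).hom ≫ boxR L A.sp ≫ J Φ (c.braiding L L).inv := rfl
  have hD : adSp (V ≪≫ c.braiding L L) A.sp =
      J Φ (c.braiding L L).inv ≫ adSp V A.sp ≫ J Φ (c.braiding L L).hom := by
    change (J Φ (V ≪≫ c.braiding L L).inv ≫ (⟨⟨L⟩⟩ : OpSp Φ) ◁ A.sp ≫
      J Φ (V ≪≫ c.braiding L L).hom) = _ ≫ (J Φ V.inv ≫ (⟨⟨L⟩⟩ : OpSp Φ) ◁ A.sp ≫ J Φ V.hom) ≫ _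
    simp only [Iso.trans_hom, Iso.trans_inv, J_comp, Category.assoc]
  have hR : boxR L A.sp ≫ J Φ (c.braiding L L).inv =
      J Φ (c.braiding L L).inv ≫ boxL (inverseBraiding c) L A.sp := by
    rw [hL', reassoc_of% hJ']
  refine ⟨?_, ?_⟩
  · rw [hD, hL, reassoc_of% hR, reassoc_of% h₂', ← reassoc_of% hR]
  · rw [hD, hL, reassoc_of% hR]
    simp only [Category.assoc]
    rw [reassoc_of% hJ, reassoc_of% h₁']

theorem hatDeltaOp_eq_adOp (hF : IsUnitaryHom F.hom) :
    hatDeltaOp (Φ := Φ) F.hom = Φ.adOp F.symm := by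
  funext a
  rw [hatDeltaOp, hF.adj_hom]
  rfl

theorem hatDelta_eq_adOp (hF : IsUnitaryHom F.hom) :
    hatDelta (Φ := Φ) c F.hom = Φ.adOp (F.symm ≪≫ c.braiding L L) := by
  funext a
  rw [hatDelta, hatDeltaOp_eq_adOp hF, FibreFunctor.adOp, FibreFunctor.adOp, FibreFunctor.conj,
    FibreFunctor.conj, FibreFunctor.conj, Iso.trans_hom, Iso.trans_inv, Φ.map_comp, Φ.map_comp]
  rfl

end Main

theorem mainTheorem1 {C : Type u} [Category.{v} C] [MonoidalCategory C]
    [MonoidalWStarCategory C] (Φ : FibreFunctor.{w} C) (c : BraidedCategory C)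
    (hc : Φ.IsRegularBraiding c) {L : C} (F : L ⊗ L ⟶ L ⊗ L)
    (hF : IsMultiplicativeUnitary c F) (hreg : IsRegularUnitary Φ c F) :
    ∃ A : HatAlg Φ L, (A.alg : Set (Φ.Op L)) = Φ.slices F ∧
      IsBisimplifiableBialgebra (inverseBraiding c) A (hatDeltaOp F) ∧
      IsBisimplifiableBialgebra c A (hatDelta c F) := by
  have hc' := hc.isRegularSp
  let G : L ⊗ L ≅ L ⊗ L := ⟨F, adj F, hF.1.1, hF.1.2⟩
  have hG : IsUnitaryHom G.hom := hF.1
  have hmul : IsMul c G := hF.2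
  have hreg' : sliceJ Φ (G.hom ≫ (c.braiding L L).inv) = bra ⟨⟨L⟩⟩ ≫ ket ⟨⟨L⟩⟩ :=
    set_injective (by rw [set_sliceJ, set_bra_ket]; exact hreg)
  obtain ⟨A, hA, hAA, hAF⟩ := exists_hatAlg hc' hG hmul hreg'
  obtain ⟨h₁, h₂⟩ := comp_adSp_symm hG hmul hA hAF
  obtain ⟨h₃, h₄⟩ := comp_adSp_trans_braiding hc' hG.inv h₁ h₂
  refine ⟨A, by rw [← A.set_sp, hA, set_sliceJ], ?_, ?_⟩
  · rw [show hatDeltaOp F = Φ.adOp G.symm from hatDeltaOp_eq_adOp hG]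
    exact isBisimplifiableBialgebra_adOp hc'.inverse hAA hG.inv h₁ h₂ hmul.coassoc_inv
  · rw [show hatDelta c F = Φ.adOp (G.symm ≪≫ c.braiding L L) from hatDelta_eq_adOp hG]
    exact isBisimplifiableBialgebra_adOp hc' hAA (hG.inv.comp (hc'.unitary L L)) h₃ h₄
      hmul.coassoc
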